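/- Let $\mathfrak{C}$ be a semistrict monoidal 2-category (Gray monoid) with product $\Box$ and unit $\mathbf I$, and let $\mathfrak{M}$ be a $\mathfrak{C}$-enriched 2-category, with hom objects $\mathfrak{M}[x,y]$, compositions $m_{x,y,z}:\mathfrak{M}[y,z]\,\Box\,\mathfrak{M}[x,y]\to\mathfrak{M}[x,z]$, units $j_x:\mathbf I\to\mathfrak{M}[x,x]$, and invertible associators and unitors satisfying the pentagon and triangle equations. For each object $x$ write $A_x=\mathfrak{M}[x,x]$, an algebra (pseudomonoid) in $\mathfrak{C}$ with multiplication $m_{x,x,x}$ and unit $j_x$. Let $f:x\to y$ be a 1-morphism of $\mathfrak{M}$, i.e. a 1-morphism $f:\mathbf I\to\mathfrak{M}[x,y]$ in $\mathfrak{C}$. Put $f_*=m_{x,x,y}\circ(f\,\Box\,1):A_x\to\mathfrak{M}[x,y]$ and $f^*=m_{x,y,y}\circ(1\,\Box\,f):A_y\to\mathfrak{M}[x,y]$. Suppose that $p_x:A_f\to A_x$, $p_y:A_f\to A_y$ and the invertible 2-morphism $\varpi:f_*p_x\Rightarrow f^*p_y$ form a 2-fiber product of $f_*$ and $f^*$;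 that is: 1. for all $p:B\to A_x$, $q:B\to A_y$ and invertible $\xi:f_*p\Rightarrow f^*q$ there are $u:B\to A_f$ and invertible $\zeta_x:p_xu\Rightarrow p$, $\zeta_y:p_yu\Rightarrow q$ with $\xi\cdot(f_*\zeta_x)=(f^*\zeta_y)\cdot(\varpi u)$ (we say that $(u,\zeta_x,\zeta_y)$ is induced by $\xi$); 2. for all $u,v:B\to A_f$ and 2-morphisms $\gamma_x:p_xu\Rightarrow p_xv$, $\gamma_y:p_yu\Rightarrow p_yv$ with $(\varpi v)\cdot(f_*\gamma_x)=(f^*\gamma_y)\cdot(\varpi u)$ there is a unique $\theta:u\Rightarrow v$ with $p_x\theta=\gamma_x$ and $p_y\theta=\gamma_y$. Let $\xi_m: f_*\, m_{x,x,x}(p_x\Box p_x)\Rightarrow f^*\, m_{y,y,y}(p_y\Box p_y)$ be the composite invertible 2-morphism $$f_*m_{x,x,x}(p_x\Box p_x)\cong m_{x,x,y}(f_*p_x\Box p_x)\overset{\varpi}{\cong} m_{x,x,y}(f^*p_y\Box p_x)\cong m_{x,y,y}(p_y\Box f_*p_x)\overset{\varpi}{\cong} m_{x,y,y}(p_y\Box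 f^*p_y)\cong f^*m_{y,y,y}(p_y\Box p_y),$$ and let $\xi_i:f_*j_x\cong f\cong f^*j_y$, where the unlabelled isomorphisms are composites of associators and unitors of $\mathfrak{M}$ and interchangers of $\mathfrak{C}$. Then there exist $(m_f:A_f\Box A_f\to A_f,\ \psi_x^{-1},\psi_y^{-1})$ induced by $\xi_m$ and $(i_f:\mathbf I\to A_f,\ \eta_x^{-1},\eta_y^{-1})$ induced by $\xi_i$. Moreover, for every such choice there is exactly one triple consisting of an associator, a left unitor and a right unitor which makes $(A_f,m_f,i_f)$ an algebra in $\mathfrak{C}$ in such a way that $(p_x,\psi_x,\eta_x):A_f\to A_x$ and $(p_y,\psi_y,\eta_y):A_f\to A_y$ are algebra 1-morphisms. In particular $A_x\xleftarrow{p_x}A_f\xrightarrow{p_y}A_y$ is a span of algebras in $\mathfrak{C}$. -/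

import Mathlib

open CategoryTheory Bicategory

universe w v u t

/-- A semistrict monoidal 2-category (Gray monoid): a monoid for the Gray tensor product, on a
strict 2-category `C`.  Explicitly: a unit object, a tensor product of objects, strict 2-functors
`A ⊡ -` (`wl`, `wl₂`) and `- ⊡ B` (`wr`, `wr₂`), and invertible interchangers
`(A ⊡ g) ; (f ⊡ B') ≅ (f ⊡ B) ; (A' ⊡ g)`, natural in and compatible with composition of both
arguments, such that the tensor product is strictly associative and unital.  Equations between
cells whose boundaries agree only through `tensor_assoc`, `unit_tensor` and `tensor_unit` are
stated as `HEq`; the composite of 1-cells is written in diagrammatic order. -/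
class GrayMonoid (C : Type u) [Bicategory.{w, v} C] [Bicategory.Strict C] where
  /-- the monoidal unit -/
  unit : C
  /-- the tensor product of objects -/
  tensor : C → C → C
  /-- `A ⊡ g` for a 1-cell `g` -/
  wl (A : C) {B B' : C} (g : B ⟶ B') : tensor A B ⟶ tensor A B'
  /-- `f ⊡ B` for a 1-cell `f` -/
  wr {A A' : C} (f : A ⟶ A') (B : C) : tensor A B ⟶ tensor A' B
  /-- `A ⊡ θ` for a 2-cell `θ` -/
  wl₂ (A : C) {B B' : C} {g g' : B ⟶ B'} (θ : g ⟶ g') : wl A g ⟶ wl A g'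
  /-- `η ⊡ B` for a 2-cell `η` -/
  wr₂ {A A' : C} {f f' : A ⟶ A'} (η : f ⟶ f') (B : C) : wr f B ⟶ wr f' B
  -- `A ⊡ -` is a strict 2-functor
  wl_id (A B : C) : wl A (𝟙 B) = 𝟙 (tensor A B)
  wl_comp (A : C) {B B' B'' : C} (g : B ⟶ B') (g' : B' ⟶ B'') :
    wl A (g ≫ g') = wl A g ≫ wl A g'
  wl₂_id (A : C) {B B' : C} (g : B ⟶ B') : wl₂ A (𝟙 g) = 𝟙 (wl A g)
  wl₂_comp (A : C) {B B' : C} {g g' g'' : B ⟶ B'} (θ : g ⟶ g') (θ' : g' ⟶ g'') :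
    wl₂ A (θ ≫ θ') = wl₂ A θ ≫ wl₂ A θ'
  wl₂_whiskerLeft (A : C) {B B' B'' : C} (h : B ⟶ B') {g g' : B' ⟶ B''} (θ : g ⟶ g') :
    wl₂ A (h ◁ θ) =
      eqToHom (wl_comp A h g) ≫ wl A h ◁ wl₂ A θ ≫ eqToHom (wl_comp A h g').symm
  wl₂_whiskerRight (A : C) {B B' B'' : C} {g g' : B ⟶ B'} (θ : g ⟶ g') (h : B' ⟶ B'') :
    wl₂ A (θ ▷ h) =
      eqToHom (wl_comp A g h) ≫ wl₂ A θ ▷ wl A h ≫ eqToHom (wl_comp A g' h).symm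
  -- `- ⊡ B` is a strict 2-functor
  wr_id (A B : C) : wr (𝟙 A) B = 𝟙 (tensor A B)
  wr_comp {A A' A'' : C} (f : A ⟶ A') (f' : A' ⟶ A'') (B : C) :
    wr (f ≫ f') B = wr f B ≫ wr f' B
  wr₂_id {A A' : C} (f : A ⟶ A') (B : C) : wr₂ (𝟙 f) B = 𝟙 (wr f B)
  wr₂_comp {A A' : C} {f f' f'' : A ⟶ A'} (η : f ⟶ f') (η' : f' ⟶ f'') (B : C) :
    wr₂ (η ≫ η') B = wr₂ η B ≫ wr₂ η' B
  wr₂_whiskerLeft {A A' A'' : C} (h : A ⟶ A') {f f' : A' ⟶ A''} (η : f ⟶ f') (B : C) :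
    wr₂ (h ◁ η) B =
      eqToHom (wr_comp h f B) ≫ wr h B ◁ wr₂ η B ≫ eqToHom (wr_comp h f' B).symm
  wr₂_whiskerRight {A A' A'' : C} {f f' : A ⟶ A'} (η : f ⟶ f') (h : A' ⟶ A'') (B : C) :
    wr₂ (η ▷ h) B =
      eqToHom (wr_comp f h B) ≫ wr₂ η B ▷ wr h B ≫ eqToHom (wr_comp f' h B).symm
  /-- the interchanger -/
  interchanger {A A' B B' : C} (f : A ⟶ A') (g : B ⟶ B') :
    wl A g ≫ wr f B' ≅ wr f B ≫ wl A' g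
  -- the interchanger is natural with respect to 2-cells
  interchanger_naturality_left {A A' B B' : C} {f f' : A ⟶ A'} (η : f ⟶ f') (g : B ⟶ B') :
    wl A g ◁ wr₂ η B' ≫ (interchanger f' g).hom =
      (interchanger f g).hom ≫ wr₂ η B ▷ wl A' g
  interchanger_naturality_right {A A' B B' : C} (f : A ⟶ A') {g g' : B ⟶ B'} (θ : g ⟶ g') :
    wl₂ A θ ▷ wr f B' ≫ (interchanger f g').hom =
      (interchanger f g).hom ≫ wr f B ◁ wl₂ A' θ
  -- the interchanger is compatible with identities and composition of 1-cells
  interchanger_id_left (A : C) {B B' : C} (g : B ⟶ B') :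
    (interchanger (𝟙 A) g).hom =
      eqToHom (by rw [wr_id, wr_id, Strict.comp_id, Strict.id_comp])
  interchanger_id_right {A A' : C} (f : A ⟶ A') (B : C) :
    (interchanger f (𝟙 B)).hom =
      eqToHom (by rw [wl_id, wl_id, Strict.comp_id, Strict.id_comp])
  interchanger_comp_left {A A' A'' B B' : C} (f : A ⟶ A') (f' : A' ⟶ A'') (g : B ⟶ B') :
    (interchanger (f ≫ f') g).hom =
      eqToHom (by rw [wr_comp, Strict.assoc]) ≫ (interchanger f g).hom ▷ wr f' B' ≫
        (α_ _ _ _).hom ≫ wr f B ◁ (interchanger f' g).hom ≫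
          eqToHom (by rw [wr_comp, Strict.assoc])
  interchanger_comp_right {A A' B B' B'' : C} (f : A ⟶ A') (g : B ⟶ B') (g' : B' ⟶ B'') :
    (interchanger f (g ≫ g')).hom =
      eqToHom (by rw [wl_comp, Strict.assoc]) ≫ wl A g ◁ (interchanger f g').hom ≫
        (α_ _ _ _).inv ≫ (interchanger f g).hom ▷ wl A' g' ≫
          eqToHom (by rw [wl_comp, Strict.assoc])
  -- strict associativity and unitality on objects
  tensor_assoc (A B D : C) : tensor (tensor A B) D = tensor A (tensor B D)
  unit_tensor (A : C) : tensor unit A = A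
  tensor_unit (A : C) : tensor A unit = A
  -- strict associativity and unitality on 1-cells
  wl_unit {A B : C} (f : A ⟶ B) : HEq (wl unit f) f
  wr_unit {A B : C} (f : A ⟶ B) : HEq (wr f unit) f
  wl_tensor (A B : C) {D D' : C} (h : D ⟶ D') : HEq (wl (tensor A B) h) (wl A (wl B h))
  wr_wl (A : C) {B B' : C} (g : B ⟶ B') (D : C) : HEq (wr (wl A g) D) (wl A (wr g D))
  wr_wr {A A' : C} (f : A ⟶ A') (B D : C) : HEq (wr (wr f B) D) (wr f (tensor B D))
  -- strict associativity and unitality on 2-cells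
  wl₂_unit {A B : C} {f f' : A ⟶ B} (η : f ⟶ f') : HEq (wl₂ unit η) η
  wr₂_unit {A B : C} {f f' : A ⟶ B} (η : f ⟶ f') : HEq (wr₂ η unit) η
  wl₂_tensor (A B : C) {D D' : C} {h h' : D ⟶ D'} (η : h ⟶ h') :
    HEq (wl₂ (tensor A B) η) (wl₂ A (wl₂ B η))
  wr₂_wl₂ (A : C) {B B' : C} {g g' : B ⟶ B'} (η : g ⟶ g') (D : C) :
    HEq (wr₂ (wl₂ A η) D) (wl₂ A (wr₂ η D))
  wr₂_wr₂ {A A' : C} {f f' : A ⟶ A'} (η : f ⟶ f') (B D : C) :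
    HEq (wr₂ (wr₂ η B) D) (wr₂ η (tensor B D))
  -- strict associativity of the interchanger
  interchanger_wl (A : C) {B B' D D' : C} (g : B ⟶ B') (h : D ⟶ D') :
    HEq (interchanger (wl A g) h).hom (wl₂ A (interchanger g h).hom)
  interchanger_wr_wl {A A' D D' : C} (f : A ⟶ A') (B : C) (h : D ⟶ D') :
    HEq (interchanger (wr f B) h).hom (interchanger f (wl B h)).hom
  interchanger_wr {A A' B B' : C} (f : A ⟶ A') (g : B ⟶ B') (D : C) :
    HEq (interchanger f (wr g D)).hom (wr₂ (interchanger f g).hom D)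

namespace GrayMonoid

theorem comp_eqToHom_of_heq {C : Type u} [Bicategory.{w, v} C] [Bicategory.Strict C]
    {X X' Y Y' : C} {f : X ⟶ Y} {f' : X' ⟶ Y'} (hX : X = X')
    (hY : Y = Y') (h : HEq f f') : f ≫ eqToHom hY = eqToHom hX ≫ f' := by
  subst hX hY
  obtain rfl := eq_of_heq h
  simp

/-- The tensor product of objects. -/
infixr:70 " ⊡ " => GrayMonoid.tensor
/-- `A ⋉ f` is the 1-cell `A ⊡ f`. -/
infixr:82 " ⋉ " => GrayMonoid.wl
/-- `f ⋊ B` is the 1-cell `f ⊡ B`. -/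
infixl:83 " ⋊ " => GrayMonoid.wr
/-- `A ⋉₂ η` is the 2-cell `A ⊡ η`. -/
infixr:82 " ⋉₂ " => GrayMonoid.wl₂
/-- `η ⋊₂ B` is the 2-cell `η ⊡ B`. -/
infixl:83 " ⋊₂ " => GrayMonoid.wr₂

variable {C : Type u} [Bicategory.{w, v} C] [Bicategory.Strict C] [GrayMonoid C]

/-! The identity 1-cells witnessing strict associativity and unitality on objects, and the
resulting equations between 1-cells. -/

/-- The identity 1-cell `(A ⊡ B) ⊡ D = A ⊡ (B ⊡ D)`. -/
abbrev asc (A B D : C) : (A ⊡ B) ⊡ D ⟶ A ⊡ (B ⊡ D) := eqToHom (tensor_assoc A B D)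

/-- The identity 1-cell `A ⊡ (B ⊡ D) = (A ⊡ B) ⊡ D`. -/
abbrev ascInv (A B D : C) : A ⊡ (B ⊡ D) ⟶ (A ⊡ B) ⊡ D := eqToHom (tensor_assoc A B D).symm

/-- The identity 1-cell `I ⊡ A = A`. -/
abbrev lu (A : C) : (unit : C) ⊡ A ⟶ A := eqToHom (unit_tensor A)

/-- The identity 1-cell `A = I ⊡ A`. -/
abbrev luInv (A : C) : A ⟶ (unit : C) ⊡ A := eqToHom (unit_tensor A).symm

/-- The identity 1-cell `A ⊡ I = A`. -/
abbrev ru (A : C) : A ⊡ (unit : C) ⟶ A := eqToHom (tensor_unit A)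

/-- The identity 1-cell `A = A ⊡ I`. -/
abbrev ruInv (A : C) : A ⟶ A ⊡ (unit : C) := eqToHom (tensor_unit A).symm

@[simp]
theorem wl_eqToHom (A : C) {B B' : C} (h : B = B') :
    A ⋉ (eqToHom h) = eqToHom (congrArg (A ⊡ ·) h) := by
  subst h
  simp [wl_id]

@[simp]
theorem eqToHom_wr {A A' : C} (h : A = A') (B : C) :
    (eqToHom h) ⋊ B = eqToHom (congrArg (· ⊡ B) h) := by
  subst h
  simp [wr_id]

attribute [simp] wl_comp wr_comp wl_id wr_id

@[simp]
theorem wr_wr_as {A A' : C} (f : A ⟶ A') (B D : C) :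
    f ⋊ B ⋊ D ≫ asc A' B D = asc A B D ≫ f ⋊ (B ⊡ D) :=
  comp_eqToHom_of_heq _ _ (wr_wr f B D)

@[simp]
theorem wr_wr_as_comp {A A' : C} (f : A ⟶ A') (B D : C) {Z : C} (h : A' ⊡ (B ⊡ D) ⟶ Z) :
    f ⋊ B ⋊ D ≫ asc A' B D ≫ h = asc A B D ≫ f ⋊ (B ⊡ D) ≫ h := by
  rw [← Category.assoc, wr_wr_as, Category.assoc]

@[simp]
theorem wr_wl_as (A : C) {B B' : C} (g : B ⟶ B') (D : C) :
    (A ⋉ g) ⋊ D ≫ asc A B' D = asc A B D ≫ A ⋉ (g ⋊ D) :=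
  comp_eqToHom_of_heq _ _ (wr_wl A g D)

@[simp]
theorem wr_wl_as_comp (A : C) {B B' : C} (g : B ⟶ B') (D : C) {Z : C}
    (h : A ⊡ (B' ⊡ D) ⟶ Z) :
    (A ⋉ g) ⋊ D ≫ asc A B' D ≫ h = asc A B D ≫ A ⋉ (g ⋊ D) ≫ h := by
  rw [← Category.assoc, wr_wl_as, Category.assoc]

@[simp]
theorem wl_as (A B : C) {D D' : C} (h : D ⟶ D') :
    (A ⊡ B) ⋉ h ≫ asc A B D' = asc A B D ≫ A ⋉ (B ⋉ h) :=
  comp_eqToHom_of_heq _ _ (wl_tensor A B h)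

@[simp]
theorem wl_as_comp (A B : C) {D D' : C} (h : D ⟶ D') {Z : C} (k : A ⊡ (B ⊡ D') ⟶ Z) :
    (A ⊡ B) ⋉ h ≫ asc A B D' ≫ k = asc A B D ≫ A ⋉ (B ⋉ h) ≫ k := by
  rw [← Category.assoc, wl_as, Category.assoc]

@[simp]
theorem wr_asInv {A A' : C} (f : A ⟶ A') (B D : C) :
    f ⋊ (B ⊡ D) ≫ ascInv A' B D = ascInv A B D ≫ f ⋊ B ⋊ D :=
  comp_eqToHom_of_heq _ _ (wr_wr f B D).symm

@[simp]
theorem wr_asInv_comp {A A' : C} (f : A ⟶ A') (B D : C) {Z : C} (h : (A' ⊡ B) ⊡ D ⟶ Z) :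
    f ⋊ (B ⊡ D) ≫ ascInv A' B D ≫ h = ascInv A B D ≫ f ⋊ B ⋊ D ≫ h := by
  rw [← Category.assoc, wr_asInv, Category.assoc]

@[simp]
theorem wl_wl_asInv (A B : C) {D D' : C} (h : D ⟶ D') :
    A ⋉ (B ⋉ h) ≫ ascInv A B D' = ascInv A B D ≫ (A ⊡ B) ⋉ h :=
  comp_eqToHom_of_heq _ _ (wl_tensor A B h).symm

@[simp]
theorem wl_wl_asInv_comp (A B : C) {D D' : C} (h : D ⟶ D') {Z : C}
    (k : (A ⊡ B) ⊡ D' ⟶ Z) :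
    A ⋉ (B ⋉ h) ≫ ascInv A B D' ≫ k = ascInv A B D ≫ (A ⊡ B) ⋉ h ≫ k := by
  rw [← Category.assoc, wl_wl_asInv, Category.assoc]

@[simp]
theorem wl_lu {A B : C} (f : A ⟶ B) : (unit : C) ⋉ f ≫ lu B = lu A ≫ f :=
  comp_eqToHom_of_heq _ _ (wl_unit f)

@[simp]
theorem wr_ru {A B : C} (f : A ⟶ B) : f ⋊ (unit : C) ≫ ru B = ru A ≫ f :=
  comp_eqToHom_of_heq _ _ (wr_unit f)

@[simp]
theorem comp_luInv {A B : C} (f : A ⟶ B) : f ≫ luInv B = luInv A ≫ (unit : C) ⋉ f :=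
  comp_eqToHom_of_heq _ _ (wl_unit f).symm

@[simp]
theorem comp_luInv_comp {A B : C} (f : A ⟶ B) {Z : C} (h : (unit : C) ⊡ B ⟶ Z) :
    f ≫ luInv B ≫ h = luInv A ≫ (unit : C) ⋉ f ≫ h := by
  rw [← Category.assoc, comp_luInv, Category.assoc]

@[simp]
theorem comp_ruInv {A B : C} (f : A ⟶ B) : f ≫ ruInv B = ruInv A ≫ f ⋊ (unit : C) :=
  comp_eqToHom_of_heq _ _ (wr_unit f).symm

@[simp]
theorem comp_ruInv_comp {A B : C} (f : A ⟶ B) {Z : C} (h : B ⊡ (unit : C) ⟶ Z) :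
    f ≫ ruInv B ≫ h = ruInv A ≫ f ⋊ (unit : C) ≫ h := by
  rw [← Category.assoc, comp_ruInv, Category.assoc]

/-- The invertible 2-cell `A ⊡ η`. -/
@[simps]
def wlIso (A : C) {B B' : C} {g g' : B ⟶ B'} (η : g ≅ g') : A ⋉ g ≅ A ⋉ g' where
  hom := A ⋉₂ η.hom
  inv := A ⋉₂ η.inv
  hom_inv_id := by rw [← wl₂_comp, Iso.hom_inv_id, wl₂_id]
  inv_hom_id := by rw [← wl₂_comp, Iso.inv_hom_id, wl₂_id]

/-- The invertible 2-cell `η ⊡ B`. -/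
@[simps]
def wrIso {A A' : C} {f f' : A ⟶ A'} (η : f ≅ f') (B : C) : f ⋊ B ≅ f' ⋊ B where
  hom := η.hom ⋊₂ B
  inv := η.inv ⋊₂ B
  hom_inv_id := by rw [← wr₂_comp, Iso.hom_inv_id, wr₂_id]
  inv_hom_id := by rw [← wr₂_comp, Iso.inv_hom_id, wr₂_id]

/-- The 1-cell `f ⊡ f'`, by convention `f ⊡ 1` followed by `1 ⊡ f'`. -/
abbrev tensorHom {A A' B B' : C} (f : A ⟶ A') (g : B ⟶ B') : A ⊡ B ⟶ A' ⊡ B' :=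
  f ⋊ B ≫ A' ⋉ g

end GrayMonoid

open GrayMonoid

/-! ### Algebras (pseudomonoids) -/

section Algebra

variable {C : Type u} [Bicategory.{w, v} C] [Bicategory.Strict C] [GrayMonoid C]

/-- The coherence data of an algebra with a given underlying object `A`, multiplication `m` and
unit `i`: associator, left unitor and right unitor, subject to the pentagon and triangle
equations. All `eqToHom`s between 1-cells are identity 2-cells between strictly equal
composites. -/
structure AlgebraOn {A : C} (m : A ⊡ A ⟶ A) (i : (unit : C) ⟶ A) where
  /-- `m (m ⊡ 1) ≅ m (1 ⊡ m)` -/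
  assoc : m ⋊ A ≫ m ≅ asc A A A ≫ A ⋉ m ≫ m
  /-- `m (i ⊡ 1) ≅ 1` -/
  leftUnitor : i ⋊ A ≫ m ≅ lu A
  /-- `m (1 ⊡ i) ≅ 1` -/
  rightUnitor : A ⋉ i ≫ m ≅ ru A
  pentagon :
    eqToHom (by simp) ≫
      ((assoc.hom ⋊₂ A) ▷ m :
        (m ⋊ A ≫ m) ⋊ A ≫ m ⟶ (asc A A A ≫ A ⋉ m ≫ m) ⋊ A ≫ m) ≫
      eqToHom (by simp) ≫
      (asc A A A ⋊ A ≫ (A ⋉ m) ⋊ A) ◁ assoc.hom ≫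
      eqToHom (by simp) ≫
      (asc A A A ⋊ A ≫ asc A (A ⊡ A) A) ◁ (A ⋉₂ assoc.hom) ▷ m ≫
      eqToHom (by simp) =
    (m ⋊ A ⋊ A) ◁ assoc.hom ≫
      eqToHom (by simp) ≫
      asc (A ⊡ A) A A ◁ (interchanger m m).inv ▷ m ≫
      eqToHom (by simp) ≫
      (asc (A ⊡ A) A A ≫ (A ⊡ A) ⋉ m) ◁ assoc.hom ≫
      eqToHom (show _ = asc (A ⊡ A) A A ≫ asc A A (A ⊡ A) ≫ A ⋉ (A ⋉ m) ≫ A ⋉ m ≫ m by simp)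
  triangle :
    eqToHom (by simp) ≫ (rightUnitor.hom ⋊₂ A) ▷ m ≫ eqToHom (by simp) =
    ((A ⋉ i) ⋊ A) ◁ assoc.hom ≫
      eqToHom (by simp) ≫
      asc A unit A ◁ (A ⋉₂ leftUnitor.hom) ▷ m ≫
      eqToHom (show _ = ru A ⋊ A ≫ m by simp)

variable (C) in
/-- An algebra (pseudomonoid) in a Gray monoid. -/
structure Algebra₂ where
  /-- the underlying object -/
  X : C
  /-- the multiplication -/
  mul : X ⊡ X ⟶ X
  /-- the unit -/
  one : (unit : C) ⟶ X
  /-- associator, unitors and coherence -/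
  str : AlgebraOn mul one

/-- The conditions for a 1-cell `f : A ⟶ B` with invertible 2-cells `ψ : m (f ⊡ f) ≅ f m` and
`η : i ≅ f i` to be an algebra 1-morphism. -/
structure IsAlgebraHom (A B : Algebra₂ C) (f : A.X ⟶ B.X)
    (ψ : tensorHom f f ≫ B.mul ≅ A.mul ≫ f) (η : B.one ≅ A.one ≫ f) : Prop where
  /-- compatibility with associators, between 1-cells `(A ⊡ A) ⊡ A ⟶ B` -/
  assoc :
    (tensorHom f f ⋊ A.X ≫ (B.X ⊡ B.X) ⋉ f) ◁ B.str.assoc.hom ≫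
      eqToHom (by simp) ≫
      (asc A.X A.X A.X ≫ f ⋊ (A.X ⊡ A.X)) ◁ (B.X ⋉₂ ψ.hom) ▷ B.mul ≫
      eqToHom (by simp) ≫
      asc A.X A.X A.X ◁ (interchanger f A.mul).inv ▷ (B.X ⋉ f ≫ B.mul) ≫
      eqToHom (by simp) ≫
      (asc A.X A.X A.X ≫ A.X ⋉ A.mul) ◁ ψ.hom =
    eqToHom (by simp) ≫
      (tensorHom f f ⋊ A.X) ◁ (interchanger B.mul f).hom ▷ B.mul ≫
      eqToHom (by simp) ≫
      (ψ.hom ⋊₂ A.X) ▷ (B.X ⋉ f ≫ B.mul) ≫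
      eqToHom (by simp) ≫
      (A.mul ⋊ A.X) ◁ ψ.hom ≫
      eqToHom (by simp) ≫
      A.str.assoc.hom ▷ f ≫
      eqToHom (show _ = (asc A.X A.X A.X ≫ A.X ⋉ A.mul) ≫ A.mul ≫ f by simp)
  /-- compatibility with left unitors, between 1-cells `I ⊡ A ⟶ B` -/
  left_unit :
    (η.hom ⋊₂ A.X) ▷ (B.X ⋉ f ≫ B.mul) ≫
      eqToHom (by simp) ≫
      (A.one ⋊ A.X) ◁ ψ.hom ≫
      eqToHom (by simp) ≫
      A.str.leftUnitor.hom ▷ f =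
    eqToHom (by simp) ≫
      (interchanger B.one f).inv ▷ B.mul ≫
      eqToHom (by simp) ≫
      ((unit : C) ⋉ f) ◁ B.str.leftUnitor.hom ≫
      eqToHom (by simp)
  /-- compatibility with right unitors, between 1-cells `A ⊡ I ⟶ B` -/
  right_unit :
    f ⋊ (unit : C) ◁ (B.X ⋉₂ η.hom) ▷ B.mul ≫
      eqToHom (by simp) ≫
      (interchanger f A.one).inv ▷ (B.X ⋉ f ≫ B.mul) ≫
      eqToHom (by simp) ≫
      (A.X ⋉ A.one) ◁ ψ.hom ≫
      eqToHom (by simp) ≫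
      A.str.rightUnitor.hom ▷ f =
    f ⋊ (unit : C) ◁ B.str.rightUnitor.hom ≫
      eqToHom (by simp)

end Algebra

/-! ### 2-fiber products -/

section TwoFiberProduct

variable {C : Type u} [Bicategory.{w, v} C] {X Y Z P : C} {f : X ⟶ Z} {g : Y ⟶ Z}
  {p₁ : P ⟶ X} {p₂ : P ⟶ Y}

/-- A factorisation of the square `(p, q, ξ)` with vertex `A` through the square
`(p₁, p₂, φ)`. -/
structure SquareLift (φ : p₁ ≫ f ≅ p₂ ≫ g) {A : C} {p : A ⟶ X} {q : A ⟶ Y}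
    (ξ : p ≫ f ≅ q ≫ g) where
  /-- the induced 1-cell -/
  u : A ⟶ P
  /-- the first comparison -/
  ζ₁ : u ≫ p₁ ≅ p
  /-- the second comparison -/
  ζ₂ : u ≫ p₂ ≅ q
  comm : ζ₁.hom ▷ f ≫ ξ.hom =
    (α_ u p₁ f).hom ≫ u ◁ φ.hom ≫ (α_ u p₂ g).inv ≫ ζ₂.hom ▷ g

/-- The square `φ : f ∘ p₁ ≅ g ∘ p₂` is a 2-fiber product. -/
structure IsTwoFiberProduct (φ : p₁ ≫ f ≅ p₂ ≫ g) : Prop where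
  exists_lift : ∀ {A : C} {p : A ⟶ X} {q : A ⟶ Y} (ξ : p ≫ f ≅ q ≫ g),
    Nonempty (SquareLift φ ξ)
  existsUnique_hom : ∀ {A : C} (a b : A ⟶ P) (γ₁ : a ≫ p₁ ⟶ b ≫ p₁) (γ₂ : a ≫ p₂ ⟶ b ≫ p₂),
    γ₁ ▷ f ≫ (α_ b p₁ f).hom ≫ b ◁ φ.hom ≫ (α_ b p₂ g).inv =
      (α_ a p₁ f).hom ≫ a ◁ φ.hom ≫ (α_ a p₂ g).inv ≫ γ₂ ▷ g →
    ∃! θ : a ⟶ b, θ ▷ p₁ = γ₁ ∧ θ ▷ p₂ = γ₂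

end TwoFiberProduct

/-! ### Enriched 2-categories -/

section Enriched

/-- A 2-category enriched over the Gray monoid `C`, with objects `Ob`. -/
structure EnrichedTwoCategory (C : Type u) [Bicategory.{w, v} C] [Bicategory.Strict C]
    [GrayMonoid C] (Ob : Type t) where
  /-- the enriched hom `[x, y]` -/
  hom : Ob → Ob → C
  /-- the enriched unit `j` -/
  one (x : Ob) : (unit : C) ⟶ hom x x
  /-- the enriched composition `[y, z] ⊡ [x, y] ⟶ [x, z]` -/
  comp (x y z : Ob) : hom y z ⊡ hom x y ⟶ hom x z
  /-- the left enriched unitor -/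
  leftUnitor (x y : Ob) : one y ⋊ hom x y ≫ comp x y y ≅ lu (hom x y)
  /-- the right enriched unitor -/
  rightUnitor (x y : Ob) : hom x y ⋉ one x ≫ comp x x y ≅ ru (hom x y)
  /-- the enriched associator -/
  assoc (x y z t : Ob) :
    comp y z t ⋊ hom x y ≫ comp x y t ≅
      asc (hom z t) (hom y z) (hom x y) ≫ hom z t ⋉ comp x y z ≫ comp x z t
  pentagon (x y z s t : Ob) :
    eqToHom (by simp) ≫
      ((assoc y z s t).hom ⋊₂ hom x y) ▷ comp x y t ≫
      eqToHom (by simp) ≫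
      (asc (hom s t) (hom z s) (hom y z) ⋊ hom x y ≫ (hom s t ⋉ comp y z s) ⋊ hom x y) ◁
        (assoc x y s t).hom ≫
      eqToHom (by simp) ≫
      (asc (hom s t) (hom z s) (hom y z) ⋊ hom x y ≫
        asc (hom s t) (hom z s ⊡ hom y z) (hom x y)) ◁
        (hom s t ⋉₂ (assoc x y z s).hom) ▷ comp x s t ≫
      eqToHom (by simp) =
    (comp z s t ⋊ hom y z ⋊ hom x y) ◁ (assoc x y z t).hom ≫
      eqToHom (by simp) ≫
      asc (hom s t ⊡ hom z s) (hom y z) (hom x y) ◁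
        (interchanger (comp z s t) (comp x y z)).inv ▷ comp x z t ≫
      eqToHom (by simp) ≫
      (asc (hom s t ⊡ hom z s) (hom y z) (hom x y) ≫ (hom s t ⊡ hom z s) ⋉ comp x y z) ◁
        (assoc x z s t).hom ≫
      eqToHom (show _ = asc (hom s t ⊡ hom z s) (hom y z) (hom x y) ≫
        asc (hom s t) (hom z s) (hom y z ⊡ hom x y) ≫
        hom s t ⋉ (hom z s ⋉ comp x y z) ≫ hom s t ⋉ comp x z s ≫ comp x s t by simp)
  triangle (x y z : Ob) :
    eqToHom (by simp) ≫ ((rightUnitor y z).hom ⋊₂ hom x y) ▷ comp x y z ≫ eqToHom (by simp) =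
    ((hom y z ⋉ one y) ⋊ hom x y) ◁ (assoc x y y z).hom ≫
      eqToHom (by simp) ≫
      asc (hom y z) unit (hom x y) ◁ (hom y z ⋉₂ (leftUnitor x y).hom) ▷ comp x y z ≫
      eqToHom (show _ = ru (hom y z) ⋊ hom x y ≫ comp x y z by simp)

namespace EnrichedTwoCategory

variable {C : Type u} [Bicategory.{w, v} C] [Bicategory.Strict C] [GrayMonoid C] {Ob : Type t}
  (M : EnrichedTwoCategory C Ob)

/-- The endo-hom algebra `A_x = [x, x]`. -/
@[simps]
def endAlgebra (x : Ob) : Algebra₂ C where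
  X := M.hom x x
  mul := M.comp x x x
  one := M.one x
  str :=
    { assoc := M.assoc x x x x
      leftUnitor := M.leftUnitor x x
      rightUnitor := M.rightUnitor x x
      pentagon := M.pentagon x x x x x
      triangle := M.triangle x x x }

/-- 1-morphisms of the underlying 2-category. -/
abbrev Mor (x y : Ob) : Type v := (unit : C) ⟶ M.hom x y

/-- `f_* : [w, x] ⟶ [w, y]`. -/
def push (w : Ob) {x y : Ob} (f : M.Mor x y) : M.hom w x ⟶ M.hom w y :=
  luInv (M.hom w x) ≫ f ⋊ M.hom w x ≫ M.comp w x y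

/-- `f^* : [y, z] ⟶ [x, z]`. -/
def pull {x y : Ob} (f : M.Mor x y) (z : Ob) : M.hom y z ⟶ M.hom x z :=
  ruInv (M.hom y z) ≫ M.hom y z ⋉ f ≫ M.comp x y z

/-- `f_* (b a) ≅ (f_* b) a`, from the interchanger and the enriched associator. -/
def pushComp (v w : Ob) {x y : Ob} (f : M.Mor x y) :
    M.comp v w x ≫ M.push v f ≅ M.push w f ⋊ M.hom v w ≫ M.comp v w y :=
  eqToIso (by simp [push]) ≪≫
    whiskerLeftIso (luInv (M.hom w x ⊡ M.hom v w))
      (whiskerRightIso (interchanger f (M.comp v w x)) (M.comp v x y)) ≪≫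
    eqToIso (show _ = (luInv (M.hom w x ⊡ M.hom v w) ≫ f ⋊ (M.hom w x ⊡ M.hom v w) ≫
      ascInv (M.hom x y) (M.hom w x) (M.hom v w)) ≫
      (asc (M.hom x y) (M.hom w x) (M.hom v w) ≫ M.hom x y ⋉ M.comp v w x ≫ M.comp v x y)
      by simp) ≪≫
    whiskerLeftIso _ (M.assoc v w x y).symm ≪≫
    eqToIso (by simp [push])

/-- `(f^* b) a ≅ b (f_* a)`, from the enriched associator. -/
def pullPush (w : Ob) {x y : Ob} (f : M.Mor x y) (z : Ob) :
    M.pull f z ⋊ M.hom w x ≫ M.comp w x z ≅ M.hom y z ⋉ M.push w f ≫ M.comp w y z :=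
  eqToIso (by simp [pull]) ≪≫
    whiskerLeftIso (ruInv (M.hom y z) ⋊ M.hom w x ≫ (M.hom y z ⋉ f) ⋊ M.hom w x)
      (M.assoc w x y z) ≪≫
    eqToIso (by simp [push])

/-- `c (f^* b) ≅ f^* (c b)`, from the enriched associator and the interchanger. -/
def compPull {x y : Ob} (f : M.Mor x y) (z t : Ob) :
    M.hom z t ⋉ M.pull f z ≫ M.comp x z t ≅ M.comp y z t ≫ M.pull f t :=
  eqToIso (show _ = (M.hom z t ⋉ ruInv (M.hom y z) ≫ M.hom z t ⋉ (M.hom y z ⋉ f) ≫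
      ascInv (M.hom z t) (M.hom y z) (M.hom x y)) ≫
      (asc (M.hom z t) (M.hom y z) (M.hom x y) ≫ M.hom z t ⋉ M.comp x y z ≫ M.comp x z t)
      by simp [pull]) ≪≫
    whiskerLeftIso _ (M.assoc x y z t).symm ≪≫
    eqToIso (by simp) ≪≫
    whiskerLeftIso (ruInv (M.hom z t ⊡ M.hom y z))
      (whiskerRightIso (interchanger (M.comp y z t) f) (M.comp x y t)) ≪≫
    eqToIso (by simp [pull])

/-- `f_* j ≅ f`, from the interchanger and the right unitor. -/
def onePush {x y : Ob} (f : M.Mor x y) : M.one x ≫ M.push x f ≅ f :=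
  eqToIso (by simp [push]) ≪≫
    whiskerLeftIso (luInv (unit : C))
      (whiskerRightIso (interchanger f (M.one x)) (M.comp x x y)) ≪≫
    eqToIso (by simp) ≪≫
    whiskerLeftIso (luInv (unit : C) ≫ f ⋊ (unit : C)) (M.rightUnitor x y) ≪≫
    eqToIso (by simp)

/-- `f^* j ≅ f`, from the interchanger and the left unitor. -/
def onePull {x y : Ob} (f : M.Mor x y) : M.one y ≫ M.pull f y ≅ f :=
  eqToIso (by simp [pull]) ≪≫
    whiskerLeftIso (ruInv (unit : C))
      (whiskerRightIso (interchanger (M.one y) f).symm (M.comp x y y)) ≪≫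
    eqToIso (by simp) ≪≫
    whiskerLeftIso (ruInv (unit : C) ≫ (unit : C) ⋉ f) (M.leftUnitor x y) ≪≫
    eqToIso (by simp)

section Square

variable {x y : Ob} (f : M.Mor x y) {P : C} {p : P ⟶ M.hom x x} {q : P ⟶ M.hom y y}
  (ϖ : p ≫ M.push x f ≅ q ≫ M.pull f y)

/-- The 2-isomorphism `f_* m (p ⊡ p) ≅ f^* m (q ⊡ q)` which induces the multiplication: move `f`
into the first factor, apply `ϖ` there, move `f` to the second factor, apply `ϖ` there, and move
`f` out. -/
def mulSquare : (tensorHom p p ≫ M.comp x x x) ≫ M.push x f ≅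
    (tensorHom q q ≫ M.comp y y y) ≫ M.pull f y :=
  eqToIso (by simp) ≪≫
    whiskerLeftIso (p ⋊ P ≫ M.hom x x ⋉ p) (M.pushComp x x f) ≪≫
    eqToIso (by simp) ≪≫
    whiskerLeftIso (p ⋊ P) (whiskerRightIso (interchanger (M.push x f) p) (M.comp x x y)) ≪≫
    eqToIso (by simp) ≪≫
    whiskerRightIso (wrIso ϖ P) (M.hom x y ⋉ p ≫ M.comp x x y) ≪≫
    eqToIso (by simp) ≪≫
    whiskerLeftIso (q ⋊ P)
      (whiskerRightIso (interchanger (M.pull f y) p).symm (M.comp x x y)) ≪≫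
    eqToIso (by simp) ≪≫
    whiskerLeftIso (q ⋊ P ≫ M.hom y y ⋉ p) (M.pullPush x f y) ≪≫
    eqToIso (by simp) ≪≫
    whiskerLeftIso (q ⋊ P) (whiskerRightIso (wlIso (M.hom y y) ϖ) (M.comp x y y)) ≪≫
    eqToIso (by simp) ≪≫
    whiskerLeftIso (q ⋊ P ≫ M.hom y y ⋉ q) (M.compPull f y y) ≪≫
    eqToIso (by simp)

/-- The 2-isomorphism `f_* j ≅ f ≅ f^* j` which induces the unit. -/
def oneSquare : M.one x ≫ M.push x f ≅ M.one y ≫ M.pull f y :=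
  M.onePush f ≪≫ (M.onePull f).symm

end Square

end EnrichedTwoCategory

end Enriched

/-! The proof replaces pasting diagrams in `C` by a calculus of generalised 1-cells. A generalised
1-cell `x ⟶ y` is any 1-cell `U : D ⟶ [x, y]`. A cell from `U` to `V` is a 1-cell `k` between the
domains (its degree) with a 2-cell `U ⟶ k ≫ V`. Composition in `M` gives a product `⊙`, functorial
in each variable, whose associator and unitors satisfy pentagon and triangle (`El.pentagon`,
`El.triangle`). The exchange law for `⊙` fails only by the interchanger of the two degrees
(`is3_interchanger`). It therefore holds strictly as soon as one of the two cells is central, that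
is, has an identity as its degree. Consequently the generalised 1-cells and central cells form an
ordinary bicategory `M.Central`.

In this language `f_* U ≅ f ⊙ U` and `f^* U ≅ U ⊙ f`, so `ϖ` becomes a lax square `f ≫ p_x ⟶ p_y ≫
f` in `M.Central`. The 2-cell `ξ_m` is this square pasted with itself (`pasteMul_square`), and `ξ_i`
is the square made of the two unitors of `f` (`pasteOne_square`). A lift of `ξ_m` is then a pair of
cells `P ⊙ P ⟶ P`, one over `A_x` and one over `A_y`, with common degree `m_f`, compatible with the
squares in the sense of `Over`. The same holds for the unit.

Algebra 1-morphisms also become simple: the axiom for the associator says that `θ` is a 3-cell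
(`Is3`) between the two ways of multiplying three copies of `P`, and likewise for the unitors
(`isAlgebraHom_iff`). Pasting three squares does not depend on the bracketing (`pasteMul_assoc`), so
both ways lie over the same square. The second clause of the universal property then gives a unique
2-cell that is a 3-cell over both `A_x` and `A_y`. It is invertible, because the argument also runs
in the opposite direction (`exists_iso_is3`). The unitors arise in the same way.

Pentagon and triangle need only be checked after composing with `p_x` and with `p_y`, which are
jointly faithful on 2-cells (`IsTwoFiberProduct.hom_ext`). There, both sides are 3-cells with the
same source and target. Since the source has an invertible 2-cell, the composite of such a 3-cell
with the projection is determined (`Is3.whiskerRight_eq`). The same remark gives uniqueness. -/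

set_option linter.unusedSimpArgs false

/-! ### Whiskered 2-cells in a strict bicategory -/

namespace GrayMonoid

section Strict
variable {C : Type u} [Bicategory.{w, v} C] [Bicategory.Strict C]

/-- The 2-cell `f ◁ σ ▷ g`, with its boundary replaced by equal 1-cells. -/
def whisk {X X' Y' Y : C} (f : X ⟶ X') {a b : X' ⟶ Y'} (σ : a ⟶ b) (g : Y' ⟶ Y)
    {s t : X ⟶ Y} (hs : s = f ≫ a ≫ g) (ht : t = f ≫ b ≫ g) : s ⟶ t :=
  eqToHom hs ≫ f ◁ (σ ▷ g) ≫ eqToHom ht.symm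

variable {X X' X'' Y'' Y' Y : C}

theorem eq_whisk {s t : X ⟶ Y} (σ : s ⟶ t) :
    σ = whisk (𝟙 X) σ (𝟙 Y) (by simp) (by simp) := by
  simp [whisk, Strict.leftUnitor_eqToIso, Strict.rightUnitor_eqToIso, id_whiskerLeft, whiskerRight_id]

/-- The trivial outer `whisk` is a seed for normalisation: the rules push it inwards until each side
is a composite of whiskered generators and all identity 2-cells are absorbed into the boundary
proofs. -/
theorem eq_iff_whisk {s t : X ⟶ Y} (σ τ : s ⟶ t) :
    σ = τ ↔ whisk (𝟙 X) σ (𝟙 Y) (s := s) (t := t) (by simp) (by simp) =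
      whisk (𝟙 X) τ (𝟙 Y) (by simp) (by simp) := by
  rw [← eq_whisk, ← eq_whisk]

theorem whisk_comp (f : X ⟶ X') {a b c : X' ⟶ Y'} (σ : a ⟶ b) (τ : b ⟶ c) (g : Y' ⟶ Y)
    {s t : X ⟶ Y} (hs : s = f ≫ a ≫ g) (ht : t = f ≫ c ≫ g) :
    whisk f (σ ≫ τ) g hs ht = whisk f σ g hs rfl ≫ whisk f τ g rfl ht := by
  simp [whisk]

theorem whisk_eqToHom (f : X ⟶ X') {a b : X' ⟶ Y'} (e : a = b) (g : Y' ⟶ Y)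
    {s t : X ⟶ Y} (hs : s = f ≫ a ≫ g) (ht : t = f ≫ b ≫ g) :
    whisk f (eqToHom e) g hs ht = eqToHom (by rw [hs, ht, e]) := by
  subst e; simp [whisk]

theorem whisk_id (f : X ⟶ X') {a : X' ⟶ Y'} (g : Y' ⟶ Y)
    {s t : X ⟶ Y} (hs : s = f ≫ a ≫ g) (ht : t = f ≫ a ≫ g) :
    whisk f (𝟙 a) g hs ht = eqToHom (by rw [hs, ht]) := by
  simp [whisk]

theorem whisk_whiskerLeft (f : X ⟶ X') (k : X' ⟶ X'') {a b : X'' ⟶ Y'} (σ : a ⟶ b) (g : Y' ⟶ Y)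
    {s t : X ⟶ Y} (hs : s = f ≫ (k ≫ a) ≫ g) (ht : t = f ≫ (k ≫ b) ≫ g) :
    whisk f (k ◁ σ) g hs ht =
      whisk (f ≫ k) σ g (by simpa using hs) (by simpa using ht) := by
  simp [whisk, Strict.associator_eqToIso]

theorem whisk_whiskerRight (f : X ⟶ X') {a b : X' ⟶ Y''} (σ : a ⟶ b) (k : Y'' ⟶ Y') (g : Y' ⟶ Y)
    {s t : X ⟶ Y} (hs : s = f ≫ (a ≫ k) ≫ g) (ht : t = f ≫ (b ≫ k) ≫ g) :
    whisk f (σ ▷ k) g hs ht =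
      whisk f σ (k ≫ g) (by simpa using hs) (by simpa using ht) := by
  simp [whisk, Strict.associator_eqToIso]

theorem whisk_whisk (f : X ⟶ X') (f' : X' ⟶ X'') {a b : X'' ⟶ Y''} (σ : a ⟶ b) (g' : Y'' ⟶ Y')
    (g : Y' ⟶ Y) {s' t' : X' ⟶ Y'} (hs' : s' = f' ≫ a ≫ g') (ht' : t' = f' ≫ b ≫ g')
    {s t : X ⟶ Y} (hs : s = f ≫ s' ≫ g) (ht : t = f ≫ t' ≫ g) :
    whisk f (whisk f' σ g' hs' ht') g hs ht =
      whisk (f ≫ f') σ (g' ≫ g) (by simp [hs, hs']) (by simp [ht, ht']) := by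
  subst hs' ht' hs ht
  simp [whisk, Strict.associator_eqToIso]

theorem whisk_comp_eqToHom (f : X ⟶ X') {a b : X' ⟶ Y'} (σ : a ⟶ b) (g : Y' ⟶ Y)
    {s t t' : X ⟶ Y} (hs : s = f ≫ a ≫ g) (ht : t = f ≫ b ≫ g) (e : t = t') :
    whisk f σ g hs ht ≫ eqToHom e = whisk f σ g hs (e.symm.trans ht) := by
  simp [whisk]

theorem eqToHom_comp_whisk (f : X ⟶ X') {a b : X' ⟶ Y'} (σ : a ⟶ b) (g : Y' ⟶ Y)
    {s t s' : X ⟶ Y} (hs : s = f ≫ a ≫ g) (ht : t = f ≫ b ≫ g) (e : s' = s) :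
    eqToHom e ≫ whisk f σ g hs ht = whisk f σ g (e.trans hs) ht := by
  simp [whisk]

theorem eqToHom_comp_whisk_assoc (f : X ⟶ X') {a b : X' ⟶ Y'} (σ : a ⟶ b) (g : Y' ⟶ Y)
    {s t s' r : X ⟶ Y} (hs : s = f ≫ a ≫ g) (ht : t = f ≫ b ≫ g) (e : s' = s) (ρ : t ⟶ r) :
    eqToHom e ≫ whisk f σ g hs ht ≫ ρ = whisk f σ g (e.trans hs) ht ≫ ρ := by
  simp [whisk]

/-- Congruence for steps of a composite, irrespective of the intermediate 1-cells. -/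
theorem whisk_heq {f f' : X ⟶ X'} {a b : X' ⟶ Y'} (σ : a ⟶ b) {g g' : Y' ⟶ Y}
    {s t s' t' : X ⟶ Y} (hs : s = f ≫ a ≫ g) (ht : t = f ≫ b ≫ g) (hs' : s' = f' ≫ a ≫ g')
    (ht' : t' = f' ≫ b ≫ g') (hf : f = f') (hg : g = g') :
    HEq (whisk f σ g hs ht) (whisk f' σ g' hs' ht') := by
  subst hf hg hs ht hs' ht'; rfl

theorem whisk_comp_heq {f f' : X ⟶ X'} {a b : X' ⟶ Y'} {σ : a ⟶ b} {g g' : Y' ⟶ Y}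
    {s t s' t' r : X ⟶ Y} {hs : s = f ≫ a ≫ g} {ht : t = f ≫ b ≫ g} {hs' : s' = f' ≫ a ≫ g'}
    {ht' : t' = f' ≫ b ≫ g'} {τ : t ⟶ r} {τ' : t' ⟶ r} (hf : f = f') (hg : g = g')
    (hτ : HEq τ τ') : HEq (whisk f σ g hs ht ≫ τ) (whisk f' σ g' hs' ht' ≫ τ') := by
  subst hf hg hs ht hs' ht' hτ; rfl

theorem comp_heq {s t r s' t' r' : X ⟶ Y} {σ : s ⟶ t} {τ : t ⟶ r} {σ' : s' ⟶ t'} {τ' : t' ⟶ r'}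
    (hs : s = s') (ht : t = t') (hr : r = r') (hσ : HEq σ σ') (hτ : HEq τ τ') :
    HEq (σ ≫ τ) (σ' ≫ τ') := by
  subst hs ht hr hσ hτ; rfl

/-- This is the interchange law for cells acting on disjoint segments of a composite; `h` is the
1-cell lying between them. Its shape cannot be inferred up to strict equalities, so it is supplied
explicitly and `e₁`, `e₂` are left as equations to be normalised. -/
theorem whisk_exchange {f : X ⟶ X'} {f₂ : X ⟶ X''} {Z Z' : C} {a b : X' ⟶ Z} {σ : a ⟶ b}
    {g₁ : Z ⟶ Y} {a' b' : X'' ⟶ Z'} {τ : a' ⟶ b'} {g : Z' ⟶ Y} {s t r : X ⟶ Y}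
    {hs : s = f ≫ a ≫ g₁} {ht : t = f ≫ b ≫ g₁} {hs₂ : t = f₂ ≫ a' ≫ g} {ht₂ : r = f₂ ≫ b' ≫ g}
    (h : Z ⟶ X'') (e₁ : g₁ = h ≫ a' ≫ g) (e₂ : f₂ = f ≫ b ≫ h) :
    whisk f σ g₁ hs ht ≫ whisk f₂ τ g hs₂ ht₂ =
      whisk (f ≫ a ≫ h) τ g (by simp [hs, e₁]) rfl ≫
        whisk f σ (h ≫ b' ≫ g) (by simp) (by simp [ht₂, e₂]) := by
  subst hs ht e₁ ht₂ e₂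
  have := congrArg (fun z ↦ whisk f z (𝟙 Y) (s := f ≫ a ≫ h ≫ a' ≫ g)
    (t := (f ≫ b ≫ h) ≫ b' ≫ g)
    (by simp) (by simp)) (Bicategory.whisker_exchange σ (h ◁ (τ ▷ g)))
  simp only [whisk_comp, whisk_whiskerLeft, whisk_whiskerRight] at this
  refine Eq.trans (eq_of_heq ?_) (this.symm.trans (eq_of_heq ?_)) <;>
    refine comp_heq (by simp) (by simp) (by simp) ?_ ?_ <;>
    exact whisk_heq _ _ _ _ _ (by simp) (by simp)

theorem whisk_exchange_symm {f : X ⟶ X'} {f₂ : X ⟶ X''} {Z Z' : C} {a b : X' ⟶ Z} {σ : a ⟶ b}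
    {g₁ : Z ⟶ Y} {a' b' : X'' ⟶ Z'} {τ : a' ⟶ b'} {g : Z' ⟶ Y} {s t r : X ⟶ Y}
    {hs : s = f₂ ≫ a' ≫ g} {ht : t = f₂ ≫ b' ≫ g} {hs₂ : t = f ≫ a ≫ g₁} {ht₂ : r = f ≫ b ≫ g₁}
    (h : Z ⟶ X'') (e₁ : g₁ = h ≫ b' ≫ g) (e₂ : f₂ = f ≫ a ≫ h) :
    whisk f₂ τ g hs ht ≫ whisk f σ g₁ hs₂ ht₂ =
      whisk f σ (h ≫ a' ≫ g) (by simp [hs, e₂]) rfl ≫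
        whisk (f ≫ b ≫ h) τ g (by simp) (by simp [ht₂, e₁]) := by
  rw [whisk_exchange h rfl rfl]
  subst e₁ e₂
  exact eq_of_heq (whisk_comp_heq rfl rfl (whisk_heq _ _ _ _ _ rfl rfl))

/-- Serves to rewrite with a known equation `T` inside a larger composite: `p` and `q` are the
1-cells that surround the whole of `T`. The whiskerings in the goal need to agree with those of `T`
only up to provable equality. -/
theorem whisk_subst₂ {X₀ Y₀ X₁ Y₁ X₂ Y₂ X₃ Y₃ : C} {a₁ b₁ : X₁ ⟶ Y₁} {σ₁ : a₁ ⟶ b₁}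
    {a₂ b₂ : X₂ ⟶ Y₂} {σ₂ : a₂ ⟶ b₂} {a₃ b₃ : X₃ ⟶ Y₃} {σ₃ : a₃ ⟶ b₃}
    {f₁ : X₀ ⟶ X₁} {f₂ : X₀ ⟶ X₂} {f₃ : X₀ ⟶ X₃} {g₁ : Y₁ ⟶ Y₀} {g₂ : Y₂ ⟶ Y₀} {g₃ : Y₃ ⟶ Y₀}
    {s₀ t₀ r₀ : X₀ ⟶ Y₀} {h₁ : s₀ = f₁ ≫ a₁ ≫ g₁} {h₂ : t₀ = f₁ ≫ b₁ ≫ g₁}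
    {h₃ : t₀ = f₂ ≫ a₂ ≫ g₂} {h₄ : r₀ = f₂ ≫ b₂ ≫ g₂} {h₅ : s₀ = f₃ ≫ a₃ ≫ g₃}
    {h₆ : r₀ = f₃ ≫ b₃ ≫ g₃}
    (T : whisk f₁ σ₁ g₁ h₁ h₂ ≫ whisk f₂ σ₂ g₂ h₃ h₄ = whisk f₃ σ₃ g₃ h₅ h₆)
    (p : X ⟶ X₀) (q : Y₀ ⟶ Y) {F₁ : X ⟶ X₁} {F₂ : X ⟶ X₂} {G₁ : Y₁ ⟶ Y} {G₂ : Y₂ ⟶ Y}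
    {s t r : X ⟶ Y} {k₁ : s = F₁ ≫ a₁ ≫ G₁} {k₂ : t = F₁ ≫ b₁ ≫ G₁} {k₃ : t = F₂ ≫ a₂ ≫ G₂}
    {k₄ : r = F₂ ≫ b₂ ≫ G₂} (e₁ : F₁ = p ≫ f₁) (e₂ : F₂ = p ≫ f₂) (e₁' : G₁ = g₁ ≫ q)
    (e₂' : G₂ = g₂ ≫ q) :
    whisk F₁ σ₁ G₁ k₁ k₂ ≫ whisk F₂ σ₂ G₂ k₃ k₄ =
      whisk (p ≫ f₃) σ₃ (g₃ ≫ q)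
        (by rw [k₁, e₁, e₁']; simpa using congrArg (p ≫ · ≫ q) (h₁.symm.trans h₅))
        (by rw [k₄, e₂, e₂']; simpa using congrArg (p ≫ · ≫ q) (h₄.symm.trans h₆)) := by
  subst e₁ e₂ e₁' e₂' k₁ k₄
  have h := congrArg (fun z ↦ whisk p z q (s := (p ≫ f₁) ≫ a₁ ≫ g₁ ≫ q)
    (t := (p ≫ f₂) ≫ b₂ ≫ g₂ ≫ q) (by simp [h₁]) (by simp [h₄])) T
  simp only [whisk_comp, whisk_whisk] at h
  rw [← h]
  exact eq_of_heq (whisk_comp_heq rfl rfl (whisk_heq _ _ _ _ _ rfl rfl))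

theorem whisk_subst₃ {X₀ Y₀ X₁ Y₁ X₂ Y₂ X₃ Y₃ X₄ Y₄ X₅ Y₅ X₆ Y₆ : C}
    {a₁ b₁ : X₁ ⟶ Y₁} {σ₁ : a₁ ⟶ b₁} {a₂ b₂ : X₂ ⟶ Y₂} {σ₂ : a₂ ⟶ b₂}
    {a₃ b₃ : X₃ ⟶ Y₃} {σ₃ : a₃ ⟶ b₃} {a₄ b₄ : X₄ ⟶ Y₄} {σ₄ : a₄ ⟶ b₄}
    {a₅ b₅ : X₅ ⟶ Y₅} {σ₅ : a₅ ⟶ b₅} {a₆ b₆ : X₆ ⟶ Y₆} {σ₆ : a₆ ⟶ b₆}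
    {f₁ : X₀ ⟶ X₁} {f₂ : X₀ ⟶ X₂} {f₃ : X₀ ⟶ X₃} {f₄ : X₀ ⟶ X₄} {f₅ : X₀ ⟶ X₅} {f₆ : X₀ ⟶ X₆}
    {g₁ : Y₁ ⟶ Y₀} {g₂ : Y₂ ⟶ Y₀} {g₃ : Y₃ ⟶ Y₀} {g₄ : Y₄ ⟶ Y₀} {g₅ : Y₅ ⟶ Y₀} {g₆ : Y₆ ⟶ Y₀}
    {s₀ t₁ t₂ t₃ t₄ r₀ : X₀ ⟶ Y₀} {h₁ : s₀ = f₁ ≫ a₁ ≫ g₁} {h₁' : t₁ = f₁ ≫ b₁ ≫ g₁}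
    {h₂ : t₁ = f₂ ≫ a₂ ≫ g₂} {h₂' : t₂ = f₂ ≫ b₂ ≫ g₂} {h₃ : t₂ = f₃ ≫ a₃ ≫ g₃}
    {h₃' : r₀ = f₃ ≫ b₃ ≫ g₃} {h₄ : s₀ = f₄ ≫ a₄ ≫ g₄} {h₄' : t₃ = f₄ ≫ b₄ ≫ g₄}
    {h₅ : t₃ = f₅ ≫ a₅ ≫ g₅} {h₅' : t₄ = f₅ ≫ b₅ ≫ g₅} {h₆ : t₄ = f₆ ≫ a₆ ≫ g₆}
    {h₆' : r₀ = f₆ ≫ b₆ ≫ g₆}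
    (T : whisk f₁ σ₁ g₁ h₁ h₁' ≫ whisk f₂ σ₂ g₂ h₂ h₂' ≫ whisk f₃ σ₃ g₃ h₃ h₃' =
      whisk f₄ σ₄ g₄ h₄ h₄' ≫ whisk f₅ σ₅ g₅ h₅ h₅' ≫ whisk f₆ σ₆ g₆ h₆ h₆')
    (p : X ⟶ X₀) (q : Y₀ ⟶ Y) {F₁ : X ⟶ X₁} {F₂ : X ⟶ X₂} {F₃ : X ⟶ X₃} {G₁ : Y₁ ⟶ Y}
    {G₂ : Y₂ ⟶ Y} {G₃ : Y₃ ⟶ Y} {s t t' r : X ⟶ Y} {k₁ : s = F₁ ≫ a₁ ≫ G₁}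
    {k₁' : t = F₁ ≫ b₁ ≫ G₁} {k₂ : t = F₂ ≫ a₂ ≫ G₂} {k₂' : t' = F₂ ≫ b₂ ≫ G₂}
    {k₃ : t' = F₃ ≫ a₃ ≫ G₃} {k₃' : r = F₃ ≫ b₃ ≫ G₃}
    (e₁ : F₁ = p ≫ f₁) (e₂ : F₂ = p ≫ f₂) (e₃ : F₃ = p ≫ f₃)
    (e₁' : G₁ = g₁ ≫ q) (e₂' : G₂ = g₂ ≫ q) (e₃' : G₃ = g₃ ≫ q) :
    whisk F₁ σ₁ G₁ k₁ k₁' ≫ whisk F₂ σ₂ G₂ k₂ k₂' ≫ whisk F₃ σ₃ G₃ k₃ k₃' =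
      whisk (p ≫ f₄) σ₄ (g₄ ≫ q)
        (by rw [k₁, e₁, e₁']; simpa using congrArg (p ≫ · ≫ q) (h₁.symm.trans h₄)) rfl ≫
      whisk (p ≫ f₅) σ₅ (g₅ ≫ q)
        (by simpa using congrArg (p ≫ · ≫ q) (h₄'.symm.trans h₅)) rfl ≫
      whisk (p ≫ f₆) σ₆ (g₆ ≫ q)
        (by simpa using congrArg (p ≫ · ≫ q) (h₅'.symm.trans h₆))
        (by rw [k₃', e₃, e₃']; simpa using congrArg (p ≫ · ≫ q) (h₃'.symm.trans h₆')) := by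
  subst e₁ e₂ e₃ e₁' e₂' e₃' k₁ k₃'
  have h := congrArg (fun z ↦ whisk p z q (s := (p ≫ f₁) ≫ a₁ ≫ g₁ ≫ q)
    (t := (p ≫ f₃) ≫ b₃ ≫ g₃ ≫ q) (by simp [h₁]) (by simp [h₃'])) T
  simp only [whisk_comp, whisk_whisk] at h
  refine Eq.trans (eq_of_heq ?_) (h.trans (eq_of_heq ?_))
  · exact whisk_comp_heq rfl rfl (whisk_comp_heq rfl rfl (whisk_heq _ _ _ _ _ rfl rfl))
  · exact whisk_comp_heq rfl rfl (whisk_comp_heq rfl rfl (whisk_heq _ _ _ _ _ rfl rfl))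

end Strict
end GrayMonoid

/-! ### Normal forms for 1-cells, 2-cells and interchangers in a Gray monoid -/

namespace GrayMonoid

section Strict
variable {C : Type u} [Bicategory.{w, v} C] [Bicategory.Strict C]

/-- Strict associativity and unitality are given as heterogeneous equalities. Conjugating by
identity 1-cells turns them into honest equations that can serve as rewrite rules. -/
theorem eq_whisk_of_heq {X X' Y Y' : C} {a b : X ⟶ Y} {a' b' : X' ⟶ Y'} {σ : a ⟶ b}
    {σ' : a' ⟶ b'} (hX : X = X') (hY : Y = Y') (ha : a = eqToHom hX ≫ a' ≫ eqToHom hY.symm)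
    (hb : b = eqToHom hX ≫ b' ≫ eqToHom hY.symm) (h : HEq σ σ') :
    σ = whisk (eqToHom hX) σ' (eqToHom hY.symm) ha hb := by
  subst hX hY
  obtain rfl : a = a' := by simpa using ha
  obtain rfl : b = b' := by simpa using hb
  obtain rfl := eq_of_heq h
  simpa using eq_whisk σ

theorem whisk_rfl {X X' Y' Y : C} (f : X ⟶ X') {a b : X' ⟶ Y'} (σ : a ⟶ b) (g : Y' ⟶ Y) :
    whisk f σ g rfl rfl = f ◁ (σ ▷ g) := by
  simp [whisk]

theorem iso_inv_eq_whisk {X X' Y Y' : C} {a b : X ⟶ Y} {a' b' : X' ⟶ Y'} (σ : a ≅ b)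
    (σ' : a' ≅ b') {f : X ⟶ X'} {g : Y' ⟶ Y} {ha : a = f ≫ a' ≫ g} {hb : b = f ≫ b' ≫ g}
    (h : σ.hom = whisk f σ'.hom g ha hb) : σ.inv = whisk f σ'.inv g hb ha := by
  rw [← cancel_epi σ.hom, Iso.hom_inv_id, h]
  subst ha hb
  simp [whisk_rfl, ← whiskerLeft_comp, ← comp_whiskerRight]

theorem eq_conj_of_heq {X X' Y Y' : C} {f : X ⟶ Y} {f' : X' ⟶ Y'} (hX : X = X')
    (hY : Y = Y') (h : HEq f f') : f = eqToHom hX ≫ f' ≫ eqToHom hY.symm := by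
  subst hX hY
  obtain rfl := eq_of_heq h
  simp

theorem whisk_hom_inv {X X' Y' Y : C} (f : X ⟶ X') {a b : X' ⟶ Y'} (σ : a ≅ b) (g : Y' ⟶ Y)
    {s t r : X ⟶ Y} (hs : s = f ≫ a ≫ g) (ht : t = f ≫ b ≫ g) (hr : r = f ≫ a ≫ g) :
    whisk f σ.hom g hs ht ≫ whisk f σ.inv g ht hr = eqToHom (hs.trans hr.symm) := by
  subst hs ht hr
  simp [whisk_rfl, ← whiskerLeft_comp, ← comp_whiskerRight]

theorem whisk_inv_hom {X X' Y' Y : C} (f : X ⟶ X') {a b : X' ⟶ Y'} (σ : a ≅ b) (g : Y' ⟶ Y)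
    {s t r : X ⟶ Y} (hs : s = f ≫ b ≫ g) (ht : t = f ≫ a ≫ g) (hr : r = f ≫ b ≫ g) :
    whisk f σ.inv g hs ht ≫ whisk f σ.hom g ht hr = eqToHom (hs.trans hr.symm) :=
  whisk_hom_inv f σ.symm g hs ht hr

theorem iso_inv_eqToHom {X Y : C} {a b : X ⟶ Y} {σ : a ≅ b} {h : a = b} (e : σ.hom = eqToHom h) :
    σ.inv = eqToHom h.symm := by
  rw [← cancel_epi σ.hom, Iso.hom_inv_id, e]; simp

end Strict

variable {C : Type u} [Bicategory.{w, v} C] [Bicategory.Strict C] [GrayMonoid C]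

theorem wr_wr_eq {A A' : C} (f : A ⟶ A') (B D : C) :
    f ⋊ (B ⊡ D) = ascInv A B D ≫ f ⋊ B ⋊ D ≫ asc A' B D :=
  eq_conj_of_heq (tensor_assoc _ _ _).symm (tensor_assoc _ _ _).symm (wr_wr f B D).symm

theorem wr_wl_eq (A : C) {B B' : C} (g : B ⟶ B') (D : C) :
    (A ⋉ g) ⋊ D = asc A B D ≫ A ⋉ (g ⋊ D) ≫ ascInv A B' D :=
  eq_conj_of_heq (tensor_assoc _ _ _) (tensor_assoc _ _ _) (wr_wl A g D)

theorem wl_tensor_eq (A B : C) {D D' : C} (h : D ⟶ D') :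
    (A ⊡ B) ⋉ h = asc A B D ≫ A ⋉ (B ⋉ h) ≫ ascInv A B D' :=
  eq_conj_of_heq (tensor_assoc _ _ _) (tensor_assoc _ _ _) (wl_tensor A B h)

theorem wl_unit_eq {A B : C} (f : A ⟶ B) : (unit : C) ⋉ f = lu A ≫ f ≫ luInv B :=
  eq_conj_of_heq (unit_tensor _) (unit_tensor _) (wl_unit f)

theorem wr_unit_eq {A B : C} (f : A ⟶ B) : f ⋊ (unit : C) = ru A ≫ f ≫ ruInv B :=
  eq_conj_of_heq (tensor_unit _) (tensor_unit _) (wr_unit f)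

variable (C) in
/-- Normalisation of 1-cells: a 1-cell is brought to the form of a composite of cells
`A₁ ⋉ (… (f ⋊ (B₁ ⊡ …)))` and identity 1-cells `eqToHom _`. -/
theorem nf₁ :
    (∀ {X Y Z W : C} (f : X ⟶ Y) (g : Y ⟶ Z) (h : Z ⟶ W), (f ≫ g) ≫ h = f ≫ g ≫ h) ∧
    (∀ {X Y : C} (f : X ⟶ Y), 𝟙 X ≫ f = f) ∧
    (∀ {X Y : C} (f : X ⟶ Y), f ≫ 𝟙 Y = f) ∧
    (∀ {X : C} (h : X = X), eqToHom h = 𝟙 X) ∧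
    (∀ {X Y Z : C} (h : X = Y) (h' : Y = Z), eqToHom h ≫ eqToHom h' = eqToHom (h.trans h')) ∧
    (∀ {X Y Z W : C} (h : X = Y) (h' : Y = Z) (f : Z ⟶ W),
      eqToHom h ≫ eqToHom h' ≫ f = eqToHom (h.trans h') ≫ f) ∧
    (∀ (A : C) {X Y Z : C} (f : X ⟶ Y) (g : Y ⟶ Z), A ⋉ (f ≫ g) = A ⋉ f ≫ A ⋉ g) ∧
    (∀ (A : C) {X Y Z : C} (f : X ⟶ Y) (g : Y ⟶ Z), (f ≫ g) ⋊ A = f ⋊ A ≫ g ⋊ A) ∧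
    (∀ (A X : C), A ⋉ (𝟙 X) = 𝟙 _) ∧
    (∀ (A X : C), (𝟙 X) ⋊ A = 𝟙 _) ∧
    (∀ (A : C) {X Y : C} (h : X = Y), A ⋉ (eqToHom h) = eqToHom (congrArg (A ⊡ ·) h)) ∧
    (∀ (A : C) {X Y : C} (h : X = Y), (eqToHom h) ⋊ A = eqToHom (congrArg (· ⊡ A) h)) ∧
    (∀ {A A' : C} (f : A ⟶ A') (B D : C), f ⋊ (B ⊡ D) =
      eqToHom (tensor_assoc A B D).symm ≫ f ⋊ B ⋊ D ≫ eqToHom (tensor_assoc A' B D)) ∧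
    (∀ (A : C) {B B' : C} (g : B ⟶ B') (D : C), (A ⋉ g) ⋊ D =
      eqToHom (tensor_assoc A B D) ≫ A ⋉ (g ⋊ D) ≫ eqToHom (tensor_assoc A B' D).symm) ∧
    (∀ (A B : C) {D D' : C} (h : D ⟶ D'), (A ⊡ B) ⋉ h =
      eqToHom (tensor_assoc A B D) ≫ A ⋉ (B ⋉ h) ≫ eqToHom (tensor_assoc A B D').symm) ∧
    (∀ {A B : C} (f : A ⟶ B), (unit : C) ⋉ f =
      eqToHom (unit_tensor A) ≫ f ≫ eqToHom (unit_tensor B).symm) ∧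
    (∀ {A B : C} (f : A ⟶ B), f ⋊ (unit : C) =
      eqToHom (tensor_unit A) ≫ f ≫ eqToHom (tensor_unit B).symm) :=
  ⟨fun _ _ _ ↦ Category.assoc _ _ _, fun _ ↦ Category.id_comp _, fun _ ↦ Category.comp_id _,
    fun _ ↦ rfl, fun _ _ ↦ eqToHom_trans _ _, fun _ _ _ ↦ eqToHom_trans_assoc _ _ _,
    fun _ ↦ wl_comp _, fun A {_ _ _} f g ↦ wr_comp f g A, wl_id, fun A X ↦ wr_id X A, wl_eqToHom,
    fun A {_ _} h ↦ eqToHom_wr h A, wr_wr_eq, wr_wl_eq, wl_tensor_eq, wl_unit_eq, wr_unit_eq⟩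

theorem wl₂_eqToHom (A : C) {B B' : C} {g g' : B ⟶ B'} (h : g = g') :
    A ⋉₂ (eqToHom h) = eqToHom (by rw [h]) := by
  subst h; simp [wl₂_id]

theorem eqToHom_wr₂ {A A' : C} {f f' : A ⟶ A'} (h : f = f') (B : C) :
    (eqToHom h) ⋊₂ B = eqToHom (by rw [h]) := by
  subst h; simp [wr₂_id]

theorem wl₂_whiskerLeft_eq (A : C) {B B' B'' : C} (h : B ⟶ B') {g g' : B' ⟶ B''} (θ : g ⟶ g') :
    A ⋉₂ (h ◁ θ) = whisk (A ⋉ h) (A ⋉₂ θ) (𝟙 _) (by simp) (by simp) := by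
  rw [wl₂_whiskerLeft, eq_iff_whisk]
  simp only [whisk_comp, whisk_eqToHom, whisk_whiskerLeft, whisk_comp_eqToHom,
    eqToHom_comp_whisk, whisk_whisk, Category.id_comp]

theorem wl₂_whiskerRight_eq (A : C) {B B' B'' : C} {g g' : B ⟶ B'} (θ : g ⟶ g') (h : B' ⟶ B'') :
    A ⋉₂ (θ ▷ h) = whisk (𝟙 _) (A ⋉₂ θ) (A ⋉ h) (by simp) (by simp) := by
  rw [wl₂_whiskerRight, eq_iff_whisk]
  simp only [whisk_comp, whisk_eqToHom, whisk_whiskerRight, whisk_comp_eqToHom,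
    eqToHom_comp_whisk, whisk_whisk, Category.id_comp]

theorem wr₂_whiskerLeft_eq {A A' A'' : C} (h : A ⟶ A') {f f' : A' ⟶ A''} (η : f ⟶ f') (B : C) :
    (h ◁ η) ⋊₂ B = whisk (h ⋊ B) (η ⋊₂ B) (𝟙 _) (by simp) (by simp) := by
  rw [wr₂_whiskerLeft, eq_iff_whisk]
  simp only [whisk_comp, whisk_eqToHom, whisk_whiskerLeft, whisk_comp_eqToHom,
    eqToHom_comp_whisk, whisk_whisk, Category.id_comp]

theorem wr₂_whiskerRight_eq {A A' A'' : C} {f f' : A ⟶ A'} (η : f ⟶ f') (h : A' ⟶ A'') (B : C) :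
    (η ▷ h) ⋊₂ B = whisk (𝟙 _) (η ⋊₂ B) (h ⋊ B) (by simp) (by simp) := by
  rw [wr₂_whiskerRight, eq_iff_whisk]
  simp only [whisk_comp, whisk_eqToHom, whisk_whiskerRight, whisk_comp_eqToHom,
    eqToHom_comp_whisk, whisk_whisk, Category.id_comp]

theorem wl₂_whisk (A : C) {X X' Y' Y : C} (f : X ⟶ X') {a b : X' ⟶ Y'} (σ : a ⟶ b) (g : Y' ⟶ Y)
    {s t : X ⟶ Y} (hs : s = f ≫ a ≫ g) (ht : t = f ≫ b ≫ g) :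
    A ⋉₂ (whisk f σ g hs ht) =
      whisk (A ⋉ f) (A ⋉₂ σ) (A ⋉ g) (by simp [hs]) (by simp [ht]) := by
  subst hs ht
  simp only [whisk_rfl, wl₂_whiskerLeft_eq, wl₂_whiskerRight_eq, whisk_whisk, Category.id_comp,
    Category.comp_id]

theorem whisk_wr₂ (B : C) {X X' Y' Y : C} (f : X ⟶ X') {a b : X' ⟶ Y'} (σ : a ⟶ b) (g : Y' ⟶ Y)
    {s t : X ⟶ Y} (hs : s = f ≫ a ≫ g) (ht : t = f ≫ b ≫ g) :
    (whisk f σ g hs ht) ⋊₂ B =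
      whisk (f ⋊ B) (σ ⋊₂ B) (g ⋊ B) (by simp [hs]) (by simp [ht]) := by
  subst hs ht
  simp only [whisk_rfl, wr₂_whiskerLeft_eq, wr₂_whiskerRight_eq, whisk_whisk, Category.id_comp,
    Category.comp_id]

theorem wr₂_wr₂_eq {A A' : C} {f f' : A ⟶ A'} (σ : f ⟶ f') (B D : C) :
    σ ⋊₂ (B ⊡ D) = whisk (ascInv A B D) (σ ⋊₂ B ⋊₂ D) (asc A' B D) (wr_wr_eq f B D)
      (wr_wr_eq f' B D) :=
  eq_whisk_of_heq (tensor_assoc _ _ _).symm (tensor_assoc _ _ _).symm _ _ (wr₂_wr₂ σ B D).symm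

theorem wr₂_wl₂_eq (A : C) {B B' : C} {g g' : B ⟶ B'} (σ : g ⟶ g') (D : C) :
    (A ⋉₂ σ) ⋊₂ D = whisk (asc A B D) (A ⋉₂ (σ ⋊₂ D)) (ascInv A B' D) (wr_wl_eq A g D)
      (wr_wl_eq A g' D) :=
  eq_whisk_of_heq (tensor_assoc _ _ _) (tensor_assoc _ _ _) _ _ (wr₂_wl₂ A σ D)

theorem wl₂_tensor_eq (A B : C) {D D' : C} {h h' : D ⟶ D'} (σ : h ⟶ h') :
    (A ⊡ B) ⋉₂ σ = whisk (asc A B D) (A ⋉₂ (B ⋉₂ σ)) (ascInv A B D') (wl_tensor_eq A B h)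
      (wl_tensor_eq A B h') :=
  eq_whisk_of_heq (tensor_assoc _ _ _) (tensor_assoc _ _ _) _ _ (wl₂_tensor A B σ)

theorem wl₂_unit_eq {A B : C} {f f' : A ⟶ B} (σ : f ⟶ f') :
    (unit : C) ⋉₂ σ = whisk (lu A) σ (luInv B) (wl_unit_eq f) (wl_unit_eq f') :=
  eq_whisk_of_heq (unit_tensor _) (unit_tensor _) _ _ (wl₂_unit σ)

theorem wr₂_unit_eq {A B : C} {f f' : A ⟶ B} (σ : f ⟶ f') :
    σ ⋊₂ (unit : C) = whisk (ru A) σ (ruInv B) (wr_unit_eq f) (wr_unit_eq f') :=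
  eq_whisk_of_heq (tensor_unit _) (tensor_unit _) _ _ (wr₂_unit σ)

/-- The arguments of an interchanger occur in its boundary, so they cannot be rewritten in place;
the change of boundary is absorbed into a `whisk`. -/
theorem interchanger_congr {A A' B B' : C} {f f' : A ⟶ A'} {g g' : B ⟶ B'} (hf : f = f')
    (hg : g = g') : (interchanger f g).hom =
      whisk (𝟙 _) (interchanger f' g').hom (𝟙 _) (by simp [hf, hg]) (by simp [hf, hg]) := by
  subst hf hg; exact eq_whisk _

theorem interchanger_eqToHom_left {A A' : C} (h : A = A') {B B' : C} (g : B ⟶ B') :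
    (interchanger (eqToHom h) g).hom = eqToHom (by subst h; simp) := by
  subst h; simp [interchanger_id_left]

theorem interchanger_eqToHom_right {A A' : C} (f : A ⟶ A') {B B' : C} (h : B = B') :
    (interchanger f (eqToHom h)).hom = eqToHom (by subst h; simp) := by
  subst h; simp [interchanger_id_right]

theorem interchanger_eqToHom_left_inv {A A' : C} (h : A = A') {B B' : C} (g : B ⟶ B') :
    (interchanger (eqToHom h) g).inv = eqToHom (by subst h; simp) :=
  iso_inv_eqToHom (interchanger_eqToHom_left h g)

theorem interchanger_eqToHom_right_inv {A A' : C} (f : A ⟶ A') {B B' : C} (h : B = B') :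
    (interchanger f (eqToHom h)).inv = eqToHom (by subst h; simp) :=
  iso_inv_eqToHom (interchanger_eqToHom_right f h)

theorem interchanger_wl_eq (A : C) {B B' D D' : C} (g : B ⟶ B') (h : D ⟶ D') :
    (interchanger (A ⋉ g) h).hom = whisk (asc A B D) (A ⋉₂ (interchanger g h).hom)
      (ascInv A B' D') (by simp only [nf₁ C]) (by simp only [nf₁ C]) :=
  eq_whisk_of_heq (tensor_assoc _ _ _) (tensor_assoc _ _ _) _ _ (interchanger_wl A g h)

theorem interchanger_wl_inv (A : C) {B B' D D' : C} (g : B ⟶ B') (h : D ⟶ D') :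
    (interchanger (A ⋉ g) h).inv = whisk (asc A B D) (A ⋉₂ (interchanger g h).inv)
      (ascInv A B' D') (by simp only [nf₁ C]) (by simp only [nf₁ C]) :=
  iso_inv_eq_whisk _ (wlIso A (interchanger g h)) (interchanger_wl_eq A g h)

theorem interchanger_wr_wl_eq {A A' D D' : C} (f : A ⟶ A') (B : C) (h : D ⟶ D') :
    (interchanger f (B ⋉ h)).hom = whisk (ascInv A B D) (interchanger (f ⋊ B) h).hom
      (asc A' B D') (by simp only [nf₁ C]) (by simp only [nf₁ C]) :=
  eq_whisk_of_heq (tensor_assoc _ _ _).symm (tensor_assoc _ _ _).symm _ _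
    (interchanger_wr_wl f B h).symm

theorem interchanger_wr_wl_inv {A A' D D' : C} (f : A ⟶ A') (B : C) (h : D ⟶ D') :
    (interchanger f (B ⋉ h)).inv = whisk (ascInv A B D) (interchanger (f ⋊ B) h).inv
      (asc A' B D') (by simp only [nf₁ C]) (by simp only [nf₁ C]) :=
  iso_inv_eq_whisk _ (interchanger (f ⋊ B) h) (interchanger_wr_wl_eq f B h)

theorem interchanger_wr_eq {A A' B B' : C} (f : A ⟶ A') (g : B ⟶ B') (D : C) :
    (interchanger f (g ⋊ D)).hom = whisk (ascInv A B D) ((interchanger f g).hom ⋊₂ D)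
      (asc A' B' D) (by simp only [nf₁ C]) (by simp only [nf₁ C]) :=
  eq_whisk_of_heq (tensor_assoc _ _ _).symm (tensor_assoc _ _ _).symm _ _ (interchanger_wr f g D)

theorem interchanger_wr_inv {A A' B B' : C} (f : A ⟶ A') (g : B ⟶ B') (D : C) :
    (interchanger f (g ⋊ D)).inv = whisk (ascInv A B D) ((interchanger f g).inv ⋊₂ D)
      (asc A' B' D) (by simp only [nf₁ C]) (by simp only [nf₁ C]) :=
  iso_inv_eq_whisk _ (wrIso (interchanger f g) D) (interchanger_wr_eq f g D)

theorem interchanger_comp_left_eq {A A' A'' B B' : C} (f : A ⟶ A') (f' : A' ⟶ A'')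
    (g : B ⟶ B') :
    (interchanger (f ≫ f') g).hom =
      whisk (𝟙 _) (interchanger f g).hom (f' ⋊ B') (by simp) rfl ≫
        whisk (f ⋊ B) (interchanger f' g).hom (𝟙 _) (by simp) (by simp) := by
  rw [interchanger_comp_left, eq_iff_whisk]
  simp only [whisk_comp, whisk_eqToHom, whisk_whiskerLeft, whisk_whiskerRight, whisk_whisk,
    Strict.associator_eqToIso, eqToIso.hom, eqToHom_comp_whisk, eqToHom_comp_whisk_assoc,
    whisk_comp_eqToHom, Category.id_comp, Category.comp_id]
  exact eq_of_heq (comp_heq (by simp) (by simp) (by simp)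
    (whisk_heq _ _ _ _ _ (by simp) (by simp)) (whisk_heq _ _ _ _ _ (by simp) (by simp)))

theorem interchanger_comp_right_eq {A A' B B' B'' : C} (f : A ⟶ A') (g : B ⟶ B')
    (g' : B' ⟶ B'') :
    (interchanger f (g ≫ g')).hom =
      whisk (A ⋉ g) (interchanger f g').hom (𝟙 _) (by simp) rfl ≫
        whisk (𝟙 _) (interchanger f g).hom (A' ⋉ g') (by simp) (by simp) := by
  rw [interchanger_comp_right, eq_iff_whisk]
  simp only [whisk_comp, whisk_eqToHom, whisk_whiskerLeft, whisk_whiskerRight, whisk_whisk,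
    Strict.associator_eqToIso, eqToIso.inv, eqToHom_comp_whisk, eqToHom_comp_whisk_assoc,
    whisk_comp_eqToHom, Category.id_comp, Category.comp_id]
  exact eq_of_heq (comp_heq (by simp) (by simp) (by simp)
    (whisk_heq _ _ _ _ _ (by simp) (by simp)) (whisk_heq _ _ _ _ _ (by simp) (by simp)))

theorem interchanger_comp_left_inv {A A' A'' B B' : C} (f : A ⟶ A') (f' : A' ⟶ A'')
    (g : B ⟶ B') :
    (interchanger (f ≫ f') g).inv =
      whisk (f ⋊ B) (interchanger f' g).inv (𝟙 _) (by simp) (by simp) ≫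
        whisk (𝟙 _) (interchanger f g).inv (f' ⋊ B') rfl (by simp) := by
  rw [← cancel_epi (interchanger (f ≫ f') g).hom, Iso.hom_inv_id, interchanger_comp_left_eq]
  simp only [Category.assoc]
  slice_rhs 2 3 => rw [whisk_hom_inv]
  simp only [eqToHom_refl, Category.id_comp, whisk_hom_inv]

theorem interchanger_comp_right_inv {A A' B B' B'' : C} (f : A ⟶ A') (g : B ⟶ B')
    (g' : B' ⟶ B'') :
    (interchanger f (g ≫ g')).inv =
      whisk (𝟙 _) (interchanger f g).inv (A' ⋉ g') (by simp) (by simp) ≫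
        whisk (A ⋉ g) (interchanger f g').inv (𝟙 _) rfl (by simp) := by
  rw [← cancel_epi (interchanger f (g ≫ g')).hom, Iso.hom_inv_id, interchanger_comp_right_eq]
  simp only [Category.assoc]
  slice_rhs 2 3 => rw [whisk_hom_inv]
  simp only [eqToHom_refl, Category.id_comp, whisk_hom_inv]

theorem interchanger_congr_inv {A A' B B' : C} {f f' : A ⟶ A'} {g g' : B ⟶ B'} (hf : f = f')
    (hg : g = g') : (interchanger f g).inv =
      whisk (𝟙 _) (interchanger f' g').inv (𝟙 _) (by simp [hf, hg]) (by simp [hf, hg]) :=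
  iso_inv_eq_whisk _ _ (interchanger_congr hf hg)

omit [GrayMonoid C] in
variable (C) in
/-- Normalisation of 2-cells to composites of whiskered generators. -/
theorem nf₂ :
    (∀ {X Y : C} {a b c d : X ⟶ Y} (σ : a ⟶ b) (τ : b ⟶ c) (ρ : c ⟶ d),
      (σ ≫ τ) ≫ ρ = σ ≫ τ ≫ ρ) ∧
    (∀ {X Y : C} {a b : X ⟶ Y} (σ : a ⟶ b), 𝟙 a ≫ σ = σ) ∧
    (∀ {X Y : C} {a b : X ⟶ Y} (σ : a ⟶ b), σ ≫ 𝟙 b = σ) ∧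
    (∀ {X Y : C} {a : X ⟶ Y} (h : a = a), eqToHom h = 𝟙 a) ∧
    (∀ {X Y : C} {a b c : X ⟶ Y} (h : a = b) (h' : b = c),
      eqToHom h ≫ eqToHom h' = eqToHom (h.trans h')) ∧
    (∀ {X Y : C} {a b c d : X ⟶ Y} (h : a = b) (h' : b = c) (σ : c ⟶ d),
      eqToHom h ≫ eqToHom h' ≫ σ = eqToHom (h.trans h') ≫ σ) :=
  ⟨fun _ _ _ ↦ Category.assoc _ _ _, fun _ ↦ Category.id_comp _, fun _ ↦ Category.comp_id _,
    fun _ ↦ rfl, fun _ _ ↦ eqToHom_trans _ _, fun _ _ _ ↦ eqToHom_trans_assoc _ _ _⟩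

variable (C) in
/-- Distribution of the tensor product over composites of 2-cells. -/
theorem nf₃ :
    type_of% (@wl₂_comp C _ _ _) ∧ type_of% (@wr₂_comp C _ _ _) ∧
    type_of% (@wl₂_id C _ _ _) ∧ type_of% (@wr₂_id C _ _ _) ∧
    type_of% (@wl₂_eqToHom C _ _ _) ∧ type_of% (@eqToHom_wr₂ C _ _ _) ∧
    type_of% (@wl₂_whiskerLeft_eq C _ _ _) ∧ type_of% (@wl₂_whiskerRight_eq C _ _ _) ∧
    type_of% (@wr₂_whiskerLeft_eq C _ _ _) ∧ type_of% (@wr₂_whiskerRight_eq C _ _ _) ∧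
    type_of% (@wl₂_whisk C _ _ _) ∧ type_of% (@whisk_wr₂ C _ _ _) :=
  ⟨wl₂_comp, wr₂_comp, wl₂_id, wr₂_id, wl₂_eqToHom, eqToHom_wr₂, wl₂_whiskerLeft_eq,
    wl₂_whiskerRight_eq, wr₂_whiskerLeft_eq, wr₂_whiskerRight_eq, wl₂_whisk, whisk_wr₂⟩

variable (C) in
/-- Strict associativity and unitality of the tensor product of 2-cells. -/
theorem nf₄ :
    type_of% (@wr₂_wr₂_eq C _ _ _) ∧
    type_of% (@wr₂_wl₂_eq C _ _ _) ∧
    type_of% (@wl₂_tensor_eq C _ _ _) ∧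
    type_of% (@wl₂_unit_eq C _ _ _) ∧
    type_of% (@wr₂_unit_eq C _ _ _) :=
  ⟨wr₂_wr₂_eq, wr₂_wl₂_eq, wl₂_tensor_eq, wl₂_unit_eq, wr₂_unit_eq⟩

omit [GrayMonoid C] in
variable (C) in
/-- Whiskering of composites. -/
theorem nf₅ :
    type_of% (@whisk_comp C _ _) ∧
    type_of% (@whisk_eqToHom C _ _) ∧
    type_of% (@whisk_id C _ _) ∧
    type_of% (@whisk_whiskerLeft C _ _) ∧
    type_of% (@whisk_whiskerRight C _ _) ∧
    type_of% (@whisk_whisk C _ _) ∧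
    type_of% (@whisk_comp_eqToHom C _ _) ∧
    type_of% (@eqToHom_comp_whisk C _ _) ∧
    type_of% (@eqToHom_comp_whisk_assoc C _ _) :=
  ⟨whisk_comp, whisk_eqToHom, whisk_id, whisk_whiskerLeft, whisk_whiskerRight, whisk_whisk,
    whisk_comp_eqToHom, eqToHom_comp_whisk, eqToHom_comp_whisk_assoc⟩

theorem interchanger_id_left_eq (A : C) {B B' : C} (g : B ⟶ B') :
    (interchanger (𝟙 A) g).hom = eqToHom (by simp) :=
  interchanger_id_left A g

theorem interchanger_id_right_eq {A A' : C} (f : A ⟶ A') (B : C) :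
    (interchanger f (𝟙 B)).hom = eqToHom (by simp) :=
  interchanger_id_right f B

theorem interchanger_id_left_inv (A : C) {B B' : C} (g : B ⟶ B') :
    (interchanger (𝟙 A) g).inv = eqToHom (by simp) :=
  iso_inv_eqToHom (interchanger_id_left A g)

theorem interchanger_id_right_inv {A A' : C} (f : A ⟶ A') (B : C) :
    (interchanger f (𝟙 B)).inv = eqToHom (by simp) :=
  iso_inv_eqToHom (interchanger_id_right f B)

theorem interchanger_wr_tensor {A A' : C} (f : A ⟶ A') (B D : C) {E E' : C} (h : E ⟶ E') :
    (interchanger (f ⋊ (B ⊡ D)) h).hom =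
      whisk (eqToHom (by simp only [tensor_assoc])) (interchanger (f ⋊ B ⋊ D) h).hom
        (eqToHom (by simp only [tensor_assoc]))
        (by simp only [nf₁ C]) (by simp only [nf₁ C]) := by
  rw [interchanger_congr (wr_wr_eq f B D) rfl]
  simp only [interchanger_comp_left_eq, interchanger_eqToHom_left, nf₂ C, nf₅ C, nf₁ C]

theorem interchanger_wr_unit {A A' : C} (f : A ⟶ A') {E E' : C} (h : E ⟶ E') :
    (interchanger (f ⋊ (unit : C)) h).hom =
      whisk (eqToHom (by simp only [tensor_unit])) (interchanger f h).hom
        (eqToHom (by simp only [tensor_unit]))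
        (by simp only [nf₁ C]) (by simp only [nf₁ C]) := by
  rw [interchanger_congr (wr_unit_eq f) rfl]
  simp only [interchanger_comp_left_eq, interchanger_eqToHom_left, nf₂ C, nf₅ C, nf₁ C]

theorem interchanger_wr_tensor_inv {A A' : C} (f : A ⟶ A') (B D : C) {E E' : C} (h : E ⟶ E') :
    (interchanger (f ⋊ (B ⊡ D)) h).inv =
      whisk (eqToHom (by simp only [tensor_assoc])) (interchanger (f ⋊ B ⋊ D) h).inv
        (eqToHom (by simp only [tensor_assoc]))
        (by simp only [nf₁ C]) (by simp only [nf₁ C]) :=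
  iso_inv_eq_whisk _ _ (interchanger_wr_tensor f B D h)

theorem interchanger_wr_unit_inv {A A' : C} (f : A ⟶ A') {E E' : C} (h : E ⟶ E') :
    (interchanger (f ⋊ (unit : C)) h).inv =
      whisk (eqToHom (by simp only [tensor_unit])) (interchanger f h).inv
        (eqToHom (by simp only [tensor_unit]))
        (by simp only [nf₁ C]) (by simp only [nf₁ C]) :=
  iso_inv_eq_whisk _ _ (interchanger_wr_unit f h)

variable (C) in
/-- Normalisation of interchangers. -/
theorem nf₆ :
    type_of% (@interchanger_id_left_eq C _ _ _) ∧
    type_of% (@interchanger_id_right_eq C _ _ _) ∧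
    type_of% (@interchanger_eqToHom_left C _ _ _) ∧
    type_of% (@interchanger_eqToHom_right C _ _ _) ∧
    type_of% (@interchanger_comp_left_eq C _ _ _) ∧
    type_of% (@interchanger_comp_right_eq C _ _ _) ∧
    type_of% (@interchanger_wl_eq C _ _ _) ∧
    type_of% (@interchanger_wr_eq C _ _ _) ∧
    type_of% (@interchanger_id_left_inv C _ _ _) ∧
    type_of% (@interchanger_id_right_inv C _ _ _) ∧
    type_of% (@interchanger_eqToHom_left_inv C _ _ _) ∧
    type_of% (@interchanger_eqToHom_right_inv C _ _ _) ∧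
    type_of% (@interchanger_comp_left_inv C _ _ _) ∧
    type_of% (@interchanger_comp_right_inv C _ _ _) ∧
    type_of% (@interchanger_wl_inv C _ _ _) ∧
    type_of% (@interchanger_wr_inv C _ _ _) :=
  ⟨interchanger_id_left_eq, interchanger_id_right_eq, interchanger_eqToHom_left,
    interchanger_eqToHom_right, interchanger_comp_left_eq, interchanger_comp_right_eq,
    interchanger_wl_eq, interchanger_wr_eq, interchanger_id_left_inv,
    interchanger_id_right_inv, interchanger_eqToHom_left_inv, interchanger_eqToHom_right_inv,
    interchanger_comp_left_inv, interchanger_comp_right_inv, interchanger_wl_inv,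
    interchanger_wr_inv⟩

variable (C) in
/-- Normalisation of interchangers of tensor products with objects. -/
theorem nf₇ :
    type_of% (@interchanger_wr_wl_eq C _ _ _) ∧
    type_of% (@interchanger_wr_tensor C _ _ _) ∧
    type_of% (@interchanger_wr_unit C _ _ _) ∧
    type_of% (@interchanger_wr_wl_inv C _ _ _) ∧
    type_of% (@interchanger_wr_tensor_inv C _ _ _) ∧
    type_of% (@interchanger_wr_unit_inv C _ _ _) :=
  ⟨interchanger_wr_wl_eq, interchanger_wr_tensor, interchanger_wr_unit,
    interchanger_wr_wl_inv, interchanger_wr_tensor_inv, interchanger_wr_unit_inv⟩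

/-- Naturality of the interchanger in its first argument, solved for the inverse and placed in a
context: a 2-cell of the first factor slides through. -/
theorem whisk_interchanger_left {A A' B B' X Y : C} {f f' : A ⟶ A'} {η : f ⟶ f'} {g : B ⟶ B'}
    {p : X ⟶ A ⊡ B} {q : A' ⊡ B' ⟶ Y} {q₁ : A' ⊡ B ⟶ Y} {s t r : X ⟶ Y}
    {hs : s = p ≫ f ⋊ B ≫ q₁} {ht : t = p ≫ f' ⋊ B ≫ q₁} {hs' : t = p ≫ (f' ⋊ B ≫ A' ⋉ g) ≫ q}
    {hr : r = p ≫ (A ⋉ g ≫ f' ⋊ B') ≫ q} (e : q₁ = A' ⋉ g ≫ q) :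
    whisk p (η ⋊₂ B) q₁ hs ht ≫ whisk p (interchanger f' g).inv q hs' hr =
      whisk p (interchanger f g).inv q (by simp [hs, e]) rfl ≫
        whisk (p ≫ A ⋉ g) (η ⋊₂ B') q (by simp) (by simp [hr]) := by
  have h : (η ⋊₂ B) ▷ (A' ⋉ g) ≫ (interchanger f' g).inv =
      (interchanger f g).inv ≫ (A ⋉ g) ◁ (η ⋊₂ B') := by
    rw [Iso.eq_inv_comp, ← Category.assoc, ← interchanger_naturality_left, Category.assoc,
      Iso.hom_inv_id, Category.comp_id]
  subst hs ht hr e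
  have h' := congrArg (fun z ↦ whisk p z q (s := p ≫ (f ⋊ B ≫ A' ⋉ g) ≫ q) rfl rfl) h
  simp only [whisk_comp, whisk_whiskerLeft, whisk_whiskerRight] at h'
  refine Eq.trans (eq_of_heq ?_) ((congrArg (eqToHom (by simp) ≫ ·) h').trans (eq_of_heq ?_))
  · simp only [eqToHom_comp_whisk_assoc]
    exact whisk_comp_heq rfl rfl (whisk_heq _ _ _ _ _ rfl rfl)
  · simp only [eqToHom_comp_whisk_assoc]
    exact whisk_comp_heq rfl rfl (whisk_heq _ _ _ _ _ rfl rfl)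

theorem whisk_interchanger_right {A A' B B' X Y : C} {f : A ⟶ A'} {g g' : B ⟶ B'} {θ : g ⟶ g'}
    {p : X ⟶ A ⊡ B} {q : A' ⊡ B' ⟶ Y} {p₁ : X ⟶ A' ⊡ B} {s t r : X ⟶ Y}
    {hs : s = p₁ ≫ A' ⋉ g ≫ q} {ht : t = p₁ ≫ A' ⋉ g' ≫ q}
    {hs' : t = p ≫ (f ⋊ B ≫ A' ⋉ g') ≫ q}
    {hr : r = p ≫ (A ⋉ g' ≫ f ⋊ B') ≫ q} (e : p₁ = p ≫ f ⋊ B) :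
    whisk p₁ (A' ⋉₂ θ) q hs ht ≫ whisk p (interchanger f g').inv q hs' hr =
      whisk p (interchanger f g).inv q (by simp [hs, e]) rfl ≫
        whisk p (A ⋉₂ θ) (f ⋊ B' ≫ q) (by simp) (by simp [hr]) := by
  have h : (f ⋊ B) ◁ (A' ⋉₂ θ) ≫ (interchanger f g').inv =
      (interchanger f g).inv ≫ (A ⋉₂ θ) ▷ (f ⋊ B') := by
    rw [Iso.eq_inv_comp, ← Category.assoc, ← interchanger_naturality_right, Category.assoc,
      Iso.hom_inv_id, Category.comp_id]
  subst hs ht hr e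
  have h' := congrArg (fun z ↦ whisk p z q (s := p ≫ (f ⋊ B ≫ A' ⋉ g) ≫ q) rfl rfl) h
  simp only [whisk_comp, whisk_whiskerLeft, whisk_whiskerRight] at h'
  refine Eq.trans (eq_of_heq ?_) ((congrArg (eqToHom (by simp) ≫ ·) h').trans (eq_of_heq ?_))
  · simp only [eqToHom_comp_whisk_assoc]
    exact whisk_comp_heq rfl rfl (whisk_heq _ _ _ _ _ rfl rfl)
  · simp only [eqToHom_comp_whisk_assoc]
    exact whisk_comp_heq rfl rfl (whisk_heq _ _ _ _ _ rfl rfl)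

/-- Here `θ : g ⟶ k ≫ g'` has the form of a cell of degree `k`. The inverse interchangers of `k` and
`g'` compose to that of `k ≫ g'`, and naturality then carries `θ` through it. This is the core of
every naturality statement in the second variable of the product. -/
theorem whisk_interchanger_cell {A A' B B' B'' X Y : C} {f : A ⟶ A'} {g : B ⟶ B''} {k : B ⟶ B'}
    {g' : B' ⟶ B''} {θ : g ⟶ k ≫ g'}
    {p : X ⟶ A ⊡ B} {q : A' ⊡ B'' ⟶ Y} {p₁ : X ⟶ A' ⊡ B} {q₂ : A' ⊡ B' ⟶ Y} {p₃ : X ⟶ A ⊡ B'}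
    {s t r z : X ⟶ Y}
    {hs : s = p₁ ≫ A' ⋉ g ≫ q} {ht : t = p₁ ≫ A' ⋉ (k ≫ g') ≫ q}
    {hs' : t = p ≫ (f ⋊ B ≫ A' ⋉ k) ≫ q₂}
    {hr : r = p ≫ (A ⋉ k ≫ f ⋊ B') ≫ q₂} {hr' : r = p₃ ≫ (f ⋊ B' ≫ A' ⋉ g') ≫ q}
    {hz : z = p₃ ≫ (A ⋉ g' ≫ f ⋊ B'') ≫ q}
    (e : p₁ = p ≫ f ⋊ B) (e₂ : q₂ = A' ⋉ g' ≫ q) (e₃ : p₃ = p ≫ A ⋉ k) :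
    whisk p₁ (A' ⋉₂ θ) q hs ht ≫ whisk p (interchanger f k).inv q₂ hs' hr ≫
      whisk p₃ (interchanger f g').inv q hr' hz =
      whisk p (interchanger f g).inv q (by simp [hs, e]) rfl ≫
        whisk p (A ⋉₂ θ) (f ⋊ B'' ≫ q) (by simp) (by simp [hz, e₃]) := by
  have := whisk_interchanger_right (f := f) (θ := θ) (p := p) (q := q) (p₁ := p₁)
    (s := s) (t := t) (r := z) (hs := hs) (ht := ht) (hs' := by simp [ht, e])
    (hr := by simp [hz, e₃]) e
  rw [← this, interchanger_comp_right_inv]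
  subst e₂ e₃
  simp only [whisk_comp, whisk_whisk]
  congr 1
  exact eq_of_heq (whisk_comp_heq (by simp) (by simp) (whisk_heq _ _ _ _ _ (by simp) (by simp)))

end GrayMonoid

/-! ### Generalised 1-cells of an enriched 2-category: product, associator, unitors -/

namespace GrayMonoid

variable {C : Type u} [Bicategory.{w, v} C] [Bicategory.Strict C]

/-- The invertible 2-cell `f ◁ σ ▷ g`, with its boundary replaced by equal 1-cells. -/
@[simps]
def whiskIso {X X' Y' Y : C} (f : X ⟶ X') {a b : X' ⟶ Y'} (σ : a ≅ b) (g : Y' ⟶ Y)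
    {s t : X ⟶ Y} (hs : s = f ≫ a ≫ g) (ht : t = f ≫ b ≫ g) : s ≅ t where
  hom := whisk f σ.hom g hs ht
  inv := whisk f σ.inv g ht hs
  hom_inv_id := by simp [whisk_hom_inv]
  inv_hom_id := by simp [whisk_inv_hom]

end GrayMonoid

namespace EnrichedTwoCategory

variable {C : Type u} [Bicategory.{w, v} C] [Bicategory.Strict C] [GrayMonoid C] {Ob : Type t}

/-- A generalised 1-cell `x ⟶ y` of an enriched 2-category: a 1-cell into the hom object
`[x, y]`. -/
structure El (M : EnrichedTwoCategory C Ob) (x y : Ob) where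
  /-- the domain -/
  dom : C
  /-- the 1-cell -/
  val : dom ⟶ M.hom x y

namespace El

variable {M : EnrichedTwoCategory C Ob} {x y z w₀ : Ob}

/-- A 2-cell over `[x, y]` between generalised 1-cells. -/
structure Hom (U V : M.El x y) where
  /-- the 1-cell between the domains -/
  deg : U.dom ⟶ V.dom
  /-- the 2-cell filling the triangle over `[x, y]` -/
  cell : U.val ⟶ deg ≫ V.val

theorem Hom.ext_whisk {U V : M.El x y} {F G : Hom U V} (h : F.deg = G.deg)
    (hc : whisk (𝟙 _) F.cell (𝟙 _) (s := U.val) (t := F.deg ≫ V.val) (by simp) (by simp) =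
      whisk (𝟙 _) G.cell (𝟙 _) (by simp) (by simp [h])) : F = G := by
  obtain ⟨k, σ⟩ := F
  obtain ⟨k', σ'⟩ := G
  obtain rfl : k = k' := h
  rw [← eq_iff_whisk] at hc
  obtain rfl : σ = σ' := hc
  rfl

/-- A lax slice over `[x, y]`. It is an ordinary category because `C` is strict: degrees compose
strictly associatively. -/
instance : Category (M.El x y) where
  Hom := Hom
  id U := ⟨𝟙 _, eqToHom (by simp)⟩
  comp {U V W} F G := ⟨F.deg ≫ G.deg, F.cell ≫ whisk F.deg G.cell (𝟙 _) (by simp) (by simp)⟩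
  id_comp F := by
    refine Hom.ext_whisk (by simp only [nf₁ C]) ?_
    simp only [nf₁ C, nf₂ C, nf₅ C]
  comp_id F := by
    refine Hom.ext_whisk (by simp only [nf₁ C]) ?_
    simp only [nf₁ C, nf₂ C, nf₅ C]
  assoc F G H := by
    refine Hom.ext_whisk (by simp only [nf₁ C]) ?_
    simp only [nf₁ C, nf₂ C, nf₅ C]
    refine eq_of_heq ?_
    repeat' refine whisk_comp_heq rfl rfl ?_
    exact whisk_heq _ _ _ _ _ rfl rfl

/-- The constructor of 2-cells, typed as a morphism of the category `M.El x y`. -/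
abbrev mkHom {U V : M.El x y} (k : U.dom ⟶ V.dom) (σ : U.val ⟶ k ≫ V.val) : U ⟶ V := ⟨k, σ⟩

theorem mk_ext {U V : M.El x y} {k k' : U.dom ⟶ V.dom} {σ : U.val ⟶ k ≫ V.val}
    {σ' : U.val ⟶ k' ≫ V.val} (h : k = k')
    (hc : whisk (𝟙 _) σ (𝟙 _) (s := U.val) (t := k ≫ V.val) (by simp) (by simp) =
      whisk (𝟙 _) σ' (𝟙 _) (by simp) (by simp [h])) :
    mkHom k σ = mkHom k' σ' :=
  Hom.ext_whisk h hc

theorem id_mk (U : M.El x y) : 𝟙 U = mkHom (𝟙 U.dom) (eqToHom (by simp)) := rfl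

theorem mk_comp_mk {U V W : M.El x y} (k : U.dom ⟶ V.dom) (σ : U.val ⟶ k ≫ V.val)
    (l : V.dom ⟶ W.dom) (τ : V.val ⟶ l ≫ W.val) :
    mkHom k σ ≫ mkHom l τ = mkHom (k ≫ l) (σ ≫ whisk k τ (𝟙 _) (by simp) (by simp)) := rfl

theorem id_deg (U : M.El x y) : Hom.deg (𝟙 U) = 𝟙 U.dom := rfl

theorem comp_deg {U V W : M.El x y} (F : U ⟶ V) (G : V ⟶ W) :
    Hom.deg (F ≫ G) = F.deg ≫ G.deg := rfl

/-- An isomorphism of generalised 1-cells over an equality of domains. -/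
@[simps]
def isoMk {U V : M.El x y} (h : U.dom = V.dom) (σ : U.val ≅ eqToHom h ≫ V.val) : U ≅ V where
  hom := ⟨eqToHom h, σ.hom⟩
  inv := ⟨eqToHom h.symm, whisk (eqToHom h.symm) σ.inv (𝟙 _) (by simp) (by simp)⟩
  hom_inv_id := by
    rw [mk_comp_mk, id_mk]
    refine mk_ext (by simp only [nf₁ C]) ?_
    simp only [nf₂ C, nf₅ C, nf₁ C, whisk_hom_inv]
  inv_hom_id := by
    rw [mk_comp_mk, id_mk]
    refine mk_ext (by simp only [nf₁ C]) ?_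
    simp only [nf₂ C, nf₅ C, nf₁ C, whisk_inv_hom]

variable {s : Ob}

/-- The product of generalised 1-cells. -/
abbrev prod (U : M.El y z) (V : M.El x y) : M.El x z :=
  ⟨U.dom ⊡ V.dom, tensorHom U.val V.val ≫ M.comp x y z⟩

infixr:70 " ⊙ " => EnrichedTwoCategory.El.prod

/-- `F ⊙ V`. -/
@[simps]
def wR {U U' : M.El y z} (F : U ⟶ U') (V : M.El x y) : U ⊙ V ⟶ U' ⊙ V where
  deg := F.deg ⋊ V.dom
  cell := whisk (𝟙 _) (F.cell ⋊₂ V.dom) (M.hom y z ⋉ V.val ≫ M.comp x y z)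
    (by simp only [nf₁ C]) (by simp only [nf₁ C])

/-- `U ⊙ F`. -/
@[simps]
def wL (U : M.El y z) {V V' : M.El x y} (F : V ⟶ V') : U ⊙ V ⟶ U ⊙ V' where
  deg := U.dom ⋉ F.deg
  cell := whisk (U.val ⋊ V.dom) (M.hom y z ⋉₂ F.cell) (M.comp x y z) (by simp only [nf₁ C]) rfl ≫
    -- The convention that `f ⊡ g` is `f ⊡ 1` followed by `1 ⊡ g` leaves the degree of `F` after
    -- `U.val`; the inverse interchanger moves it to the front. `wR` needs no such correction.
    whisk (𝟙 _) (interchanger U.val F.deg).inv (M.hom y z ⋉ V'.val ≫ M.comp x y z)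
      (by simp only [nf₁ C]) (by simp only [nf₁ C])

/-- The associator of generalised 1-cells. -/
def α (U : M.El z w₀) (V : M.El y z) (W : M.El x y) : (U ⊙ V) ⊙ W ≅ U ⊙ (V ⊙ W) :=
  isoMk (tensor_assoc _ _ _)
    (whiskIso ((U.val ⋊ V.dom ≫ M.hom z w₀ ⋉ V.val) ⋊ W.dom)
      (interchanger (M.comp y z w₀) W.val).symm (M.comp x y w₀) (by simp only [nf₁ C]) rfl ≪≫
    whiskIso ((U.val ⋊ V.dom ≫ M.hom z w₀ ⋉ V.val) ⋊ W.dom ≫ (M.hom z w₀ ⊡ M.hom y z) ⋉ W.val)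
      (M.assoc x y z w₀) (𝟙 _) (by simp only [nf₁ C]) (by simp only [nf₁ C]))

variable (M) in
/-- The unit as a generalised 1-cell. -/
abbrev one (x : Ob) : M.El x x := ⟨unit, M.one x⟩

/-- The left unitor of generalised 1-cells. -/
def lun (U : M.El x y) : one M y ⊙ U ≅ U :=
  isoMk (unit_tensor _)
    (whiskIso (𝟙 _) (interchanger (M.one y) U.val).symm (M.comp x y y)
      (by simp only [nf₁ C]) rfl ≪≫
    whiskIso (unit ⋉ U.val) (M.leftUnitor x y) (𝟙 _) (by simp only [nf₁ C])
      (by simp only [nf₁ C]))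

/-- The right unitor of generalised 1-cells. -/
def run (U : M.El x y) : U ⊙ one M x ≅ U :=
  isoMk (tensor_unit _)
    (whiskIso (U.val ⋊ unit) (M.rightUnitor x y) (𝟙 _) (by simp only [nf₁ C])
      (by simp only [nf₁ C]))

theorem wR_mk {U U' : M.El y z} (k : U.dom ⟶ U'.dom) (σ : U.val ⟶ k ≫ U'.val) (V : M.El x y) :
    wR (mkHom k σ) V = mkHom (k ⋊ V.dom)
      (whisk (𝟙 _) (σ ⋊₂ V.dom) (M.hom y z ⋉ V.val ≫ M.comp x y z)
        (by simp only [nf₁ C]) (by simp only [nf₁ C])) := rfl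

theorem wL_mk (U : M.El y z) {V V' : M.El x y} (k : V.dom ⟶ V'.dom) (σ : V.val ⟶ k ≫ V'.val) :
    wL U (mkHom k σ) = mkHom (U.dom ⋉ k)
      (whisk (U.val ⋊ V.dom) (M.hom y z ⋉₂ σ) (M.comp x y z) (by simp only [nf₁ C]) rfl ≫
        whisk (𝟙 _) (interchanger U.val k).inv (M.hom y z ⋉ V'.val ≫ M.comp x y z)
          (by simp only [nf₁ C]) (by simp only [nf₁ C])) := rfl

theorem α_hom_mk (U : M.El z w₀) (V : M.El y z) (W : M.El x y) :
    (α U V W).hom = mkHom (eqToHom (tensor_assoc _ _ _))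
      (whisk ((U.val ⋊ V.dom ≫ M.hom z w₀ ⋉ V.val) ⋊ W.dom)
        (interchanger (M.comp y z w₀) W.val).inv (M.comp x y w₀) (by simp only [nf₁ C]) rfl ≫
      whisk ((U.val ⋊ V.dom ≫ M.hom z w₀ ⋉ V.val) ⋊ W.dom ≫ (M.hom z w₀ ⊡ M.hom y z) ⋉ W.val)
        (M.assoc x y z w₀).hom (𝟙 _) (by simp only [nf₁ C]) (by simp only [nf₁ C])) := rfl

theorem lun_hom_mk (U : M.El x y) : (lun U).hom = mkHom (eqToHom (unit_tensor _))
    (whisk (𝟙 _) (interchanger (M.one y) U.val).inv (M.comp x y y)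
      (by simp only [nf₁ C]) rfl ≫
    whisk (unit ⋉ U.val) (M.leftUnitor x y).hom (𝟙 _) (by simp only [nf₁ C])
      (by simp only [nf₁ C])) := rfl

theorem run_hom_mk (U : M.El x y) : (run U).hom = mkHom (eqToHom (tensor_unit _))
    (whisk (U.val ⋊ unit) (M.rightUnitor x y).hom (𝟙 _) (by simp only [nf₁ C])
      (by simp only [nf₁ C])) := rfl

theorem wR_id (U : M.El y z) (V : M.El x y) : wR (𝟙 U) V = 𝟙 (U ⊙ V) := by
  rw [id_mk, id_mk, wR_mk]
  refine mk_ext (by simp only [nf₁ C]) ?_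
  simp only [nf₂ C, nf₃ C, nf₅ C, nf₁ C]

theorem wR_comp {U U' U'' : M.El y z} (F : U ⟶ U') (G : U' ⟶ U'') (V : M.El x y) :
    wR (F ≫ G) V = wR F V ≫ wR G V := by
  obtain ⟨k, σ⟩ := F
  obtain ⟨l, τ⟩ := G
  simp only [wR_mk, mk_comp_mk]
  refine mk_ext (by simp only [nf₁ C]) ?_
  simp only [nf₂ C, nf₃ C, nf₅ C, nf₁ C]
  refine eq_of_heq ?_
  repeat' refine whisk_comp_heq rfl rfl ?_
  exact whisk_heq _ _ _ _ _ rfl rfl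

theorem wL_id (U : M.El y z) (V : M.El x y) : wL U (𝟙 V) = 𝟙 (U ⊙ V) := by
  rw [id_mk, id_mk, wL_mk]
  refine mk_ext (by simp only [nf₁ C]) ?_
  simp only [nf₂ C, nf₃ C, nf₅ C, nf₁ C, nf₆ C]

theorem wL_comp (U : M.El y z) {V V' V'' : M.El x y} (F : V ⟶ V') (G : V' ⟶ V'') :
    wL U (F ≫ G) = wL U F ≫ wL U G := by
  obtain ⟨k, σ⟩ := F
  obtain ⟨l, τ⟩ := G
  simp only [wL_mk, mk_comp_mk]
  refine mk_ext (by simp only [nf₁ C]) ?_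
  simp only [nf₂ C, nf₃ C, nf₅ C, nf₁ C, nf₆ C]
  slice_rhs 2 3 => rw [whisk_exchange (𝟙 _) (by simp only [nf₁ C]) (by simp only [nf₁ C])]
  simp only [nf₂ C, nf₁ C]
  refine eq_of_heq ?_
  repeat' refine whisk_comp_heq rfl rfl ?_
  exact whisk_heq _ _ _ _ _ rfl rfl

theorem wR_α {U U' : M.El z w₀} (F : U ⟶ U') (V : M.El y z) (W : M.El x y) :
    wR (wR F V) W ≫ (α U' V W).hom = (α U V W).hom ≫ wR F (V ⊙ W) := by
  obtain ⟨k, σ⟩ := F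
  simp only [α_hom_mk, wR_mk, mk_comp_mk]
  refine mk_ext (by simp only [nf₁ C]) ?_
  simp only [nf₂ C, nf₃ C, nf₄ C, nf₅ C, nf₁ C, nf₆ C]
  slice_lhs 1 2 => rw [whisk_exchange (asc _ _ _ ≫ M.hom z w₀ ⋉ V.val ⋊ W.dom ≫ ascInv _ _ _) (by simp only [nf₁ C]) (by simp only [nf₁ C])]
  slice_lhs 2 3 => rw [whisk_exchange (asc _ _ _ ≫ M.hom z w₀ ⋉ V.val ⋊ W.dom ≫ M.hom z w₀ ⋉ M.hom y z ⋉ W.val ≫ ascInv _ _ _) (by simp only [nf₁ C]) (by simp only [nf₁ C])]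
  simp only [nf₂ C, nf₁ C]
  refine eq_of_heq ?_
  repeat' refine whisk_comp_heq rfl rfl ?_
  exact whisk_heq _ _ _ _ _ rfl rfl

theorem wL_wR_α (U : M.El z w₀) {V V' : M.El y z} (F : V ⟶ V') (W : M.El x y) :
    wR (wL U F) W ≫ (α U V' W).hom = (α U V W).hom ≫ wL U (wR F W) := by
  obtain ⟨k, σ⟩ := F
  simp only [α_hom_mk, wR_mk, wL_mk, mk_comp_mk]
  refine mk_ext (by simp only [nf₁ C]) ?_
  simp only [nf₂ C, nf₃ C, nf₄ C, nf₅ C, nf₁ C, nf₆ C]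
  slice_lhs 2 3 => rw [whisk_exchange (asc _ _ _ ≫ M.hom z w₀ ⋉ V'.val ⋊ W.dom ≫ ascInv _ _ _)
    (by simp only [nf₁ C]) (by simp only [nf₁ C])]
  simp only [nf₂ C, nf₁ C]
  slice_lhs 1 2 => rw [whisk_exchange (ascInv _ _ _)
    (by simp only [nf₁ C]) (by simp only [nf₁ C])]
  simp only [nf₂ C, nf₁ C]
  slice_lhs 3 4 => rw [whisk_exchange (asc _ _ _ ≫ M.hom z w₀ ⋉ V'.val ⋊ W.dom ≫ M.hom z w₀ ⋉ M.hom y z ⋉ W.val ≫ ascInv _ _ _)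
    (by simp only [nf₁ C]) (by simp only [nf₁ C])]
  simp only [nf₂ C, nf₁ C]
  slice_lhs 2 3 => rw [whisk_exchange (M.hom z w₀ ⋉ M.hom y z ⋉ W.val ≫ ascInv _ _ _)
    (by simp only [nf₁ C]) (by simp only [nf₁ C])]
  simp only [nf₂ C, nf₁ C]
  refine eq_of_heq ?_
  repeat' refine whisk_comp_heq rfl rfl ?_
  exact whisk_heq _ _ _ _ _ rfl rfl

set_option maxHeartbeats 1000000 in
-- The cell `F` sits in the last factor, so it has to pass the interchanger hidden in the source
-- associator. This is done by `whisk_interchanger_cell`; the remaining steps are exchanges of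
-- disjoint cells.
theorem wL_α (U : M.El z w₀) (V : M.El y z) {W W' : M.El x y} (F : W ⟶ W') :
    wL (U ⊙ V) F ≫ (α U V W').hom = (α U V W).hom ≫ wL U (wL V F) := by
  obtain ⟨k, τ⟩ := F
  simp only [α_hom_mk, wR_mk, wL_mk, mk_comp_mk]
  refine mk_ext (by simp only [nf₁ C]) ?_
  simp only [nf₂ C, nf₃ C, nf₄ C, nf₅ C, nf₁ C, nf₆ C]
  simp only [nf₇ C, nf₂ C, nf₅ C, nf₁ C]
  slice_lhs 4 5 => rw [whisk_exchange (asc _ _ _ ≫ M.hom z w₀ ⋉ V.val ⋊ W'.dom ≫ ascInv _ _ _)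
    (by simp only [nf₁ C]) (by simp only [nf₁ C])]
  simp only [nf₂ C, nf₁ C]
  slice_lhs 3 4 => rw [whisk_exchange (ascInv _ _ _)
    (by simp only [nf₁ C]) (by simp only [nf₁ C])]
  simp only [nf₂ C, nf₁ C]
  slice_lhs 1 3 => rw [whisk_interchanger_cell (by simp only [nf₁ C]) (by simp only [nf₁ C])
    (by simp only [nf₁ C])]
  simp only [nf₂ C, nf₄ C, nf₅ C, nf₁ C]
  slice_lhs 4 5 => rw [whisk_exchange (asc _ _ _ ≫ M.hom z w₀ ⋉ V.val ⋊ W'.dom ≫ M.hom z w₀ ⋉ M.hom y z ⋉ W'.val ≫ ascInv _ _ _)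
    (by simp only [nf₁ C]) (by simp only [nf₁ C])]
  simp only [nf₂ C, nf₁ C]
  slice_lhs 3 4 => rw [whisk_exchange (M.hom z w₀ ⋉ M.hom y z ⋉ W'.val ≫ ascInv _ _ _)
    (by simp only [nf₁ C]) (by simp only [nf₁ C])]
  simp only [nf₂ C, nf₁ C]
  slice_lhs 2 3 => rw [whisk_exchange (ascInv _ _ _)
    (by simp only [nf₁ C]) (by simp only [nf₁ C])]
  simp only [nf₂ C, nf₁ C]
  refine eq_of_heq ?_
  repeat' refine whisk_comp_heq rfl rfl ?_
  exact whisk_heq _ _ _ _ _ rfl rfl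

end El
namespace El

variable {M : EnrichedTwoCategory C Ob} {x y z w₀ s : Ob}

theorem run_naturality {U V : M.El x y} (F : U ⟶ V) :
    wR F (one M x) ≫ (run V).hom = (run U).hom ≫ F := by
  obtain ⟨k, σ⟩ := F
  simp only [run_hom_mk, wR_mk, mk_comp_mk]
  refine mk_ext (by simp only [nf₁ C]) ?_
  simp only [nf₂ C, nf₃ C, nf₄ C, nf₅ C, nf₁ C, nf₆ C]
  slice_lhs 1 2 => rw [whisk_exchange (ruInv _)
    (by simp only [nf₁ C]) (by simp only [nf₁ C])]
  simp only [nf₂ C, nf₁ C]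
  refine eq_of_heq ?_
  repeat' refine whisk_comp_heq rfl rfl ?_
  exact whisk_heq _ _ _ _ _ rfl rfl

theorem lun_naturality {U V : M.El x y} (F : U ⟶ V) :
    wL (one M y) F ≫ (lun V).hom = (lun U).hom ≫ F := by
  obtain ⟨k, σ⟩ := F
  simp only [lun_hom_mk, wL_mk, mk_comp_mk]
  refine mk_ext (by simp only [nf₁ C]) ?_
  simp only [nf₂ C, nf₃ C, nf₄ C, nf₅ C, nf₁ C, nf₆ C]
  slice_lhs 1 3 => rw [whisk_interchanger_cell (by simp only [nf₁ C]) (by simp only [nf₁ C])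
    (by simp only [nf₁ C])]
  simp only [nf₂ C, nf₄ C, nf₅ C, nf₁ C]
  slice_lhs 2 3 => rw [whisk_exchange (luInv _)
    (by simp only [nf₁ C]) (by simp only [nf₁ C])]
  simp only [nf₂ C, nf₁ C]
  refine eq_of_heq ?_
  repeat' refine whisk_comp_heq rfl rfl ?_
  exact whisk_heq _ _ _ _ _ rfl rfl

/-- The enriched triangle identity turns the enriched associator and left unitor into the right
unitor. That unitor then has to pass the interchanger with `V.val`, which is naturality of the
interchanger. -/
theorem triangle (U : M.El y z) (V : M.El x y) :
    (α U (one M y) V).hom ≫ wL U (lun V).hom = wR (run U).hom V := by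
  simp only [α_hom_mk, run_hom_mk, lun_hom_mk, wL_mk, wR_mk, mk_comp_mk]
  refine mk_ext (by simp only [nf₁ C]) ?_
  simp only [nf₂ C, nf₃ C, nf₄ C, nf₅ C, nf₁ C, nf₆ C]
  slice_lhs 2 3 => rw [whisk_exchange_symm (ascInv _ _ _)
    (by simp only [nf₁ C]) (by simp only [nf₁ C])]
  simp only [nf₂ C, nf₁ C]
  have T := M.triangle x y z
  rw [eq_iff_whisk] at T
  simp only [nf₂ C, nf₃ C, nf₄ C, nf₅ C, nf₁ C] at T
  slice_lhs 3 4 => rw [whisk_subst₂ T.symm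
    (ru U.dom ⋊ V.dom ≫ U.val ⋊ V.dom ≫ M.hom y z ⋉ V.val ≫ ruInv (M.hom y z) ⋊ M.hom x y) (𝟙 _)
    (by simp only [nf₁ C]) (by simp only [nf₁ C])
    (by simp only [nf₁ C]) (by simp only [nf₁ C])]
  refine Eq.trans (eq_of_heq ?_) ((whisk_interchanger_left (η := (M.rightUnitor y z).hom)
    (g := V.val) (p := U.val ⋊ unit ⋊ V.dom) (q := M.comp x y z) (hs := by simp only [nf₁ C])
    (ht := rfl) (hs' := by simp only [nf₁ C]) (hr := by simp only [nf₁ C]) rfl).symm.trans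
    (eq_of_heq ?_))
  · simp only [nf₂ C, nf₃ C, nf₄ C, nf₅ C, nf₁ C, nf₆ C]
    repeat' refine whisk_comp_heq rfl rfl ?_
    exact whisk_heq _ _ _ _ _ rfl rfl
  · simp only [nf₂ C, nf₃ C, nf₄ C, nf₅ C, nf₁ C, nf₆ C]
    exact whisk_heq _ _ _ _ _ rfl rfl

set_option maxHeartbeats 2000000 in
-- Two inputs are needed: naturality of the interchanger, to move `Z.val` past the enriched
-- associator of the first three factors, and the enriched pentagon. Everything else is exchange of
-- disjoint cells.
theorem pentagon (U : M.El w₀ s) (V : M.El z w₀) (W : M.El y z) (Z : M.El x y) :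
    wR (α U V W).hom Z ≫ (α U (V ⊙ W) Z).hom ≫ wL U (α V W Z).hom =
      (α (U ⊙ V) W Z).hom ≫ (α U V (W ⊙ Z)).hom := by
  simp only [α_hom_mk, wL_mk, wR_mk, mk_comp_mk]
  refine mk_ext (by simp only [nf₁ C]) ?_
  simp only [nf₂ C, nf₃ C, nf₄ C, nf₅ C, nf₁ C, nf₆ C]
  simp only [nf₇ C, nf₂ C, nf₅ C, nf₁ C]
  slice_lhs 4 5 => rw [whisk_exchange_symm (ascInv _ _ _)
    (by simp only [nf₁ C]) (by simp only [nf₁ C])]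
  simp only [nf₂ C, nf₁ C]
  -- `N` commutes the associator 2-cell with `Z.val`, bringing the three associators of the enriched
  -- pentagon next to each other.
  have N := whisk_interchanger_left (η := (M.assoc y z w₀ s).hom) (g := Z.val) (p := 𝟙 _)
    (q := 𝟙 _) (hs := rfl) (ht := rfl) (hs' := by simp only [nf₁ C]) (hr := rfl) rfl
  simp only [nf₂ C, nf₃ C, nf₄ C, nf₅ C, nf₁ C, nf₆ C] at N
  slice_lhs 2 4 => rw [whisk_subst₃ N
    (U.val ⋊ V.dom ⋊ W.dom ⋊ Z.dom ≫ (M.hom w₀ s ⋉ V.val) ⋊ W.dom ⋊ Z.dom ≫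
      ((M.hom w₀ s ⊡ M.hom z w₀) ⋉ W.val) ⋊ Z.dom) (M.comp x y s)
    (by simp only [nf₁ C]) (by simp only [nf₁ C])
    (by simp only [nf₁ C]) (by simp only [nf₁ C]) (by simp only [nf₁ C]) (by simp only [nf₁ C])]
  simp only [nf₂ C, nf₁ C]
  have T := M.pentagon x y z w₀ s
  rw [eq_iff_whisk] at T
  simp only [nf₂ C, nf₃ C, nf₄ C, nf₅ C, nf₁ C] at T
  slice_lhs 4 6 => rw [whisk_subst₃ T
    (U.val ⋊ V.dom ⋊ W.dom ⋊ Z.dom ≫ (M.hom w₀ s ⋉ V.val) ⋊ W.dom ⋊ Z.dom ≫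
      ((M.hom w₀ s ⊡ M.hom z w₀) ⋉ W.val) ⋊ Z.dom ≫
      ((M.hom w₀ s ⊡ M.hom z w₀) ⊡ M.hom y z) ⋉ Z.val) (𝟙 _)
    (by simp only [nf₁ C]) (by simp only [nf₁ C])
    (by simp only [nf₁ C]) (by simp only [nf₁ C]) (by simp only [nf₁ C]) (by simp only [nf₁ C])]
  simp only [nf₂ C, nf₁ C]
  slice_lhs 1 2 => rw [whisk_exchange (𝟙 _)
    (by simp only [nf₁ C]) (by simp only [nf₁ C])]
  simp only [nf₂ C, nf₁ C]
  slice_lhs 3 4 => rw [whisk_exchange (𝟙 _)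
    (by simp only [nf₁ C]) (by simp only [nf₁ C])]
  simp only [nf₂ C, nf₁ C]
  slice_lhs 2 3 => rw [whisk_exchange ((M.hom z s ⊡ M.hom y z) ⋉ Z.val)
    (by simp only [nf₁ C]) (by simp only [nf₁ C])]
  simp only [nf₂ C, nf₁ C]
  refine eq_of_heq ?_
  repeat' refine whisk_comp_heq rfl rfl ?_
  exact whisk_heq _ _ _ _ _ rfl rfl

end El
end EnrichedTwoCategory

/-! ### 3-cells between cells of generalised 1-cells -/

namespace GrayMonoid

variable {C : Type u} [Bicategory.{w, v} C] [Bicategory.Strict C] [GrayMonoid C]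

theorem whisk_interchanger_left_symm {A A' B B' X Y : C} {f f' : A ⟶ A'} {η : f ⟶ f'} {g : B ⟶ B'}
    {p : X ⟶ A ⊡ B} {q : A' ⊡ B' ⟶ Y} {p₁ : X ⟶ A ⊡ B'} {s t r : X ⟶ Y}
    {hs : s = p ≫ (f ⋊ B ≫ A' ⋉ g) ≫ q} {ht : t = p ≫ (A ⋉ g ≫ f ⋊ B') ≫ q}
    {hs' : t = p₁ ≫ f ⋊ B' ≫ q} {hr : r = p₁ ≫ f' ⋊ B' ≫ q} (e : p₁ = p ≫ A ⋉ g) :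
    whisk p (interchanger f g).inv q hs ht ≫ whisk p₁ (η ⋊₂ B') q hs' hr =
      whisk p (η ⋊₂ B) (A' ⋉ g ≫ q) (by simp [hs]) rfl ≫
        whisk p (interchanger f' g).inv q (by simp) (by simp [hr, e]) := by
  rw [whisk_interchanger_left rfl]
  subst e
  exact eq_of_heq (whisk_comp_heq rfl rfl (whisk_heq _ _ _ _ _ rfl rfl))

end GrayMonoid

namespace EnrichedTwoCategory

variable {C : Type u} [Bicategory.{w, v} C] [Bicategory.Strict C] [GrayMonoid C] {Ob : Type t}

namespace El

variable {M : EnrichedTwoCategory C Ob} {x y z w₀ s : Ob}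

/-- A 2-cell `θ` between the 1-cells underlying `F` and `G` which is compatible with the cells over
the hom object. -/
def Is3 {U V : M.El x y} (F G : U ⟶ V) (θ : F.deg ⟶ G.deg) : Prop :=
  F.cell ≫ θ ▷ V.val = G.cell

theorem is3_mk_iff {U V : M.El x y} {k l : U.dom ⟶ V.dom} {σ : U.val ⟶ k ≫ V.val}
    {τ : U.val ⟶ l ≫ V.val} {θ : k ⟶ l} :
    Is3 (mkHom k σ) (mkHom l τ) θ ↔
      whisk (𝟙 _) σ (𝟙 _) (by simp) rfl ≫ whisk (𝟙 _) θ V.val (by simp) (by simp) =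
        whisk (𝟙 _) τ (𝟙 _) (s := U.val) (t := l ≫ V.val) (by simp) (by simp) := by
  change σ ≫ θ ▷ V.val = τ ↔ _
  rw [eq_iff_whisk]
  simp only [nf₂ C, nf₅ C, nf₁ C]

theorem Is3.of_mk {U V : M.El x y} {F G : U ⟶ V} {θ : F.deg ⟶ G.deg} {k l : U.dom ⟶ V.dom}
    {σ : U.val ⟶ k ≫ V.val} {τ : U.val ⟶ l ≫ V.val} {θ' : k ⟶ l} (hF : F = mkHom k σ)
    (hG : G = mkHom l τ) (hθ : HEq θ θ')
    (h : whisk (𝟙 _) σ (𝟙 _) (by simp) rfl ≫ whisk (𝟙 _) θ' V.val (by simp) (by simp) =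
      whisk (𝟙 _) τ (𝟙 _) (s := U.val) (t := l ≫ V.val) (by simp) (by simp)) : Is3 F G θ := by
  subst hF hG
  obtain rfl := eq_of_heq hθ
  exact is3_mk_iff.2 h

namespace Is3

variable {U V W : M.El x y}

theorem of_eq {F G : U ⟶ V} (h : F = G) : Is3 F G (eqToHom (congrArg Hom.deg h)) := by
  subst h
  simp [Is3]

/-- Lets a 3-cell that happens to be an identity be used as an equation of cells; strict exchange
laws are extracted from `is3_interchanger` in this way. -/
theorem eq_of_eqToHom {F G : U ⟶ V} {h : F.deg = G.deg} (H : Is3 F G (eqToHom h)) : F = G := by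
  obtain ⟨k, σ⟩ := F
  obtain ⟨l, τ⟩ := G
  obtain rfl : k = l := h
  obtain rfl : σ = τ := by simpa [Is3] using H
  rfl

theorem trans {F G H : U ⟶ V} {θ : F.deg ⟶ G.deg} {φ : G.deg ⟶ H.deg} (h : Is3 F G θ)
    (h' : Is3 G H φ) : Is3 F H (θ ≫ φ) := by
  rw [Is3, comp_whiskerRight, ← Category.assoc, h, h']

theorem symm {F G : U ⟶ V} {θ : F.deg ≅ G.deg} (h : Is3 F G θ.hom) : Is3 G F θ.inv := by
  rw [Is3, ← h, Category.assoc, ← comp_whiskerRight, Iso.hom_inv_id, id_whiskerRight,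
    Category.comp_id]

theorem whiskerLeft (F : U ⟶ V) {G H : V ⟶ W} {θ : G.deg ⟶ H.deg} (h : Is3 G H θ) :
    Is3 (F ≫ G) (F ≫ H) (F.deg ◁ θ) := by
  obtain ⟨k, σ⟩ := F
  obtain ⟨l, τ⟩ := G
  obtain ⟨l', τ'⟩ := H
  change l ⟶ l' at θ
  obtain rfl : τ ≫ θ ▷ W.val = τ' := h
  refine Is3.of_mk (by simp only [wL_mk, wR_mk, mk_comp_mk]; rfl)
    (by simp only [wL_mk, wR_mk, mk_comp_mk]; rfl) HEq.rfl ?_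
  simp only [nf₂ C, nf₅ C, nf₁ C]
  refine eq_of_heq ?_
  repeat' refine whisk_comp_heq rfl rfl ?_
  exact whisk_heq _ _ _ _ _ rfl rfl

theorem whiskerRight {F G : U ⟶ V} {θ : F.deg ⟶ G.deg} (h : Is3 F G θ) (H : V ⟶ W) :
    Is3 (F ≫ H) (G ≫ H) (θ ▷ H.deg) := by
  obtain ⟨k, σ⟩ := F
  obtain ⟨l, τ⟩ := G
  obtain ⟨m, ρ⟩ := H
  change k ⟶ l at θ
  obtain rfl : σ ≫ θ ▷ V.val = τ := h
  refine Is3.of_mk (by simp only [wL_mk, wR_mk, mk_comp_mk]; rfl)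
    (by simp only [wL_mk, wR_mk, mk_comp_mk]; rfl) HEq.rfl ?_
  simp only [nf₂ C, nf₅ C, nf₁ C]
  slice_rhs 2 3 => rw [whisk_exchange (𝟙 _) (by simp only [nf₁ C]) (by simp only [nf₁ C])]
  simp only [nf₂ C, nf₁ C]
  refine eq_of_heq ?_
  repeat' refine whisk_comp_heq rfl rfl ?_
  exact whisk_heq _ _ _ _ _ rfl rfl

end Is3

theorem Is3.wR {U U' : M.El y z} {F G : U ⟶ U'} {θ : F.deg ⟶ G.deg} (h : Is3 F G θ)
    (V : M.El x y) : Is3 (wR F V) (wR G V) (θ ⋊₂ V.dom) := by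
  obtain ⟨k, σ⟩ := F
  obtain ⟨l, τ⟩ := G
  change k ⟶ l at θ
  obtain rfl : σ ≫ θ ▷ U'.val = τ := h
  refine Is3.of_mk (by simp only [wL_mk, wR_mk, mk_comp_mk]; rfl)
    (by simp only [wL_mk, wR_mk, mk_comp_mk]; rfl) HEq.rfl ?_
  simp only [nf₂ C, nf₃ C, nf₅ C, nf₁ C]
  refine eq_of_heq ?_
  repeat' refine whisk_comp_heq rfl rfl ?_
  exact whisk_heq _ _ _ _ _ rfl rfl

theorem Is3.wL (U : M.El y z) {V V' : M.El x y} {F G : V ⟶ V'} {θ : F.deg ⟶ G.deg}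
    (h : Is3 F G θ) : Is3 (wL U F) (wL U G) (U.dom ⋉₂ θ) := by
  obtain ⟨k, σ⟩ := F
  obtain ⟨l, τ⟩ := G
  change k ⟶ l at θ
  obtain rfl : σ ≫ θ ▷ V'.val = τ := h
  refine Is3.of_mk (by simp only [wL_mk, wR_mk, mk_comp_mk]; rfl)
    (by simp only [wL_mk, wR_mk, mk_comp_mk]; rfl) HEq.rfl ?_
  simp only [nf₂ C, nf₃ C, nf₅ C, nf₁ C]
  slice_rhs 2 3 => rw [whisk_interchanger_right (by simp only [nf₁ C])]
  refine eq_of_heq ?_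
  repeat' refine whisk_comp_heq rfl rfl ?_
  exact whisk_heq _ _ _ _ _ rfl rfl

/-- The product of cells is functorial only up to the Gray structure: the two orders of applying `F`
and `G` differ by the interchanger of their degrees and by nothing else. The interchanger of `F.deg`
with `V'.val` cancels, and naturality handles the 2-cells. -/
theorem is3_interchanger {U U' : M.El y z} (F : U ⟶ U') {V V' : M.El x y} (G : V ⟶ V') :
    Is3 (wL U G ≫ wR F V') (wR F V ≫ wL U' G) (interchanger F.deg G.deg).hom := by
  obtain ⟨k, σ⟩ := F
  obtain ⟨l, τ⟩ := G
  refine Is3.of_mk (by simp only [wL_mk, wR_mk, mk_comp_mk]; rfl)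
    (by simp only [wL_mk, wR_mk, mk_comp_mk]; rfl) HEq.rfl ?_
  simp only [nf₂ C, nf₃ C, nf₅ C, nf₁ C]
  slice_lhs 2 3 => rw [whisk_interchanger_left_symm (by simp only [nf₁ C])]
  simp only [nf₂ C, nf₃ C, nf₅ C, nf₆ C, nf₁ C]
  slice_lhs 4 5 => rw [whisk_inv_hom]
  simp only [nf₂ C, nf₅ C]
  slice_rhs 1 2 => rw [whisk_exchange (𝟙 _) (by simp only [nf₁ C]) (by simp only [nf₁ C])]
  simp only [nf₂ C, nf₁ C]
  refine eq_of_heq ?_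
  repeat' refine whisk_comp_heq rfl rfl ?_
  exact whisk_heq _ _ _ _ _ rfl rfl

end El
end EnrichedTwoCategory

/-! ### Pasting of lax squares, central cells and the bicategory they form -/

namespace EnrichedTwoCategory

section Coherence

variable {B : Type u₁} [Bicategory.{w₁, v₁} B] {a b : B} {f : a ⟶ b} {p : b ⟶ b} {q : a ⟶ a}

/-- A lax square `f p ⟶ q f` pasted with itself. -/
def pasteMul (ω : f ≫ p ⟶ q ≫ f) : f ≫ p ≫ p ⟶ (q ≫ q) ≫ f :=
  (α_ f p p).inv ≫ ω ▷ p ≫ (α_ q f p).hom ≫ q ◁ ω ≫ (α_ q q f).inv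

/-- The lax square pasted from a unit. -/
def pasteOne (f : a ⟶ b) : f ≫ 𝟙 b ⟶ 𝟙 a ≫ f := (ρ_ f).hom ≫ (λ_ f).inv

/-- Both sides paste three copies of `ω` side by side, so they differ only by coherence cells.
Stating this in an arbitrary bicategory keeps the Gray structure out of the argument. -/
theorem pasteMul_assoc (ω : f ≫ p ⟶ q ≫ f) :
    f ◁ (α_ p p p).hom ≫ (α_ f p (p ≫ p)).inv ≫ ω ▷ (p ≫ p) ≫ (α_ q f (p ≫ p)).hom ≫
      q ◁ pasteMul ω ≫ (α_ q (q ≫ q) f).inv =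
    ((α_ f (p ≫ p) p).inv ≫ pasteMul ω ▷ p ≫ (α_ (q ≫ q) f p).hom ≫ (q ≫ q) ◁ ω ≫
      (α_ (q ≫ q) q f).inv) ≫ (α_ q q q).hom ▷ f := by
  simp only [pasteMul]
  bicategory

theorem pasteOne_left (ω : f ≫ p ⟶ q ≫ f) :
    f ◁ (λ_ p).hom ≫ ω =
      ((α_ f (𝟙 b) p).inv ≫ pasteOne f ▷ p ≫ (α_ (𝟙 a) f p).hom ≫ 𝟙 a ◁ ω ≫
        (α_ (𝟙 a) q f).inv) ≫ (λ_ q).hom ▷ f := by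
  simp only [pasteOne]
  bicategory

theorem pasteOne_right (ω : f ≫ p ⟶ q ≫ f) :
    f ◁ (ρ_ p).hom ≫ ω =
      ((α_ f p (𝟙 b)).inv ≫ ω ▷ 𝟙 b ≫ (α_ q f (𝟙 b)).hom ≫ q ◁ pasteOne f ≫
        (α_ q (𝟙 a) f).inv) ≫ (ρ_ q).hom ▷ f := by
  simp only [pasteOne]
  bicategory

end Coherence

variable {C : Type u} [Bicategory.{w, v} C] [Bicategory.Strict C] [GrayMonoid C] {Ob : Type t}

namespace El

variable {M : EnrichedTwoCategory C Ob} {x y z w₀ s : Ob}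

/-- The cells which lie over an equality of domains. -/
def IsCentral {U V : M.El x y} (F : U ⟶ V) : Prop := ∃ h : U.dom = V.dom, F.deg = eqToHom h

namespace IsCentral

theorem id (U : M.El x y) : IsCentral (𝟙 U) := ⟨rfl, rfl⟩

variable {U V W : M.El x y}

theorem comp {F : U ⟶ V} {G : V ⟶ W} (hF : IsCentral F) (hG : IsCentral G) :
    IsCentral (F ≫ G) := by
  obtain ⟨h, e⟩ := hF
  obtain ⟨h', e'⟩ := hG
  exact ⟨h.trans h', by rw [comp_deg, e, e', eqToHom_trans]⟩

theorem inv {F : U ≅ V} (hF : IsCentral F.hom) : IsCentral F.inv := by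
  obtain ⟨h, e⟩ := hF
  refine ⟨h.symm, ?_⟩
  have := congrArg Hom.deg F.hom_inv_id
  rw [comp_deg, e, id_deg] at this
  rw [← cancel_epi (eqToHom h), this]
  simp

theorem wR {U V : M.El y z} {F : U ⟶ V} (hF : IsCentral F) (W : M.El x y) :
    IsCentral (wR F W) := by
  obtain ⟨h, e⟩ := hF
  exact ⟨congrArg (· ⊡ W.dom) h, by rw [wR_deg, e, eqToHom_wr]⟩

theorem wL (W : M.El y z) {F : U ⟶ V} (hF : IsCentral F) : IsCentral (wL W F) := by
  obtain ⟨h, e⟩ := hF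
  exact ⟨congrArg (W.dom ⊡ ·) h, by rw [wL_deg, e, wl_eqToHom]⟩

end IsCentral

theorem isCentral_α (U : M.El z w₀) (V : M.El y z) (W : M.El x y) : IsCentral (α U V W).hom :=
  ⟨tensor_assoc _ _ _, rfl⟩

theorem isCentral_lun (U : M.El x y) : IsCentral (lun U).hom := ⟨unit_tensor _, rfl⟩

theorem isCentral_run (U : M.El x y) : IsCentral (run U).hom := ⟨tensor_unit _, rfl⟩

/-- An interchanger with an identity argument is an identity, so the exchange law, which in general
holds up to that interchanger, becomes strict. -/
theorem exchange_of_isCentral_right {U U' : M.El y z} (F : U ⟶ U') {V V' : M.El x y} {G : V ⟶ V'}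
    (hG : IsCentral G) : wL U G ≫ wR F V' = wR F V ≫ wL U' G := by
  obtain ⟨l, τ⟩ := G
  obtain ⟨h, rfl : l = eqToHom h⟩ := hG
  have := is3_interchanger F (mkHom (eqToHom h) τ)
  rw [show (interchanger F.deg (Hom.deg (mkHom (eqToHom h) τ))).hom = eqToHom _ from
    interchanger_eqToHom_right F.deg h] at this
  exact this.eq_of_eqToHom

theorem exchange_of_isCentral_left {U U' : M.El y z} {F : U ⟶ U'} (hF : IsCentral F)
    {V V' : M.El x y} (G : V ⟶ V') : wL U G ≫ wR F V' = wR F V ≫ wL U' G := by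
  obtain ⟨k, σ⟩ := F
  obtain ⟨h, rfl : k = eqToHom h⟩ := hF
  have := is3_interchanger (mkHom (eqToHom h) σ) G
  rw [show (interchanger (Hom.deg (mkHom (eqToHom h) σ)) G.deg).hom = eqToHom _ from
    interchanger_eqToHom_left h G.deg] at this
  exact this.eq_of_eqToHom

end El

/-- The objects of an enriched 2-category, as objects of the bicategory of generalised 1-cells and
central cells. -/
structure Central (_ : EnrichedTwoCategory C Ob) where
  /-- the underlying object -/
  pt : Ob

namespace Central

open El

variable {M : EnrichedTwoCategory C Ob}

variable (M) in
/-- The 1-cells of the bicategory `M.Central`. -/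
structure Hom₁ (x y : Ob) where
  /-- the generalised 1-cell -/
  el : M.El y x

variable {x y z : Ob}

/-- The 2-cells of the bicategory `M.Central`. -/
@[ext]
structure Hom₂ (U V : Hom₁ M x y) where
  /-- the underlying cell -/
  hom : U.el ⟶ V.el
  isCentral : IsCentral hom

instance homCategory (x y : Ob) : Category (Hom₁ M x y) where
  Hom := Hom₂
  id U := ⟨𝟙 U.el, .id _⟩
  comp F G := ⟨F.hom ≫ G.hom, F.isCentral.comp G.isCentral⟩
  id_comp F := Hom₂.ext (Category.id_comp F.hom)
  comp_id F := Hom₂.ext (Category.comp_id F.hom)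
  assoc F G H := Hom₂.ext (Category.assoc F.hom G.hom H.hom)

theorem hom_ext {U V : Hom₁ M x y} {F G : U ⟶ V} (h : F.hom = G.hom) : F = G := Hom₂.ext h

/-- A central isomorphism of generalised 1-cells, as an isomorphism of `M.Central`. -/
@[simps]
def isoMk {U V : Hom₁ M x y} (F : U.el ≅ V.el) (h : IsCentral F.hom) : U ≅ V where
  hom := ⟨F.hom, h⟩
  inv := ⟨F.inv, h.inv⟩
  hom_inv_id := Hom₂.ext F.hom_inv_id
  inv_hom_id := Hom₂.ext F.inv_hom_id

/-- Restriction to central cells is what makes `whisker_exchange` hold. The direction of 1-cells is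
reversed relative to `M`, so that the diagrammatic composite `U ≫ V` is the product `U ⊙ V`. -/
instance : Bicategory M.Central where
  Hom x y := Hom₁ M x.pt y.pt
  homCategory x y := homCategory x.pt y.pt
  id x := ⟨El.one M x.pt⟩
  comp U V := ⟨prod U.el V.el⟩
  whiskerLeft U _ _ F := ⟨wL U.el F.hom, F.isCentral.wL U.el⟩
  whiskerRight F V := ⟨wR F.hom V.el, F.isCentral.wR V.el⟩
  associator U V W := isoMk (α U.el V.el W.el) (isCentral_α _ _ _)
  leftUnitor U := isoMk (lun U.el) (isCentral_lun _)
  rightUnitor U := isoMk (run U.el) (isCentral_run _)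
  whiskerLeft_id U V := hom_ext (wL_id U.el V.el)
  whiskerLeft_comp U _ _ _ F G := hom_ext (wL_comp U.el F.hom G.hom)
  id_whiskerLeft F := by
    rw [← Category.assoc]; exact (Iso.eq_comp_inv _).2 (hom_ext (lun_naturality F.hom))
  comp_whiskerLeft U V _ _ F := by
    rw [← Category.assoc]; exact (Iso.eq_comp_inv _).2 (hom_ext (wL_α U.el V.el F.hom))
  id_whiskerRight U V := hom_ext (wR_id U.el V.el)
  comp_whiskerRight F G V := hom_ext (wR_comp F.hom G.hom V.el)
  whiskerRight_id F := by
    rw [← Category.assoc]; exact (Iso.eq_comp_inv _).2 (hom_ext (run_naturality F.hom))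
  whiskerRight_comp F V W := (Iso.eq_inv_comp _).2 (hom_ext (wR_α F.hom V.el W.el).symm)
  whisker_assoc U _ _ F W := by
    rw [← Category.assoc]; exact (Iso.eq_comp_inv _).2 (hom_ext (wL_wR_α U.el F.hom W.el))
  whisker_exchange F G := hom_ext (exchange_of_isCentral_left F.isCentral G.hom)
  pentagon U V W Z := hom_ext (El.pentagon U.el V.el W.el Z.el)
  triangle U V := hom_ext (El.triangle U.el V.el)

end Central

end EnrichedTwoCategory

/-! ### `f_*` and `f^*` as products with `f` -/

namespace GrayMonoid

variable {C : Type u} [Bicategory.{w, v} C] [Bicategory.Strict C]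

theorem whisk_hom_inv_of_eq {X X' Y' Y : C} {f f' : X ⟶ X'} {a b : X' ⟶ Y'} {σ : a ≅ b}
    {g g' : Y' ⟶ Y} {s t r : X ⟶ Y} {hs : s = f ≫ a ≫ g} {ht : t = f ≫ b ≫ g}
    {ht' : t = f' ≫ b ≫ g'} {hr : r = f' ≫ a ≫ g'} (hf : f = f') (hg : g = g') :
    whisk f σ.hom g hs ht ≫ whisk f' σ.inv g' ht' hr = eqToHom (by rw [hs, hr, hf, hg]) := by
  subst hf hg
  exact whisk_hom_inv f σ g hs ht hr

theorem whisk_inv_hom_of_eq {X X' Y' Y : C} {f f' : X ⟶ X'} {a b : X' ⟶ Y'} {σ : a ≅ b}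
    {g g' : Y' ⟶ Y} {s t r : X ⟶ Y} {hs : s = f ≫ b ≫ g} {ht : t = f ≫ a ≫ g}
    {ht' : t = f' ≫ a ≫ g'} {hr : r = f' ≫ b ≫ g'} (hf : f = f') (hg : g = g') :
    whisk f σ.inv g hs ht ≫ whisk f' σ.hom g' ht' hr = eqToHom (by rw [hs, hr, hf, hg]) := by
  subst hf hg
  exact whisk_inv_hom f σ g hs ht hr

end GrayMonoid

namespace EnrichedTwoCategory

variable {C : Type u} [Bicategory.{w, v} C] [Bicategory.Strict C] [GrayMonoid C] {Ob : Type t}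
  {M : EnrichedTwoCategory C Ob} {x y : Ob}

theorem push_eq (w : Ob) (f : M.Mor x y) :
    M.push w f = luInv (M.hom w x) ≫ f ⋊ M.hom w x ≫ M.comp w x y := by rw [push]

theorem pull_eq (f : M.Mor x y) (z : Ob) :
    M.pull f z = ruInv (M.hom y z) ≫ M.hom y z ⋉ f ≫ M.comp x y z := by rw [pull]

theorem pushComp_hom (v w : Ob) (f : M.Mor x y) : (M.pushComp v w f).hom =
    whisk (luInv _) (interchanger f (M.comp v w x)).hom (M.comp v x y)
        (by simp only [push_eq, pull_eq, nf₁ C]) rfl ≫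
      whisk (luInv (M.hom w x ⊡ M.hom v w) ≫ f ⋊ (M.hom w x ⊡ M.hom v w) ≫
        ascInv (M.hom x y) (M.hom w x) (M.hom v w)) (M.assoc v w x y).inv (𝟙 _)
        (by simp only [push_eq, pull_eq, nf₁ C]) (by simp only [push_eq, pull_eq, nf₁ C]) := by
  rw [eq_iff_whisk]
  simp only [pushComp, Iso.trans_hom, eqToIso.hom, whiskerLeftIso_hom, whiskerRightIso_hom,
    Iso.symm_hom, nf₂ C, nf₅ C, nf₁ C]

theorem pullPush_hom (w : Ob) (f : M.Mor x y) (z : Ob) : (M.pullPush w f z).hom =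
    whisk (ruInv (M.hom y z) ⋊ M.hom w x ≫ (M.hom y z ⋉ f) ⋊ M.hom w x) (M.assoc w x y z).hom (𝟙 _)
        (by simp only [push_eq, pull_eq, nf₁ C]) (by simp only [push_eq, pull_eq, nf₁ C]) := by
  rw [eq_iff_whisk]
  simp only [pullPush, Iso.trans_hom, eqToIso.hom, whiskerLeftIso_hom, whiskerRightIso_hom,
    Iso.symm_hom, nf₂ C, nf₅ C, nf₁ C]

theorem compPull_hom (f : M.Mor x y) (z t : Ob) : (M.compPull f z t).hom =
    whisk (M.hom z t ⋉ ruInv (M.hom y z) ≫ M.hom z t ⋉ (M.hom y z ⋉ f) ≫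
        ascInv (M.hom z t) (M.hom y z) (M.hom x y)) (M.assoc x y z t).inv (𝟙 _)
        (by simp only [push_eq, pull_eq, nf₁ C]) rfl ≫
      whisk (ruInv (M.hom z t ⊡ M.hom y z)) (interchanger (M.comp y z t) f).hom (M.comp x y t)
        (by simp only [push_eq, pull_eq, nf₁ C]) (by simp only [push_eq, pull_eq, nf₁ C]) := by
  rw [eq_iff_whisk]
  simp only [compPull, Iso.trans_hom, eqToIso.hom, whiskerLeftIso_hom, whiskerRightIso_hom,
    Iso.symm_hom, nf₂ C, nf₅ C, nf₁ C]
  refine eq_of_heq ?_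
  repeat' refine whisk_comp_heq rfl rfl ?_
  exact whisk_heq _ _ _ _ _ rfl rfl

theorem onePush_hom (f : M.Mor x y) : (M.onePush f).hom =
    whisk (luInv unit) (interchanger f (M.one x)).hom (M.comp x x y)
        (by simp only [push_eq, pull_eq, nf₁ C]) rfl ≫
      whisk (luInv unit ≫ f ⋊ unit) (M.rightUnitor x y).hom (𝟙 _)
        (by simp only [push_eq, pull_eq, nf₁ C]) (by simp only [push_eq, pull_eq, nf₁ C]) := by
  rw [eq_iff_whisk]
  simp only [onePush, Iso.trans_hom, eqToIso.hom, whiskerLeftIso_hom, whiskerRightIso_hom,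
    Iso.symm_hom, nf₂ C, nf₅ C, nf₁ C]

theorem onePull_hom (f : M.Mor x y) : (M.onePull f).hom =
    whisk (ruInv unit) (interchanger (M.one y) f).inv (M.comp x y y)
        (by simp only [push_eq, pull_eq, nf₁ C]) rfl ≫
      whisk (ruInv unit ≫ unit ⋉ f) (M.leftUnitor x y).hom (𝟙 _)
        (by simp only [push_eq, pull_eq, nf₁ C]) (by simp only [push_eq, pull_eq, nf₁ C]) := by
  rw [eq_iff_whisk]
  simp only [onePull, Iso.trans_hom, eqToIso.hom, whiskerLeftIso_hom, whiskerRightIso_hom,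
    Iso.symm_hom, nf₂ C, nf₅ C, nf₁ C]

theorem interchanger_push (w : Ob) (f : M.Mor x y) {B B' : C} (g : B ⟶ B') :
    (interchanger (M.push w f) g).hom = whisk (𝟙 _)
      (interchanger (luInv (M.hom w x) ≫ f ⋊ M.hom w x ≫ M.comp w x y) g).hom (𝟙 _)
      (by simp only [push_eq, nf₁ C]) (by simp only [push_eq, nf₁ C]) :=
  interchanger_congr rfl rfl

theorem interchanger_pull_inv (f : M.Mor x y) (z : Ob) {B B' : C} (g : B ⟶ B') :
    (interchanger (M.pull f z) g).inv = whisk (𝟙 _)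
      (interchanger (ruInv (M.hom y z) ≫ M.hom y z ⋉ f ≫ M.comp x y z) g).inv (𝟙 _)
      (by simp only [pull_eq, nf₁ C]) (by simp only [pull_eq, nf₁ C]) :=
  interchanger_congr_inv rfl rfl

namespace El

variable {M : EnrichedTwoCategory C Ob} {x y z w₀ s : Ob}

/-- A 2-cell between 1-cells into a hom object, as a cell over the identity. -/
abbrev ofCell {D : C} {a b : D ⟶ M.hom x y} (σ : a ⟶ b) : (⟨D, a⟩ : M.El x y) ⟶ ⟨D, b⟩ :=
  mkHom (𝟙 D) (whisk (𝟙 D) σ (𝟙 _) (by simp only [nf₁ C]) (by simp only [nf₁ C]))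

/-- A 1-morphism of the underlying 2-category as a generalised 1-cell. -/
abbrev mor (f : M.Mor x y) : M.El x y := ⟨unit, f⟩

/-- `f_* U`. -/
abbrev pushEl (f : M.Mor x y) (U : M.El z x) : M.El z y := ⟨U.dom, U.val ≫ M.push z f⟩

/-- `f^* U`. -/
abbrev pullEl (f : M.Mor x y) (U : M.El y z) : M.El x z := ⟨U.dom, U.val ≫ M.pull f z⟩

/-- `f_*` on cells. -/
def pushHom (f : M.Mor x y) {U V : M.El z x} (F : U ⟶ V) : pushEl f U ⟶ pushEl f V :=
  mkHom F.deg (whisk (𝟙 _) F.cell (M.push z f) (by simp only [nf₁ C]) (by simp only [nf₁ C]))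

/-- `f^*` on cells. -/
def pullHom (f : M.Mor x y) {U V : M.El y z} (F : U ⟶ V) : pullEl f U ⟶ pullEl f V :=
  mkHom F.deg (whisk (𝟙 _) F.cell (M.pull f z) (by simp only [nf₁ C]) (by simp only [nf₁ C]))

/-- `f ⊙ U ≅ f_* U`. -/
def pushIso (f : M.Mor x y) (U : M.El z x) : mor f ⊙ U ≅ pushEl f U :=
  isoMk (unit_tensor _) (whiskIso (𝟙 _) (interchanger f U.val).symm (M.comp z x y)
    (by simp only [nf₁ C]) (by simp only [push_eq, nf₁ C]))

/-- `U ⊙ f ≅ f^* U`. -/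
def pullIso (f : M.Mor x y) (U : M.El y z) : U ⊙ mor f ≅ pullEl f U :=
  isoMk (tensor_unit _) (eqToIso (by simp only [pull_eq, nf₁ C]))

theorem pushIso_hom_mk (f : M.Mor x y) (U : M.El z x) : (pushIso f U).hom =
    mkHom (eqToHom (unit_tensor _)) (whisk (𝟙 _) (interchanger f U.val).inv (M.comp z x y)
      (by simp only [nf₁ C]) (by simp only [push_eq, nf₁ C])) := rfl

theorem pullIso_hom_mk (f : M.Mor x y) (U : M.El y z) : (pullIso f U).hom =
    mkHom (eqToHom (tensor_unit _)) (eqToHom (by simp only [pull_eq, nf₁ C])) := rfl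

theorem isCentral_pushIso (f : M.Mor x y) (U : M.El z x) : IsCentral (pushIso f U).hom :=
  ⟨unit_tensor _, rfl⟩

theorem isCentral_pullIso (f : M.Mor x y) (U : M.El y z) : IsCentral (pullIso f U).hom :=
  ⟨tensor_unit _, rfl⟩

theorem isCentral_ofCell {D : C} {a b : D ⟶ M.hom x y} (σ : a ⟶ b) : IsCentral (ofCell σ) :=
  ⟨rfl, rfl⟩

theorem pushIso_naturality (f : M.Mor x y) {U V : M.El z x} (F : U ⟶ V) :
    wL (mor f) F ≫ (pushIso f V).hom = (pushIso f U).hom ≫ pushHom f F := by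
  obtain ⟨k, σ⟩ := F
  simp only [pushIso_hom_mk, wL_mk, pushHom, mk_comp_mk]
  refine mk_ext (by simp only [nf₁ C]) ?_
  simp only [nf₂ C, nf₃ C, nf₄ C, nf₅ C, nf₁ C, nf₆ C]
  slice_lhs 1 3 => rw [whisk_interchanger_cell (by simp only [nf₁ C]) (by simp only [nf₁ C])
    (by simp only [nf₁ C])]
  simp only [nf₂ C, nf₄ C, nf₅ C, nf₁ C]
  refine eq_of_heq ?_
  repeat' refine whisk_comp_heq rfl rfl ?_
  exact whisk_heq _ _ _ _ _ rfl rfl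

theorem pullIso_naturality (f : M.Mor x y) {U V : M.El y z} (F : U ⟶ V) :
    wR F (mor f) ≫ (pullIso f V).hom = (pullIso f U).hom ≫ pullHom f F := by
  obtain ⟨k, σ⟩ := F
  simp only [pullIso_hom_mk, wR_mk, pullHom, mk_comp_mk]
  refine mk_ext (by simp only [nf₁ C]) ?_
  simp only [nf₂ C, nf₃ C, nf₄ C, nf₅ C, nf₁ C, nf₆ C]
  exact eq_of_heq (whisk_heq _ _ _ _ _ (by simp only [nf₁ C]) (by simp only [pull_eq, nf₁ C]))

/-- `f_* (U V) ≅ (f_* U) V`. -/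
def pushProd (f : M.Mor x y) (U : M.El w₀ x) (V : M.El z w₀) :
    pushEl f (U ⊙ V) ⟶ pushEl f U ⊙ V :=
  mkHom (𝟙 _) (whisk (tensorHom U.val V.val) (M.pushComp z w₀ f).hom (𝟙 _)
      (by simp only [nf₁ C]) rfl ≫
    whisk (U.val ⋊ V.dom) (interchanger (M.push w₀ f) V.val).hom (M.comp z w₀ y)
      (by simp only [nf₁ C]) (by simp only [nf₁ C]))

/-- `(f^* U) V ≅ U (f_* V)`. -/
def pullProd (f : M.Mor x y) (U : M.El y z) (V : M.El w₀ x) :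
    pullEl f U ⊙ V ⟶ U ⊙ pushEl f V :=
  mkHom (𝟙 _) (whisk (U.val ⋊ V.dom) (interchanger (M.pull f z) V.val).inv (M.comp w₀ x z)
      (by simp only [nf₁ C]) rfl ≫
    whisk (tensorHom U.val V.val) (M.pullPush w₀ f z).hom (𝟙 _)
      (by simp only [nf₁ C]) (by simp only [nf₁ C]))

/-- `U (f^* V) ≅ f^* (U V)`. -/
def prodPull (f : M.Mor x y) (U : M.El z w₀) (V : M.El y z) :
    U ⊙ pullEl f V ⟶ pullEl f (U ⊙ V) :=
  mkHom (𝟙 _) (whisk (tensorHom U.val V.val) (M.compPull f z w₀).hom (𝟙 _)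
    (by simp only [nf₁ C]) (by simp only [nf₁ C]))

set_option maxHeartbeats 1000000 in
-- On the right-hand side the associator of `α` cancels against the one in `pushComp`, and every
-- interchanger cancels against its inverse, except that of `f` with `U.val`, which is the left-hand
-- side.
theorem wR_pushIso (f : M.Mor x y) (U : M.El w₀ x) (V : M.El z w₀) :
    wR (pushIso f U).hom V =
      (α (mor f) U V).hom ≫ (pushIso f (U ⊙ V)).hom ≫ pushProd f U V := by
  simp only [pushIso_hom_mk, α_hom_mk, wR_mk, pushProd, mk_comp_mk]
  refine mk_ext (by simp only [nf₁ C]) ?_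
  rw [pushComp_hom]
  simp only [interchanger_push, nf₂ C, nf₃ C, nf₄ C, nf₅ C, nf₁ C, nf₆ C]
  simp only [nf₇ C, nf₂ C, nf₅ C, nf₁ C]
  slice_rhs 5 6 => rw [whisk_inv_hom_of_eq (by simp only [nf₁ C]) (by simp only [nf₁ C])]
  simp only [nf₂ C, nf₅ C, nf₁ C]
  slice_rhs 2 3 => rw [whisk_exchange_symm ((M.hom x y ⊡ M.hom w₀ x) ⋉ V.val) (by simp only [nf₁ C]) (by simp only [nf₁ C])]
  simp only [nf₂ C, nf₅ C, nf₁ C]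
  slice_rhs 3 4 => rw [whisk_exchange_symm (𝟙 _) (by simp only [nf₁ C]) (by simp only [nf₁ C])]
  simp only [nf₂ C, nf₅ C, nf₁ C]
  slice_rhs 4 5 => rw [whisk_hom_inv_of_eq (by simp only [nf₁ C]) (by simp only [nf₁ C])]
  simp only [nf₂ C, nf₅ C, nf₁ C]
  slice_rhs 3 4 => rw [whisk_inv_hom_of_eq (by simp only [nf₁ C]) (by simp only [nf₁ C])]
  simp only [nf₂ C, nf₅ C, nf₁ C]
  slice_rhs 1 2 => rw [whisk_exchange_symm (𝟙 _) (by simp only [nf₁ C]) (by simp only [nf₁ C])]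
  simp only [nf₂ C, nf₅ C, nf₁ C]
  slice_rhs 2 3 => rw [whisk_inv_hom_of_eq (by simp only [nf₁ C]) (by simp only [nf₁ C])]
  simp only [nf₂ C, nf₅ C, nf₁ C]

/-- Shows that `(f^* U) V ≅ U (f_* V)` is the associator `(U f) V ≅ U (f V)` in disguise. The cell
of `pullIso` is an identity, so only one exchange of disjoint cells is required. -/
theorem wR_pullIso (f : M.Mor x y) (U : M.El y z) (V : M.El w₀ x) :
    wR (pullIso f U).hom V ≫ pullProd f U V =
      (α U (mor f) V).hom ≫ wL U (pushIso f V).hom := by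
  simp only [pushIso_hom_mk, pullIso_hom_mk, α_hom_mk, wR_mk, wL_mk, pullProd, mk_comp_mk]
  refine mk_ext (by simp only [nf₁ C]) ?_
  rw [pullPush_hom]
  simp only [interchanger_pull_inv, nf₂ C, nf₃ C, nf₄ C, nf₅ C, nf₁ C, nf₆ C]
  slice_rhs 2 3 => rw [whisk_exchange_symm (ascInv _ _ _) (by simp only [nf₁ C]) (by simp only [nf₁ C])]
  simp only [nf₂ C, nf₅ C, nf₁ C]
  refine eq_of_heq ?_
  repeat' refine whisk_comp_heq rfl rfl ?_
  exact whisk_heq _ _ _ _ _ rfl rfl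

theorem wL_pullIso (f : M.Mor x y) (U : M.El z w₀) (V : M.El y z) :
    (α U V (mor f)).hom ≫ wL U (pullIso f V).hom ≫ prodPull f U V =
      (pullIso f (U ⊙ V)).hom := by
  simp only [pullIso_hom_mk, α_hom_mk, wL_mk, prodPull, mk_comp_mk]
  refine mk_ext (by simp only [nf₁ C]) ?_
  rw [compPull_hom]
  simp only [nf₂ C, nf₃ C, nf₄ C, nf₅ C, nf₁ C, nf₆ C]
  slice_lhs 2 3 => rw [whisk_hom_inv_of_eq (by simp only [nf₁ C]) (by simp only [nf₁ C])]
  simp only [nf₂ C, nf₅ C, nf₁ C]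
  rw [whisk_inv_hom_of_eq (by simp only [nf₁ C]) (by simp only [nf₁ C])]

/-- Identifies `f_* j ≅ f` with the right unitor of `f`; the interchanger in `onePush` is exactly
the inverse of the one in `pushIso`. -/
theorem pushIso_one (f : M.Mor x y) :
    (pushIso f (one M x)).hom ≫ ofCell (M.onePush f).hom = (run (mor f)).hom := by
  simp only [pushIso_hom_mk, run_hom_mk, mk_comp_mk]
  refine mk_ext (by simp only [nf₁ C]) ?_
  rw [onePush_hom]
  simp only [nf₂ C, nf₃ C, nf₄ C, nf₅ C, nf₁ C, nf₆ C]
  slice_lhs 1 2 => rw [whisk_inv_hom_of_eq (by simp only [nf₁ C]) (by simp only [nf₁ C])]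
  simp only [nf₂ C, nf₅ C, nf₁ C]

theorem pullIso_one (f : M.Mor x y) :
    (pullIso f (one M y)).hom ≫ ofCell (M.onePull f).hom = (lun (mor f)).hom := by
  simp only [pullIso_hom_mk, lun_hom_mk, mk_comp_mk]
  refine mk_ext (by simp only [nf₁ C]) ?_
  rw [onePull_hom]
  simp only [nf₂ C, nf₃ C, nf₄ C, nf₅ C, nf₁ C, nf₆ C]
  refine eq_of_heq ?_
  repeat' refine whisk_comp_heq rfl rfl ?_
  exact whisk_heq _ _ _ _ _ rfl rfl

end El
end EnrichedTwoCategory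

/-! ### The 2-fiber product in terms of lax squares -/

namespace GrayMonoid

variable {C : Type u} [Bicategory.{w, v} C] [Bicategory.Strict C]

/-- The boundary 1-cells in the two equations are only provably equal; the whiskered generators are
the same, so one equation transfers to the other. -/
theorem whisk_comp_eq_whisk_comp {X Y X₁ Y₁ X₂ Y₂ X₃ Y₃ X₄ Y₄ : C}
    {a₁ b₁ : X₁ ⟶ Y₁} {σ₁ : a₁ ⟶ b₁} {a₂ b₂ : X₂ ⟶ Y₂} {σ₂ : a₂ ⟶ b₂}
    {a₃ b₃ : X₃ ⟶ Y₃} {σ₃ : a₃ ⟶ b₃} {a₄ b₄ : X₄ ⟶ Y₄} {σ₄ : a₄ ⟶ b₄}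
    {f₁ : X ⟶ X₁} {f₂ : X ⟶ X₂} {f₃ : X ⟶ X₃} {f₄ : X ⟶ X₄}
    {g₁ : Y₁ ⟶ Y} {g₂ : Y₂ ⟶ Y} {g₃ : Y₃ ⟶ Y} {g₄ : Y₄ ⟶ Y}
    {s r t t' s' r' k k' : X ⟶ Y} {h₁ : s = f₁ ≫ a₁ ≫ g₁} {h₂ : t = f₁ ≫ b₁ ≫ g₁}
    {h₃ : t = f₂ ≫ a₂ ≫ g₂} {h₄ : r = f₂ ≫ b₂ ≫ g₂} {h₅ : s = f₃ ≫ a₃ ≫ g₃}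
    {h₆ : t' = f₃ ≫ b₃ ≫ g₃} {h₇ : t' = f₄ ≫ a₄ ≫ g₄} {h₈ : r = f₄ ≫ b₄ ≫ g₄}
    {l₁ : s' = f₁ ≫ a₁ ≫ g₁} {l₂ : k = f₁ ≫ b₁ ≫ g₁}
    {l₃ : k = f₂ ≫ a₂ ≫ g₂} {l₄ : r' = f₂ ≫ b₂ ≫ g₂} {l₅ : s' = f₃ ≫ a₃ ≫ g₃}
    {l₆ : k' = f₃ ≫ b₃ ≫ g₃} {l₇ : k' = f₄ ≫ a₄ ≫ g₄} {l₈ : r' = f₄ ≫ b₄ ≫ g₄}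
    (h : whisk f₁ σ₁ g₁ h₁ h₂ ≫ whisk f₂ σ₂ g₂ h₃ h₄ =
      whisk f₃ σ₃ g₃ h₅ h₆ ≫ whisk f₄ σ₄ g₄ h₇ h₈) :
    whisk f₁ σ₁ g₁ l₁ l₂ ≫ whisk f₂ σ₂ g₂ l₃ l₄ =
      whisk f₃ σ₃ g₃ l₅ l₆ ≫ whisk f₄ σ₄ g₄ l₇ l₈ := by
  subst h₁ l₁ h₂ l₂ h₄ l₄ h₆ l₆
  exact h

end GrayMonoid

namespace EnrichedTwoCategory

variable {C : Type u} [Bicategory.{w, v} C] [Bicategory.Strict C] [GrayMonoid C] {Ob : Type t}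

namespace El

variable {M : EnrichedTwoCategory C Ob} {x y z w₀ s : Ob}

theorem mk_inj {U V : M.El x y} {k k' : U.dom ⟶ V.dom} {σ : U.val ⟶ k ≫ V.val}
    {σ' : U.val ⟶ k' ≫ V.val} (h : mkHom k σ = mkHom k' σ') :
    whisk (𝟙 _) σ (𝟙 _) (s := U.val) (t := k ≫ V.val) (by simp) (by simp) =
      whisk (𝟙 _) σ' (𝟙 _) (by simp)
        (by rw [show k = k' from congrArg Hom.deg h]; simp) := by
  obtain ⟨rfl, h'⟩ := Hom.mk.inj h
  obtain rfl := eq_of_heq h'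
  rfl

/-- Both generalised 1-cells have the same domain `D`, so a central degree is an equality `D = D`,
hence the identity. -/
theorem IsCentral.exists_ofCell {D : C} {a b : D ⟶ M.hom x y}
    {F : (⟨D, a⟩ : M.El x y) ⟶ ⟨D, b⟩} (hF : IsCentral F) : ∃ σ : a ⟶ b, F = ofCell σ := by
  obtain ⟨k, σ⟩ := F
  obtain ⟨h, rfl : k = 𝟙 D⟩ := hF
  refine ⟨whisk (𝟙 D) σ (𝟙 _) (by simp only [nf₁ C]) (by simp only [nf₁ C]), mk_ext rfl ?_⟩
  simp only [nf₂ C, nf₅ C, nf₁ C]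

theorem wR_inv_hom {U V : M.El y z} (F : U ≅ V) (W : M.El x y) :
    wR F.inv W ≫ wR F.hom W = 𝟙 _ := by
  rw [← wR_comp, F.inv_hom_id, wR_id]

theorem wL_inv_hom (W : M.El y z) {U V : M.El x y} (F : U ≅ V) :
    wL W F.inv ≫ wL W F.hom = 𝟙 _ := by
  rw [← wL_comp, F.inv_hom_id, wL_id]

section Square

variable {f : M.Mor x y} {P : C} {p : P ⟶ M.hom x x} {q : P ⟶ M.hom y y}
  (ϖ : p ≫ M.push x f ≅ q ≫ M.pull f y)

/-- The compatibility condition of the 2-fiber product, written with associators in `C`, is the same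
as commutation of a square of cells over `[x, y]`. -/
theorem pushHom_comp_ofCell_iff {D : C} {c : D ⟶ M.hom x x} {d : D ⟶ M.hom y y} {a : D ⟶ P}
    {σ : c ⟶ a ≫ p} {τ : d ⟶ a ≫ q} {ξ : c ≫ M.push x f ⟶ d ≫ M.pull f y} :
    pushHom f (mkHom (U := ⟨D, c⟩) (V := ⟨P, p⟩) a σ) ≫ ofCell ϖ.hom =
      ofCell ξ ≫ pullHom f (mkHom (U := ⟨D, d⟩) (V := ⟨P, q⟩) a τ) ↔
    σ ▷ M.push x f ≫ (α_ a p _).hom ≫ a ◁ ϖ.hom ≫ (α_ a q _).inv = ξ ≫ τ ▷ M.pull f y := by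
  simp only [pushHom, pullHom, mk_comp_mk, Strict.associator_eqToIso, eqToIso.hom, eqToIso.inv]
  constructor
  · intro h
    have h := mk_inj h
    rw [eq_iff_whisk]
    simp only [nf₂ C, nf₅ C, nf₁ C] at h ⊢
    exact whisk_comp_eq_whisk_comp h
  · intro h
    refine mk_ext (by simp only [nf₁ C]) ?_
    rw [eq_iff_whisk] at h
    simp only [nf₂ C, nf₅ C, nf₁ C] at h ⊢
    exact whisk_comp_eq_whisk_comp h

/-- Splits the defining composite of `ξ_m` into its five moves, two of which are applications of
`ϖ`, so that each can be compared with a piece of the pasting of squares. -/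
theorem ofCell_mulSquare : ofCell (M.mulSquare f ϖ).hom =
    pushProd f ⟨P, p⟩ ⟨P, p⟩ ≫ wR (ofCell ϖ.hom) ⟨P, p⟩ ≫ pullProd f ⟨P, q⟩ ⟨P, p⟩ ≫
      wL ⟨P, q⟩ (ofCell ϖ.hom) ≫ prodPull f ⟨P, q⟩ ⟨P, q⟩ := by
  simp only [pushProd, pullProd, prodPull, wR_mk, wL_mk, mk_comp_mk]
  refine mk_ext (by simp only [nf₁ C]) ?_
  simp only [mulSquare, Iso.trans_hom, eqToIso.hom, whiskerLeftIso_hom, whiskerRightIso_hom,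
    wrIso_hom, wlIso_hom, Iso.symm_hom]
  simp only [nf₂ C, nf₃ C, nf₄ C, nf₅ C, nf₁ C, nf₆ C]
  refine eq_of_heq ?_
  repeat' refine whisk_comp_heq rfl rfl ?_
  exact whisk_heq _ _ _ _ _ rfl rfl

end Square
end El

namespace Central

open El

variable {M : EnrichedTwoCategory C Ob} {x y : Ob} {f : M.Mor x y} {P : C} {p : P ⟶ M.hom x x}
  {q : P ⟶ M.hom y y}

variable (M) in
abbrev of {x y : Ob} (U : M.El x y) : (⟨y⟩ : M.Central) ⟶ ⟨x⟩ := ⟨U⟩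

/-- The square `ϖ` as a lax square. -/
def square (ϖ : p ≫ M.push x f ≅ q ≫ M.pull f y) :
    of M (mor f) ≫ of M ⟨P, p⟩ ⟶ of M ⟨P, q⟩ ≫ of M (mor f) :=
  ⟨(pushIso f ⟨P, p⟩).hom ≫ ofCell ϖ.hom ≫ (pullIso f ⟨P, q⟩).inv,
    (isCentral_pushIso _ _).comp ((isCentral_ofCell _).comp (isCentral_pullIso _ _).inv)⟩

theorem pasteMul_hom {F : M.El x y} {U : M.El x x} {V : M.El y y}
    (ω : of M F ≫ of M U ⟶ of M V ≫ of M F) : (pasteMul ω).hom =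
      (α F U U).inv ≫ wR ω.hom U ≫ (α V F U).hom ≫ wL V ω.hom ≫ (α V V F).inv := rfl

theorem pasteOne_hom (F : M.El x y) : (pasteOne (of M F)).hom = (run F).hom ≫ (lun F).inv := rfl

/-- The key identification: `ξ_m` is the lax square of `ϖ` pasted with itself. The three ways of
moving `f` (into the first factor, across, and out of the second) are the three associators of the
pasting, conjugated by `f_* ≅ f ⊙ -` and `f^* ≅ - ⊙ f`. -/
theorem pasteMul_square (ϖ : p ≫ M.push x f ≅ q ≫ M.pull f y) :
    (pasteMul (square ϖ)).hom = (pushIso f (⟨P, p⟩ ⊙ ⟨P, p⟩)).hom ≫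
      ofCell (M.mulSquare f ϖ).hom ≫ (pullIso f (⟨P, q⟩ ⊙ ⟨P, q⟩)).inv := by
  rw [pasteMul_hom, ofCell_mulSquare]
  have h₁ := wR_pushIso f ⟨P, p⟩ ⟨P, p⟩
  have h₂ := wR_pullIso f ⟨P, q⟩ ⟨P, p⟩
  have h₃ := wL_pullIso f ⟨P, q⟩ ⟨P, q⟩
  rw [Iso.inv_comp_eq]
  have h₂' : wR (pullIso f ⟨P, q⟩).inv ⟨P, p⟩ ≫ (α ⟨P, q⟩ (mor f) ⟨P, p⟩).hom ≫
      wL ⟨P, q⟩ (pushIso f ⟨P, p⟩).hom = pullProd f ⟨P, q⟩ ⟨P, p⟩ := by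
    rw [← h₂, ← Category.assoc, wR_inv_hom, Category.id_comp]
  have h₃' : prodPull f ⟨P, q⟩ ⟨P, q⟩ = wL ⟨P, q⟩ (pullIso f ⟨P, q⟩).inv ≫
      (α ⟨P, q⟩ ⟨P, q⟩ (mor f)).inv ≫ (pullIso f (⟨P, q⟩ ⊙ ⟨P, q⟩)).hom := by
    rw [← h₃, Iso.inv_hom_id_assoc, ← Category.assoc, wL_inv_hom, Category.id_comp]
  simp only [square, wR_comp, wL_comp, h₁, ← h₂', h₃', Category.assoc, Iso.hom_inv_id,
    Category.comp_id]

/-- The counterpart for the unit: `f_* j ≅ f ≅ f^* j` becomes the composite of the right unitor of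
`f` with the inverse of the left unitor. -/
theorem pasteOne_square : (pasteOne (of M (mor f))).hom = (pushIso f (El.one M x)).hom ≫
      ofCell (M.oneSquare f).hom ≫ (pullIso f (El.one M y)).inv := by
  have h : ofCell (M.oneSquare f).hom = ofCell (M.onePush f).hom ≫ ofCell (M.onePull f).inv := by
    rw [mk_comp_mk]
    refine mk_ext (by simp only [nf₁ C]) ?_
    simp only [oneSquare, Iso.trans_hom, Iso.symm_hom, nf₂ C, nf₅ C, nf₁ C]
    exact eq_of_heq (whisk_comp_heq rfl rfl (whisk_heq _ _ _ _ _ rfl rfl))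
  have h' : ofCell (M.onePull f).inv ≫ ofCell (M.onePull f).hom = 𝟙 (mor f) := by
    rw [mk_comp_mk, id_mk]
    refine mk_ext (by simp only [nf₁ C]) ?_
    simp only [nf₂ C, nf₅ C, nf₁ C, whisk_inv_hom]
  rw [pasteOne_hom, h, Category.assoc, ← pushIso_one, Category.assoc, Iso.cancel_iso_hom_left,
    ← cancel_mono (lun (mor f)).hom]
  simp only [Category.assoc, Iso.inv_hom_id, Category.comp_id]
  rw [← pullIso_one, Iso.inv_hom_id_assoc, h', Category.comp_id]

/-- `Fy` is compatible with `Fx` along the lax squares `Ω` and `ω`. -/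
def Over {F : M.El x y} {U U' : M.El x x} {V V' : M.El y y} (Ω : of M F ≫ of M U ⟶ of M V ≫ of M F)
    (ω : of M F ≫ of M U' ⟶ of M V' ≫ of M F) (Fx : U ⟶ U') (Fy : V ⟶ V') : Prop :=
  wL F Fx ≫ ω.hom = Ω.hom ≫ wR Fy F

theorem over_square {D : C} {c : D ⟶ M.hom x x} {d : D ⟶ M.hom y y}
    (ξ : c ≫ M.push x f ≅ d ≫ M.pull f y) (ϖ : p ≫ M.push x f ≅ q ≫ M.pull f y) {a : D ⟶ P}
    {σ : c ⟶ a ≫ p} {τ : d ⟶ a ≫ q}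
    (h : σ ▷ M.push x f ≫ (α_ a p _).hom ≫ a ◁ ϖ.hom ≫ (α_ a q _).inv =
      ξ.hom ≫ τ ▷ M.pull f y) :
    Over (square ξ) (square ϖ) (mkHom (U := ⟨D, c⟩) (V := ⟨P, p⟩) a σ)
      (mkHom (U := ⟨D, d⟩) (V := ⟨P, q⟩) a τ) := by
  rw [← pushHom_comp_ofCell_iff] at h
  rw [Over, square, square]
  change wL (mor f) _ ≫ (pushIso f ⟨P, p⟩).hom ≫ ofCell ϖ.hom ≫ (pullIso f ⟨P, q⟩).inv =
    ((pushIso f ⟨D, c⟩).hom ≫ ofCell ξ.hom ≫ (pullIso f ⟨D, d⟩).inv) ≫ _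
  rw [← Category.assoc, pushIso_naturality, Category.assoc, ← Category.assoc (pushHom _ _), h,
    Category.assoc, Category.assoc, Category.assoc, Iso.cancel_iso_hom_left]
  congr 1
  rw [Iso.eq_inv_comp, ← Category.assoc, ← pullIso_naturality, Category.assoc, Iso.hom_inv_id,
    Category.comp_id]

/-- Conjugating `Ω` by `f ⊙ - ≅ f_*` and `- ⊙ f ≅ f^*` gives a central cell, hence a 2-cell `ξ`. It
depends on `Ω` only, so two pairs over the same `Ω` satisfy their equations with the same `ξ` and
can be compared. -/
theorem Over.exists_cell {D : C} {c : D ⟶ M.hom x x} {d : D ⟶ M.hom y y}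
    {ϖ : p ≫ M.push x f ≅ q ≫ M.pull f y}
    (Ω : of M (mor f) ≫ of M ⟨D, c⟩ ⟶ of M ⟨D, d⟩ ≫ of M (mor f)) :
    ∃ ξ : c ≫ M.push x f ⟶ d ≫ M.pull f y, ∀ {a : D ⟶ P} {σ : c ⟶ a ≫ p} {τ : d ⟶ a ≫ q},
      Over Ω (square ϖ) (mkHom (U := ⟨D, c⟩) (V := ⟨P, p⟩) a σ)
        (mkHom (U := ⟨D, d⟩) (V := ⟨P, q⟩) a τ) →
      σ ▷ M.push x f ≫ (α_ a p _).hom ≫ a ◁ ϖ.hom ≫ (α_ a q _).inv = ξ ≫ τ ▷ M.pull f y := by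
  obtain ⟨ξ, hξ⟩ := IsCentral.exists_ofCell (((isCentral_pushIso f ⟨D, c⟩).inv).comp
    (Ω.isCentral.comp (isCentral_pullIso f ⟨D, d⟩)))
  refine ⟨ξ, fun {a σ τ} h ↦ ?_⟩
  rw [← pushHom_comp_ofCell_iff, ← hξ]
  change wL (mor f) _ ≫ (pushIso f ⟨P, p⟩).hom ≫ ofCell ϖ.hom ≫ (pullIso f ⟨P, q⟩).inv = _ at h
  rw [← Category.assoc, pushIso_naturality, Category.assoc, ← Iso.eq_inv_comp,
    ← Category.assoc (pushHom _ _), Iso.comp_inv_eq] at h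
  rw [h, Category.assoc, Category.assoc, Category.assoc, Category.assoc, pullIso_naturality]

/-- The universal property of a 2-fiber product, in terms of cells over `ϖ`. -/
theorem existsUnique_is3 {ϖ : p ≫ M.push x f ≅ q ≫ M.pull f y} (hϖ : IsTwoFiberProduct ϖ) {D : C}
    {c : D ⟶ M.hom x x} {d : D ⟶ M.hom y y}
    (Ω : of M (mor f) ≫ of M ⟨D, c⟩ ⟶ of M ⟨D, d⟩ ≫ of M (mor f)) {a b : D ⟶ P}
    {σ : c ⟶ a ≫ p} {τ : d ⟶ a ≫ q} {σ' : c ⟶ b ≫ p} {τ' : d ⟶ b ≫ q} [IsIso σ] [IsIso τ]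
    (h : Over Ω (square ϖ) (mkHom (U := ⟨D, c⟩) (V := ⟨P, p⟩) a σ)
      (mkHom (U := ⟨D, d⟩) (V := ⟨P, q⟩) a τ))
    (h' : Over Ω (square ϖ) (mkHom (U := ⟨D, c⟩) (V := ⟨P, p⟩) b σ')
      (mkHom (U := ⟨D, d⟩) (V := ⟨P, q⟩) b τ')) :
    ∃! θ : a ⟶ b, σ ≫ θ ▷ p = σ' ∧ τ ≫ θ ▷ q = τ' := by
  obtain ⟨ξ, hξ⟩ := Over.exists_cell (ϖ := ϖ) Ω
  have e := hξ h
  have e' := hξ h'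
  -- The 2-cells to be lifted are `σ⁻¹ σ'` and `τ⁻¹ τ'`; they are compatible with `ϖ` because `e`
  -- and `e'` share the same `ξ`.
  obtain ⟨θ, ⟨h₁, h₂⟩, hθ⟩ := hϖ.existsUnique_hom a b (inv σ ≫ σ') (inv τ ≫ τ') (by
    rw [← cancel_epi (σ ▷ M.push x f), ← Category.assoc, ← comp_whiskerRight,
      IsIso.hom_inv_id_assoc, e']
    simp only [← Category.assoc] at e ⊢
    rw [e, Category.assoc ξ, ← comp_whiskerRight, IsIso.hom_inv_id_assoc])
  refine ⟨θ, ⟨by rw [h₁, IsIso.hom_inv_id_assoc], by rw [h₂, IsIso.hom_inv_id_assoc]⟩, ?_⟩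
  rintro θ' ⟨rfl, rfl⟩
  exact hθ θ' ⟨by rw [IsIso.inv_hom_id_assoc], by rw [IsIso.inv_hom_id_assoc]⟩

end Central

/-! ### Products of compatible cells lie over pasted squares -/

namespace El

variable {M : EnrichedTwoCategory C Ob} {x y : Ob} {F : M.El x y} {U W : M.El x x}
  {V W' : M.El y y}

/-- The square `ω` is crossed once using `h` and once using `hM`; between these, `Hy` is exchanged
with `ω`. The cells `Hx`, `Hy` need not be central, so this exchange rests on `hω`. -/
theorem paste_wR {ω : F ⊙ U ⟶ V ⊙ F} (hω : IsCentral ω) {Θ : F ⊙ W ⟶ W' ⊙ F} {Hx : W ⟶ U}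
    {Hy : W' ⟶ V} {Mx : U ⊙ U ⟶ U} {My : V ⊙ V ⟶ V} (h : wL F Hx ≫ ω = Θ ≫ wR Hy F)
    (hM : wL F Mx ≫ ω = ((α F U U).inv ≫ wR ω U ≫ (α V F U).hom ≫ wL V ω ≫ (α V V F).inv) ≫
      wR My F) :
    wL F (wR Hx U ≫ Mx) ≫ ω = ((α F W U).inv ≫ wR Θ U ≫ (α W' F U).hom ≫ wL W' ω ≫
      (α W' V F).inv) ≫ wR (wR Hy V ≫ My) F := by
  have e₁ : wL F (wR Hx U) ≫ (α F U U).inv = (α F W U).inv ≫ wR (wL F Hx) U := by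
    rw [Iso.comp_inv_eq, Category.assoc, wL_wR_α, Iso.inv_hom_id_assoc]
  have e₂ : wR (wL F Hx) U ≫ wR ω U = wR Θ U ≫ wR (wR Hy F) U := by
    rw [← wR_comp, h, wR_comp]
  have e₃ := wR_α Hy F U
  have e₄ := exchange_of_isCentral_right Hy hω
  have e₅ : wR Hy (V ⊙ F) ≫ (α V V F).inv = (α W' V F).inv ≫ wR (wR Hy V) F := by
    rw [Iso.comp_inv_eq, Category.assoc, wR_α, Iso.inv_hom_id_assoc]
  rw [wL_comp, Category.assoc, hM]
  simp only [Category.assoc, wR_comp]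
  rw [reassoc_of% e₁, reassoc_of% e₂, reassoc_of% e₃, ← reassoc_of% e₄, reassoc_of% e₅]

/-- As for `paste_wR`, except that the exchange is now between `Hx` and `ω`, before `h` is applied
in the second factor. -/
theorem paste_wL {ω : F ⊙ U ⟶ V ⊙ F} (hω : IsCentral ω) {Θ : F ⊙ W ⟶ W' ⊙ F} {Hx : W ⟶ U}
    {Hy : W' ⟶ V} {Mx : U ⊙ U ⟶ U} {My : V ⊙ V ⟶ V} (h : wL F Hx ≫ ω = Θ ≫ wR Hy F)
    (hM : wL F Mx ≫ ω = ((α F U U).inv ≫ wR ω U ≫ (α V F U).hom ≫ wL V ω ≫ (α V V F).inv) ≫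
      wR My F) :
    wL F (wL U Hx ≫ Mx) ≫ ω = ((α F U W).inv ≫ wR ω W ≫ (α V F W).hom ≫ wL V Θ ≫
      (α V W' F).inv) ≫ wR (wL V Hy ≫ My) F := by
  have e₁ : wL F (wL U Hx) ≫ (α F U U).inv = (α F U W).inv ≫ wL (F ⊙ U) Hx := by
    rw [Iso.comp_inv_eq, Category.assoc, wL_α, Iso.inv_hom_id_assoc]
  have e₂ := exchange_of_isCentral_left hω Hx
  have e₃ := wL_α V F Hx
  have e₄ : wL V (wL F Hx) ≫ wL V ω = wL V Θ ≫ wL V (wR Hy F) := by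
    rw [← wL_comp, h, wL_comp]
  have e₅ : wL V (wR Hy F) ≫ (α V V F).inv = (α V W' F).inv ≫ wR (wL V Hy) F := by
    rw [Iso.comp_inv_eq, Category.assoc, wL_wR_α, Iso.inv_hom_id_assoc]
  rw [wL_comp, Category.assoc, hM]
  simp only [Category.assoc, wR_comp]
  rw [reassoc_of% e₁, reassoc_of% e₂, reassoc_of% e₃, reassoc_of% e₄, reassoc_of% e₅]

end El

namespace Central

open El

variable {M : EnrichedTwoCategory C Ob} {x y : Ob}

section

variable {F : M.El x y} {U : M.El x x} {V : M.El y y} {ω : of M F ≫ of M U ⟶ of M V ≫ of M F}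

theorem Over.precomp {W W₀ : M.El x x} {W' W₀' : M.El y y}
    {Θ : of M F ≫ of M W ⟶ of M W' ≫ of M F} {Θ₀ : of M F ≫ of M W₀ ⟶ of M W₀' ≫ of M F}
    {Hx : W ⟶ U} {Hy : W' ⟶ V} (h : Over Θ ω Hx Hy) {Ax : W₀ ⟶ W} {Ay : W₀' ⟶ W'}
    (hA : wL F Ax ≫ Θ.hom = Θ₀.hom ≫ wR Ay F) : Over Θ₀ ω (Ax ≫ Hx) (Ay ≫ Hy) := by
  have h : wL F Hx ≫ ω.hom = Θ.hom ≫ wR Hy F := h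
  change wL F (Ax ≫ Hx) ≫ ω.hom = Θ₀.hom ≫ wR (Ay ≫ Hy) F
  rw [wL_comp, Category.assoc, h, ← Category.assoc, hA, Category.assoc, wR_comp]

variable {Mx : U ⊙ U ⟶ U} {My : V ⊙ V ⟶ V}

theorem Over.assoc_left (h : Over (pasteMul ω) ω Mx My) :
    Over (U := (U ⊙ U) ⊙ U) (V := (V ⊙ V) ⊙ V)
      ((α_ (of M F) (of M U ≫ of M U) (of M U)).inv ≫ pasteMul ω ▷ of M U ≫
        (α_ (of M V ≫ of M V) (of M F) (of M U)).hom ≫ (of M V ≫ of M V) ◁ ω ≫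
        (α_ (of M V ≫ of M V) (of M V) (of M F)).inv) ω (wR Mx U ≫ Mx) (wR My V ≫ My) :=
  paste_wR ω.isCentral h h

/-- The point is that the outer square is literally the one of `Over.assoc_left`. The product over
`U ⊙ (U ⊙ U)` first lies over the other bracketing, and precomposing with the associators changes
the bracketing by `pasteMul_assoc`. -/
theorem Over.assoc_right (h : Over (pasteMul ω) ω Mx My) :
    Over (U := (U ⊙ U) ⊙ U) (V := (V ⊙ V) ⊙ V)
      ((α_ (of M F) (of M U ≫ of M U) (of M U)).inv ≫ pasteMul ω ▷ of M U ≫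
        (α_ (of M V ≫ of M V) (of M F) (of M U)).hom ≫ (of M V ≫ of M V) ◁ ω ≫
        (α_ (of M V ≫ of M V) (of M V) (of M F)).inv) ω
      ((α U U U).hom ≫ wL U Mx ≫ Mx) ((α V V V).hom ≫ wL V My ≫ My) := by
  refine Over.precomp (W := U ⊙ (U ⊙ U)) (W' := V ⊙ (V ⊙ V))
    (Θ := (α_ (of M F) (of M U) (of M U ≫ of M U)).inv ≫ ω ▷ (of M U ≫ of M U) ≫
      (α_ (of M V) (of M F) (of M U ≫ of M U)).hom ≫ of M V ◁ pasteMul ω ≫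
        (α_ (of M V) (of M V ≫ of M V) (of M F)).inv) (paste_wL ω.isCentral h h) ?_
  exact congrArg Hom₂.hom (pasteMul_assoc ω)

variable {Hx : El.one M x ⟶ U} {Hy : El.one M y ⟶ V}

theorem Over.unit_left (h : Over (pasteMul ω) ω Mx My) (h₁ : Over (pasteOne (of M F)) ω Hx Hy) :
    Over (U := El.one M x ⊙ U) (V := El.one M y ⊙ V)
      ((α_ (of M F) (𝟙 _) (of M U)).inv ≫ pasteOne (of M F) ▷ of M U ≫
        (α_ (𝟙 _) (of M F) (of M U)).hom ≫ 𝟙 _ ◁ ω ≫ (α_ (𝟙 _) (of M V) (of M F)).inv) ω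
      (wR Hx U ≫ Mx) (wR Hy V ≫ My) :=
  paste_wR ω.isCentral h₁ h

/-- The unitors lie over the same square as the multiplications by the unit in `Over.unit_left`, so
the universal property can compare the two. -/
theorem Over.unit_left' :
    Over (U := El.one M x ⊙ U) (V := El.one M y ⊙ V)
      ((α_ (of M F) (𝟙 _) (of M U)).inv ≫ pasteOne (of M F) ▷ of M U ≫
        (α_ (𝟙 _) (of M F) (of M U)).hom ≫ 𝟙 _ ◁ ω ≫ (α_ (𝟙 _) (of M V) (of M F)).inv) ω
      (lun U).hom (lun V).hom :=
  congrArg Hom₂.hom (pasteOne_left ω)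

theorem Over.unit_right (h : Over (pasteMul ω) ω Mx My) (h₁ : Over (pasteOne (of M F)) ω Hx Hy) :
    Over (U := U ⊙ El.one M x) (V := V ⊙ El.one M y)
      ((α_ (of M F) (of M U) (𝟙 _)).inv ≫ ω ▷ 𝟙 _ ≫ (α_ (of M V) (of M F) (𝟙 _)).hom ≫
        of M V ◁ pasteOne (of M F) ≫ (α_ (of M V) (𝟙 _) (of M F)).inv) ω
      (wL U Hx ≫ Mx) (wL V Hy ≫ My) :=
  paste_wL ω.isCentral h₁ h

theorem Over.unit_right' :
    Over (U := U ⊙ El.one M x) (V := V ⊙ El.one M y)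
      ((α_ (of M F) (of M U) (𝟙 _)).inv ≫ ω ▷ 𝟙 _ ≫ (α_ (of M V) (of M F) (𝟙 _)).hom ≫
        of M V ◁ pasteOne (of M F) ≫ (α_ (of M V) (𝟙 _) (of M F)).inv) ω
      (run U).hom (run V).hom :=
  congrArg Hom₂.hom (pasteOne_right ω)

end

section Lift

variable {f : M.Mor x y} {P : C} {p : P ⟶ M.hom x x} {q : P ⟶ M.hom y y}
  {ϖ : p ≫ M.push x f ≅ q ≫ M.pull f y}

theorem over_of_squareLift {D : C} {c : D ⟶ M.hom x x} {d : D ⟶ M.hom y y}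
    {ξ : c ≫ M.push x f ≅ d ≫ M.pull f y} (L : SquareLift ϖ ξ) :
    Over (square ξ) (square ϖ) (mkHom (U := ⟨D, c⟩) (V := ⟨P, p⟩) L.u L.ζ₁.inv)
      (mkHom (U := ⟨D, d⟩) (V := ⟨P, q⟩) L.u L.ζ₂.inv) := by
  refine over_square ξ ϖ ?_
  have h := L.comm
  -- A lift is oriented `u ≫ p ≅ c`, whereas a cell of degree `u` is a 2-cell `c ⟶ u ≫ p`, so the
  -- inverse comparisons occur; multiplying by the comparisons themselves recovers `L.comm`.
  rw [← cancel_epi (L.ζ₁.hom ▷ M.push x f), ← cancel_mono (L.ζ₂.hom ▷ M.pull f y)]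
  have e₁ : L.ζ₁.hom ▷ M.push x f ≫ L.ζ₁.inv ▷ M.push x f = 𝟙 _ := by
    rw [← comp_whiskerRight, Iso.hom_inv_id, id_whiskerRight]
  have e₂ : L.ζ₂.inv ▷ M.pull f y ≫ L.ζ₂.hom ▷ M.pull f y = 𝟙 _ := by
    rw [← comp_whiskerRight, Iso.inv_hom_id, id_whiskerRight]
  simp only [Category.assoc, e₂, Category.comp_id, reassoc_of% e₁, h]

theorem over_mul (μ : SquareLift ϖ (M.mulSquare f ϖ)) :
    Over (U := ⟨P, p⟩ ⊙ ⟨P, p⟩) (V := ⟨P, q⟩ ⊙ ⟨P, q⟩) (pasteMul (square ϖ)) (square ϖ)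
      (mkHom (V := ⟨P, p⟩) μ.u μ.ζ₁.inv) (mkHom (V := ⟨P, q⟩) μ.u μ.ζ₂.inv) := by
  change _ = (pasteMul (square ϖ)).hom ≫ _
  rw [pasteMul_square]
  exact over_of_squareLift μ

theorem over_one (ι : SquareLift ϖ (M.oneSquare f)) :
    Over (U := El.one M x) (V := El.one M y) (pasteOne (of M (mor f))) (square ϖ)
      (mkHom (V := ⟨P, p⟩) ι.u ι.ζ₁.inv) (mkHom (V := ⟨P, q⟩) ι.u ι.ζ₂.inv) := by
  change _ = (pasteOne (of M (mor f))).hom ≫ _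
  rw [pasteOne_square]
  exact over_of_squareLift ι

end Lift

end Central

end EnrichedTwoCategory

/-! ### Algebra 1-morphisms as 3-cells -/

namespace GrayMonoid

variable {C : Type u} [Bicategory.{w, v} C] [Bicategory.Strict C]

theorem eq_iff_eq_of_heq {X Y : C} {s t s' t' : X ⟶ Y} {σ τ : s ⟶ t} {σ' τ' : s' ⟶ t'} (hs : s = s')
    (ht : t = t') (hσ : HEq σ σ') (hτ : HEq τ τ') : σ = τ ↔ σ' = τ' := by
  subst hs ht hσ hτ
  rfl

theorem whisk_hom_comp_eq_iff {X X' Y' Y : C} {f : X ⟶ X'} {a b : X' ⟶ Y'} {σ : a ≅ b} {g : Y' ⟶ Y}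
    {s t r : X ⟶ Y} {hs : s = f ≫ a ≫ g} {ht : t = f ≫ b ≫ g} {τ : t ⟶ r} {ρ : s ⟶ r} :
    whisk f σ.hom g hs ht ≫ τ = ρ ↔ τ = whisk f σ.inv g ht hs ≫ ρ := by
  subst hs ht
  constructor
  · rintro rfl
    simp [whisk]
  · rintro rfl
    simp [whisk]

end GrayMonoid

namespace EnrichedTwoCategory

variable {C : Type u} [Bicategory.{w, v} C] [Bicategory.Strict C] [GrayMonoid C] {Ob : Type t}

namespace El

variable {M : EnrichedTwoCategory C Ob} {x y : Ob}

section AlgebraHom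

variable {A : C} {m : A ⊡ A ⟶ A} {i : (unit : C) ⟶ A} {p : A ⟶ M.hom x x}
  (ψ : tensorHom p p ≫ M.comp x x x ≅ m ≫ p) (η : M.one x ≅ i ≫ p)

theorem is3_assoc_iff (θ : m ⋊ A ≫ m ⟶ asc A A A ≫ A ⋉ m ≫ m) :
    ((tensorHom p p ⋊ A ≫ (M.hom x x ⊡ M.hom x x) ⋉ p) ◁ (M.assoc x x x x).hom ≫
      eqToHom (by simp) ≫
      (asc A A A ≫ p ⋊ (A ⊡ A)) ◁ (M.hom x x ⋉₂ ψ.hom) ▷ M.comp x x x ≫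
      eqToHom (by simp) ≫
      asc A A A ◁ (interchanger p m).inv ▷ (M.hom x x ⋉ p ≫ M.comp x x x) ≫
      eqToHom (by simp) ≫
      (asc A A A ≫ A ⋉ m) ◁ ψ.hom =
    eqToHom (by simp) ≫
      (tensorHom p p ⋊ A) ◁ (interchanger (M.comp x x x) p).hom ▷ M.comp x x x ≫
      eqToHom (by simp) ≫
      (ψ.hom ⋊₂ A) ▷ (M.hom x x ⋉ p ≫ M.comp x x x) ≫
      eqToHom (by simp) ≫
      (m ⋊ A) ◁ ψ.hom ≫
      eqToHom (by simp) ≫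
      θ ▷ p ≫
      eqToHom (show _ = (asc A A A ≫ A ⋉ m) ≫ m ≫ p by simp)) ↔
    Is3 (wR (mkHom (U := ⟨A, p⟩ ⊙ ⟨A, p⟩) (V := ⟨A, p⟩) m ψ.hom) ⟨A, p⟩ ≫
        mkHom (U := ⟨A, p⟩ ⊙ ⟨A, p⟩) (V := ⟨A, p⟩) m ψ.hom)
      ((α ⟨A, p⟩ ⟨A, p⟩ ⟨A, p⟩).hom ≫
        wL ⟨A, p⟩ (mkHom (U := ⟨A, p⟩ ⊙ ⟨A, p⟩) (V := ⟨A, p⟩) m ψ.hom) ≫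
        mkHom (U := ⟨A, p⟩ ⊙ ⟨A, p⟩) (V := ⟨A, p⟩) m ψ.hom) θ := by
  -- Unfolds `Is3` and the composites of cells, choosing boundary 1-cells from which normalisation
  -- can start.
  change _ ↔ (whisk (s := tensorHom (tensorHom p p ≫ M.comp x x x) p ≫ M.comp x x x)
        (t := m ⋊ A ≫ tensorHom p p ≫ M.comp x x x) (𝟙 _) (ψ.hom ⋊₂ A)
        (M.hom x x ⋉ p ≫ M.comp x x x) (by simp only [nf₁ C]) (by simp only [nf₁ C]) ≫
      whisk (t := (m ⋊ A ≫ m) ≫ p) (m ⋊ A) ψ.hom (𝟙 _) (by simp only [nf₁ C]) (by simp only [nf₁ C])) ≫ θ ▷ p =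
      (whisk (s := tensorHom (tensorHom p p ≫ M.comp x x x) p ≫ M.comp x x x)
        (tensorHom p p ⋊ A) (interchanger (M.comp x x x) p).inv (M.comp x x x) (by simp only [nf₁ C]) rfl ≫
      whisk (t := asc A A A ≫ tensorHom p (tensorHom p p ≫ M.comp x x x) ≫ M.comp x x x)
        (tensorHom p p ⋊ A ≫ (M.hom x x ⊡ M.hom x x) ⋉ p)
        (M.assoc x x x x).hom (𝟙 _) (by simp only [nf₁ C]) (by simp only [nf₁ C])) ≫
      whisk (t := (asc A A A ≫ A ⋉ m ≫ m) ≫ p) (asc A A A)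
        ((whisk (s := tensorHom p (tensorHom p p ≫ M.comp x x x) ≫ M.comp x x x)
            (p ⋊ (A ⊡ A)) (M.hom x x ⋉₂ ψ.hom) (M.comp x x x) (by simp only [nf₁ C]) rfl ≫
          whisk (t := A ⋉ m ≫ tensorHom p p ≫ M.comp x x x) (𝟙 _) (interchanger p m).inv
            (M.hom x x ⋉ p ≫ M.comp x x x) (by simp only [nf₁ C]) (by simp only [nf₁ C])) ≫
          whisk (t := (A ⋉ m ≫ m) ≫ p) (A ⋉ m) ψ.hom (𝟙 _) (by simp only [nf₁ C]) (by simp only [nf₁ C])) (𝟙 _) (by simp only [nf₁ C]) (by simp only [nf₁ C])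
  rw [eq_iff_whisk, eq_iff_whisk (_ ≫ θ ▷ p)]
  simp only [nf₂ C, nf₃ C, nf₄ C, nf₅ C, nf₁ C]
  -- The algebra axiom has the interchanger of the multiplication with `p` on one side, while `α`
  -- contains its inverse on the other; it is moved across.
  rw [eq_comm, whisk_hom_comp_eq_iff]
  refine eq_iff_eq_of_heq (by simp only [nf₁ C]) (by simp only [nf₁ C]) ?_ ?_
  all_goals
    repeat' first
      | refine whisk_heq _ _ _ _ _ ?_ ?_
      | refine comp_heq ?_ ?_ ?_ ?_ ?_
    all_goals first | with_reducible rfl | simp only [nf₁ C]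

theorem is3_left_iff (θ : i ⋊ A ≫ m ⟶ lu A) :
    ((η.hom ⋊₂ A) ▷ (M.hom x x ⋉ p ≫ M.comp x x x) ≫
      eqToHom (by simp) ≫
      (i ⋊ A) ◁ ψ.hom ≫
      eqToHom (by simp) ≫
      θ ▷ p =
    eqToHom (by simp) ≫
      (interchanger (M.one x) p).inv ▷ M.comp x x x ≫
      eqToHom (by simp) ≫
      ((unit : C) ⋉ p) ◁ (M.leftUnitor x x).hom ≫
      eqToHom (by simp)) ↔
    Is3 (wR (mkHom (U := one M x) (V := ⟨A, p⟩) i η.hom) ⟨A, p⟩ ≫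
        mkHom (U := ⟨A, p⟩ ⊙ ⟨A, p⟩) (V := ⟨A, p⟩) m ψ.hom) (lun ⟨A, p⟩).hom θ := by
  change _ ↔ (whisk (s := tensorHom (M.one x) p ≫ M.comp x x x)
        (t := i ⋊ A ≫ tensorHom p p ≫ M.comp x x x) (𝟙 _) (η.hom ⋊₂ A)
        (M.hom x x ⋉ p ≫ M.comp x x x) (by simp only [nf₁ C]) (by simp only [nf₁ C]) ≫
      whisk (t := (i ⋊ A ≫ m) ≫ p) (i ⋊ A) ψ.hom (𝟙 _) (by simp only [nf₁ C]) (by simp only [nf₁ C])) ≫ θ ▷ p =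
    whisk (s := tensorHom (M.one x) p ≫ M.comp x x x) (𝟙 _) (interchanger (M.one x) p).inv
      (M.comp x x x) (by simp only [nf₁ C]) rfl ≫
    whisk (t := lu A ≫ p) (unit ⋉ p) (M.leftUnitor x x).hom (𝟙 _) (by simp only [nf₁ C]) (by simp only [nf₁ C])
  rw [eq_iff_whisk, eq_iff_whisk (_ ≫ θ ▷ p)]
  simp only [nf₂ C, nf₃ C, nf₄ C, nf₅ C, nf₁ C]
  refine eq_iff_eq_of_heq (by simp only [nf₁ C]) (by simp only [nf₁ C]) ?_ ?_
  all_goals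
    repeat' first
      | refine whisk_heq _ _ _ _ _ ?_ ?_
      | refine comp_heq ?_ ?_ ?_ ?_ ?_
    all_goals first | with_reducible rfl | simp only [nf₁ C]

theorem is3_right_iff (θ : A ⋉ i ≫ m ⟶ ru A) :
    (p ⋊ (unit : C) ◁ (M.hom x x ⋉₂ η.hom) ▷ M.comp x x x ≫
      eqToHom (by simp) ≫
      (interchanger p i).inv ▷ (M.hom x x ⋉ p ≫ M.comp x x x) ≫
      eqToHom (by simp) ≫
      (A ⋉ i) ◁ ψ.hom ≫
      eqToHom (by simp) ≫
      θ ▷ p =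
    p ⋊ (unit : C) ◁ (M.rightUnitor x x).hom ≫
      eqToHom (by simp)) ↔
    Is3 (wL ⟨A, p⟩ (mkHom (U := one M x) (V := ⟨A, p⟩) i η.hom) ≫
        mkHom (U := ⟨A, p⟩ ⊙ ⟨A, p⟩) (V := ⟨A, p⟩) m ψ.hom) (run ⟨A, p⟩).hom θ := by
  change _ ↔ ((whisk (s := tensorHom p (M.one x) ≫ M.comp x x x)
        (p ⋊ unit) (M.hom x x ⋉₂ η.hom) (M.comp x x x) (by simp only [nf₁ C]) rfl ≫
      whisk (t := A ⋉ i ≫ tensorHom p p ≫ M.comp x x x) (𝟙 _) (interchanger p i).inv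
        (M.hom x x ⋉ p ≫ M.comp x x x) (by simp only [nf₁ C]) (by simp only [nf₁ C])) ≫
      whisk (t := (A ⋉ i ≫ m) ≫ p) (A ⋉ i) ψ.hom (𝟙 _) (by simp only [nf₁ C]) (by simp only [nf₁ C])) ≫ θ ▷ p =
    whisk (s := tensorHom p (M.one x) ≫ M.comp x x x) (t := ru A ≫ p) (p ⋊ unit)
      (M.rightUnitor x x).hom (𝟙 _) (by simp only [nf₁ C]) (by simp only [nf₁ C])
  rw [eq_iff_whisk, eq_iff_whisk (_ ≫ θ ▷ p)]
  simp only [nf₂ C, nf₃ C, nf₄ C, nf₅ C, nf₁ C]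
  refine eq_iff_eq_of_heq (by simp only [nf₁ C]) (by simp only [nf₁ C]) ?_ ?_
  all_goals
    repeat' first
      | refine whisk_heq _ _ _ _ _ ?_ ?_
      | refine comp_heq ?_ ?_ ?_ ?_ ?_
    all_goals first | with_reducible rfl | simp only [nf₁ C]

/-- Removes the explicit algebra 1-morphism axioms from the rest of the argument: for a target `A_x`
they are the three 3-cell conditions. -/
theorem isAlgebraHom_iff (S : AlgebraOn m i) :
    IsAlgebraHom ⟨A, m, i, S⟩ (M.endAlgebra x) p ψ η ↔
    Is3 (wR (mkHom (U := ⟨A, p⟩ ⊙ ⟨A, p⟩) (V := ⟨A, p⟩) m ψ.hom) ⟨A, p⟩ ≫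
        mkHom (U := ⟨A, p⟩ ⊙ ⟨A, p⟩) (V := ⟨A, p⟩) m ψ.hom)
      ((α ⟨A, p⟩ ⟨A, p⟩ ⟨A, p⟩).hom ≫
        wL ⟨A, p⟩ (mkHom (U := ⟨A, p⟩ ⊙ ⟨A, p⟩) (V := ⟨A, p⟩) m ψ.hom) ≫
        mkHom (U := ⟨A, p⟩ ⊙ ⟨A, p⟩) (V := ⟨A, p⟩) m ψ.hom) S.assoc.hom ∧
    Is3 (wR (mkHom (U := one M x) (V := ⟨A, p⟩) i η.hom) ⟨A, p⟩ ≫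
        mkHom (U := ⟨A, p⟩ ⊙ ⟨A, p⟩) (V := ⟨A, p⟩) m ψ.hom) (lun ⟨A, p⟩).hom S.leftUnitor.hom ∧
    Is3 (wL ⟨A, p⟩ (mkHom (U := one M x) (V := ⟨A, p⟩) i η.hom) ≫
        mkHom (U := ⟨A, p⟩ ⊙ ⟨A, p⟩) (V := ⟨A, p⟩) m ψ.hom) (run ⟨A, p⟩).hom
      S.rightUnitor.hom :=
  ⟨fun h ↦ ⟨(is3_assoc_iff ψ _).1 h.assoc, (is3_left_iff ψ η _).1 h.left_unit,
    (is3_right_iff ψ η _).1 h.right_unit⟩,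
   fun h ↦ ⟨(is3_assoc_iff ψ _).2 h.1, (is3_left_iff ψ η _).2 h.2.1,
    (is3_right_iff ψ η _).2 h.2.2⟩⟩

end AlgebraHom

end El

end EnrichedTwoCategory

/-! ### Coherence of the induced algebra and its uniqueness -/

namespace GrayMonoid

variable {C : Type u} [Bicategory.{w, v} C] [Bicategory.Strict C]

instance isIso_whisk {X X' Y' Y : C} (f : X ⟶ X') {a b : X' ⟶ Y'} (σ : a ⟶ b) [IsIso σ] (g : Y' ⟶ Y)
    {s t : X ⟶ Y} (hs : s = f ≫ a ≫ g) (ht : t = f ≫ b ≫ g) : IsIso (whisk f σ g hs ht) := by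
  unfold whisk
  infer_instance

variable [GrayMonoid C]

instance isIso_wr₂ {A A' : C} {f f' : A ⟶ A'} (σ : f ⟶ f') [IsIso σ] (B : C) : IsIso (σ ⋊₂ B) :=
  inferInstanceAs (IsIso (wrIso (asIso σ) B).hom)

instance isIso_wl₂ (A : C) {B B' : C} {g g' : B ⟶ B'} (σ : g ⟶ g') [IsIso σ] : IsIso (A ⋉₂ σ) :=
  inferInstanceAs (IsIso (wlIso A (asIso σ)).hom)

end GrayMonoid

/-- The projections are jointly faithful on 2-cells. The pair `θ ▷ p₁`, `θ ▷ p₂` is compatible with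
`φ` by naturality, and `θ`, `θ'` are both lifts of it. -/
theorem IsTwoFiberProduct.hom_ext {C : Type u} [Bicategory.{w, v} C] {X Y Z P D : C} {f : X ⟶ Z}
    {g : Y ⟶ Z} {p₁ : P ⟶ X} {p₂ : P ⟶ Y} {φ : p₁ ≫ f ≅ p₂ ≫ g} (hφ : IsTwoFiberProduct φ)
    {a b : D ⟶ P} {θ θ' : a ⟶ b} (h₁ : θ ▷ p₁ = θ' ▷ p₁) (h₂ : θ ▷ p₂ = θ' ▷ p₂) : θ = θ' := by
  refine (hφ.existsUnique_hom a b (θ ▷ p₁) (θ ▷ p₂) ?_).unique ⟨rfl, rfl⟩ ⟨h₁.symm, h₂.symm⟩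
  rw [associator_naturality_left_assoc, ← whisker_exchange_assoc,
    associator_inv_naturality_left]

namespace EnrichedTwoCategory

variable {C : Type u} [Bicategory.{w, v} C] [Bicategory.Strict C] [GrayMonoid C] {Ob : Type t}

namespace El

variable {M : EnrichedTwoCategory C Ob} {x y z w₀ : Ob}

section IsIso

theorem isIso_cell_comp {U V W : M.El x y} {F : U ⟶ V} {G : V ⟶ W} (hF : IsIso F.cell)
    (hG : IsIso G.cell) : IsIso (Hom.cell (F ≫ G)) :=
  IsIso.comp_isIso' hF (isIso_whisk F.deg G.cell (𝟙 _) (by simp) (by simp [comp_deg]))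

theorem isIso_cell_wR {U V : M.El y z} {F : U ⟶ V} (hF : IsIso F.cell) (W : M.El x y) :
    IsIso (wR F W).cell :=
  have := isIso_wr₂ F.cell W.dom
  isIso_whisk (𝟙 _) (F.cell ⋊₂ W.dom) (M.hom y z ⋉ W.val ≫ M.comp x y z) (by simp only [nf₁ C])
    (by simp only [wR_deg, nf₁ C])

theorem isIso_cell_wL (U : M.El y z) {V W : M.El x y} {F : V ⟶ W} (hF : IsIso F.cell) :
    IsIso (wL U F).cell :=
  have := isIso_wl₂ (M.hom y z) F.cell
  IsIso.comp_isIso' (isIso_whisk (U.val ⋊ V.dom) (M.hom y z ⋉₂ F.cell) (M.comp x y z)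
    (by simp only [nf₁ C]) rfl) (isIso_whisk (𝟙 _) (interchanger U.val F.deg).inv
      (M.hom y z ⋉ W.val ≫ M.comp x y z) (by simp only [nf₁ C]) (by simp only [wL_deg, nf₁ C]))

theorem isIso_cell_α (U : M.El z w₀) (V : M.El y z) (W : M.El x y) :
    IsIso (Hom.cell (α U V W).hom) :=
  Iso.isIso_hom _

theorem isIso_cell_lun (U : M.El x y) : IsIso (Hom.cell (lun U).hom) :=
  Iso.isIso_hom _

theorem isIso_cell_run (U : M.El x y) : IsIso (Hom.cell (run U).hom) :=
  Iso.isIso_hom _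

end IsIso

/-- A 3-cell satisfies `F.cell ≫ θ ▷ V.val = G.cell`; with `F.cell` invertible this determines `θ ▷
V.val`. -/
theorem Is3.whiskerRight_eq {U V : M.El x y} {F G : U ⟶ V} {θ θ' : F.deg ⟶ G.deg}
    (h : Is3 F G θ) (h' : Is3 F G θ') (hF : IsIso F.cell) : θ ▷ V.val = θ' ▷ V.val := by
  rw [← cancel_epi F.cell]
  exact Eq.trans h (Eq.symm h')

section Algebra

variable {P : M.El x x} {μ : P ⊙ P ⟶ P}
  {a : μ.deg ⋊ P.dom ≫ μ.deg ⟶ asc P.dom P.dom P.dom ≫ P.dom ⋉ μ.deg ≫ μ.deg}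

/-- Each side of the pentagon is a composite of 3-cells from the leftmost to the rightmost product
of four copies of `P`, so both agree after composing with `P.val`. The equations `e₁` to `e₇`
reconcile the endpoints of successive 3-cells, using naturality of `α` and `El.pentagon`; they
supply the identity 2-cells of the statement. -/
theorem pentagon_whiskerRight (hμ : IsIso μ.cell)
    (h : Is3 (wR μ P ≫ μ) ((α P P P).hom ≫ wL P μ ≫ μ) a) :
    (eqToHom (by simp) ≫
      ((a ⋊₂ P.dom) ▷ μ.deg : (μ.deg ⋊ P.dom ≫ μ.deg) ⋊ P.dom ≫ μ.deg ⟶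
        (asc P.dom P.dom P.dom ≫ P.dom ⋉ μ.deg ≫ μ.deg) ⋊ P.dom ≫ μ.deg) ≫
      eqToHom (by simp) ≫
      (asc P.dom P.dom P.dom ⋊ P.dom ≫ (P.dom ⋉ μ.deg) ⋊ P.dom) ◁ a ≫
      eqToHom (by simp) ≫
      (asc P.dom P.dom P.dom ⋊ P.dom ≫ asc P.dom (P.dom ⊡ P.dom) P.dom) ◁
        (P.dom ⋉₂ a) ▷ μ.deg ≫
      eqToHom (by simp)) ▷ P.val =
    ((μ.deg ⋊ P.dom ⋊ P.dom) ◁ a ≫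
      eqToHom (by simp) ≫
      asc (P.dom ⊡ P.dom) P.dom P.dom ◁ (interchanger μ.deg μ.deg).inv ▷ μ.deg ≫
      eqToHom (by simp) ≫
      (asc (P.dom ⊡ P.dom) P.dom P.dom ≫ (P.dom ⊡ P.dom) ⋉ μ.deg) ◁ a ≫
      eqToHom (show _ = asc (P.dom ⊡ P.dom) P.dom P.dom ≫ asc P.dom P.dom (P.dom ⊡ P.dom) ≫
        P.dom ⋉ (P.dom ⋉ μ.deg) ≫ P.dom ⋉ μ.deg ≫ μ.deg by simp)) ▷ P.val := by
  have e₁ : wR (wR μ P) P ≫ wR μ P ≫ μ = wR (wR μ P ≫ μ) P ≫ μ := by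
    rw [wR_comp, Category.assoc]
  have e₂ : wR ((α P P P).hom ≫ wL P μ ≫ μ) P ≫ μ =
      (wR (α P P P).hom P ≫ wR (wL P μ) P) ≫ wR μ P ≫ μ := by
    simp only [wR_comp, Category.assoc]
  have e₃ : (wR (α P P P).hom P ≫ wR (wL P μ) P) ≫ (α P P P).hom ≫ wL P μ ≫ μ =
      (wR (α P P P).hom P ≫ (α P (P ⊙ P) P).hom) ≫ wL P (wR μ P ≫ μ) ≫ μ := by
    simp only [wL_comp, Category.assoc, reassoc_of% wL_wR_α]
  have e₄ : (wR (α P P P).hom P ≫ (α P (P ⊙ P) P).hom) ≫ wL P ((α P P P).hom ≫ wL P μ ≫ μ) ≫ μ =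
      (α (P ⊙ P) P P).hom ≫ (α P P (P ⊙ P)).hom ≫ wL P (wL P μ) ≫ wL P μ ≫ μ := by
    simp only [wL_comp, Category.assoc]
    rw [← reassoc_of% pentagon]
  have e₅ : wR (wR μ P) P ≫ (α P P P).hom ≫ wL P μ ≫ μ =
      (α (P ⊙ P) P P).hom ≫ (wR μ (P ⊙ P) ≫ wL P μ) ≫ μ := by
    simp only [Category.assoc, reassoc_of% wR_α]
  have e₆ : (α (P ⊙ P) P P).hom ≫ (wL (P ⊙ P) μ ≫ wR μ P) ≫ μ =
      ((α (P ⊙ P) P P).hom ≫ wL (P ⊙ P) μ) ≫ wR μ P ≫ μ := by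
    simp only [Category.assoc]
  have e₇ : ((α (P ⊙ P) P P).hom ≫ wL (P ⊙ P) μ) ≫ (α P P P).hom ≫ wL P μ ≫ μ =
      (α (P ⊙ P) P P).hom ≫ (α P P (P ⊙ P)).hom ≫ wL P (wL P μ) ≫ wL P μ ≫ μ := by
    simp only [Category.assoc, reassoc_of% wL_α]
  have L := (Is3.of_eq e₁).trans (((h.wR P).whiskerRight μ).trans ((Is3.of_eq e₂).trans
    ((h.whiskerLeft _).trans ((Is3.of_eq e₃).trans
    ((((h.wL P).whiskerRight μ).whiskerLeft _).trans (Is3.of_eq e₄))))))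
  have R := (h.whiskerLeft (wR (wR μ P) P)).trans ((Is3.of_eq e₅).trans
    -- The inverse interchanger in the pentagon is the failure of `μ ⊙ 1` and `1 ⊙ μ` to commute
    -- strictly on four factors.
    ((((is3_interchanger μ μ).symm.whiskerRight μ).whiskerLeft _).trans ((Is3.of_eq e₆).trans
    ((h.whiskerLeft _).trans (Is3.of_eq e₇)))))
  exact L.whiskerRight_eq R (isIso_cell_comp (isIso_cell_wR (isIso_cell_wR hμ P) P)
    (isIso_cell_comp (isIso_cell_wR hμ P) hμ))

theorem triangle_whiskerRight (hμ : IsIso μ.cell) {ι : one M x ⟶ P} (hι : IsIso ι.cell)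
    {l : ι.deg ⋊ P.dom ≫ μ.deg ⟶ lu P.dom} {r : P.dom ⋉ ι.deg ≫ μ.deg ⟶ ru P.dom}
    (h : Is3 (wR μ P ≫ μ) ((α P P P).hom ≫ wL P μ ≫ μ) a)
    (hl : Is3 (wR ι P ≫ μ) (lun P).hom l) (hr : Is3 (wL P ι ≫ μ) (run P).hom r) :
    (eqToHom (by simp) ≫ (r ⋊₂ P.dom) ▷ μ.deg ≫ eqToHom (by simp)) ▷ P.val =
    (((P.dom ⋉ ι.deg) ⋊ P.dom) ◁ a ≫
      eqToHom (by simp) ≫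
      asc P.dom unit P.dom ◁ (P.dom ⋉₂ l) ▷ μ.deg ≫
      eqToHom (show _ = ru P.dom ⋊ P.dom ≫ μ.deg by simp)) ▷ P.val := by
  have e₁ : wR (wL P ι) P ≫ wR μ P ≫ μ = wR (wL P ι ≫ μ) P ≫ μ := by
    rw [wR_comp, Category.assoc]
  have e₂ : wR (wL P ι) P ≫ (α P P P).hom ≫ wL P μ ≫ μ =
      (α P (one M x) P).hom ≫ wL P (wR ι P ≫ μ) ≫ μ := by
    simp only [wL_comp, Category.assoc, reassoc_of% wL_wR_α]
  have e₃ : (α P (one M x) P).hom ≫ wL P (lun P).hom ≫ μ = wR (run P).hom P ≫ μ := by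
    rw [reassoc_of% triangle]
  -- The final reflexive 3-cell matches the trailing identity 2-cell in the triangle equation.
  have L := (Is3.of_eq e₁).trans (((hr.wR P).whiskerRight μ).trans (Is3.of_eq rfl))
  have R := (h.whiskerLeft (wR (wL P ι) P)).trans ((Is3.of_eq e₂).trans
    ((((hl.wL P).whiskerRight μ).whiskerLeft _).trans (Is3.of_eq e₃)))
  exact L.whiskerRight_eq R (isIso_cell_comp (isIso_cell_wR (isIso_cell_wL P hι) P)
    (isIso_cell_comp (isIso_cell_wR hμ P) hμ))

end Algebra

end El

namespace Central

open El

variable {M : EnrichedTwoCategory C Ob} {x y : Ob}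
variable {f : M.Mor x y} {P : C} {p : P ⟶ M.hom x x} {q : P ⟶ M.hom y y}
  {ϖ : p ≫ M.push x f ≅ q ≫ M.pull f y}

/-- The universal property gives a 3-cell in each direction. The two composites are identities
because they are so after whiskering with either projection, where invertibility of the given
2-cells allows cancellation. -/
theorem exists_iso_is3 (hϖ : IsTwoFiberProduct ϖ) {D : C}
    {c : D ⟶ M.hom x x} {d : D ⟶ M.hom y y}
    (Ω : of M (mor f) ≫ of M ⟨D, c⟩ ⟶ of M ⟨D, d⟩ ≫ of M (mor f)) {a b : D ⟶ P}
    {σ : c ⟶ a ≫ p} {τ : d ⟶ a ≫ q} {σ' : c ⟶ b ≫ p} {τ' : d ⟶ b ≫ q} (hσ : IsIso σ)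
    (hτ : IsIso τ) (hσ' : IsIso σ') (hτ' : IsIso τ')
    (h : Over Ω (square ϖ) (mkHom (U := ⟨D, c⟩) (V := ⟨P, p⟩) a σ)
      (mkHom (U := ⟨D, d⟩) (V := ⟨P, q⟩) a τ))
    (h' : Over Ω (square ϖ) (mkHom (U := ⟨D, c⟩) (V := ⟨P, p⟩) b σ')
      (mkHom (U := ⟨D, d⟩) (V := ⟨P, q⟩) b τ')) :
    ∃ θ : a ≅ b, Is3 (mkHom (U := ⟨D, c⟩) (V := ⟨P, p⟩) a σ) (mkHom b σ') θ.hom ∧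
      Is3 (mkHom (U := ⟨D, d⟩) (V := ⟨P, q⟩) a τ) (mkHom b τ') θ.hom := by
  obtain ⟨θ, ⟨h₁, h₂⟩, -⟩ := existsUnique_is3 hϖ Ω h h'
  obtain ⟨θ', ⟨h₁', h₂'⟩, -⟩ := existsUnique_is3 hϖ Ω h' h
  refine ⟨⟨θ, θ', hϖ.hom_ext ?_ ?_, hϖ.hom_ext ?_ ?_⟩, h₁, h₂⟩
  · rw [← cancel_epi σ, comp_whiskerRight, reassoc_of% h₁, h₁', id_whiskerRight, Category.comp_id]
  · rw [← cancel_epi τ, comp_whiskerRight, reassoc_of% h₂, h₂', id_whiskerRight, Category.comp_id]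
  · rw [← cancel_epi σ', comp_whiskerRight, reassoc_of% h₁', h₁, id_whiskerRight, Category.comp_id]
  · rw [← cancel_epi τ', comp_whiskerRight, reassoc_of% h₂', h₂, id_whiskerRight, Category.comp_id]

theorem existsUnique_algebraOn (hϖ : IsTwoFiberProduct ϖ) (μ : SquareLift ϖ (M.mulSquare f ϖ))
    (ι : SquareLift ϖ (M.oneSquare f)) :
    ∃! S : AlgebraOn μ.u ι.u,
      IsAlgebraHom ⟨P, μ.u, ι.u, S⟩ (M.endAlgebra x) p μ.ζ₁.symm ι.ζ₁.symm ∧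
      IsAlgebraHom ⟨P, μ.u, ι.u, S⟩ (M.endAlgebra y) q μ.ζ₂.symm ι.ζ₂.symm := by
  simp only [isAlgebraHom_iff]
  have hm := over_mul μ
  have hi := over_one ι
  have i₁ : IsIso (mkHom (U := (⟨P, p⟩ : M.El x x) ⊙ ⟨P, p⟩) (V := ⟨P, p⟩) μ.u μ.ζ₁.inv).cell :=
    Iso.isIso_inv _
  have i₂ : IsIso (mkHom (U := (⟨P, q⟩ : M.El y y) ⊙ ⟨P, q⟩) (V := ⟨P, q⟩) μ.u μ.ζ₂.inv).cell :=
    Iso.isIso_inv _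
  have i₃ : IsIso (mkHom (U := El.one M x) (V := ⟨P, p⟩) ι.u ι.ζ₁.inv).cell :=
    Iso.isIso_inv _
  have i₄ : IsIso (mkHom (U := El.one M y) (V := ⟨P, q⟩) ι.u ι.ζ₂.inv).cell :=
    Iso.isIso_inv _
  have ja₁ := isIso_cell_comp (isIso_cell_wR i₁ ⟨P, p⟩) i₁
  have ja₂ := isIso_cell_comp (isIso_cell_wR i₂ ⟨P, q⟩) i₂
  have jl₁ := isIso_cell_comp (isIso_cell_wR i₃ ⟨P, p⟩) i₁
  have jl₂ := isIso_cell_comp (isIso_cell_wR i₄ ⟨P, q⟩) i₂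
  have jr₁ := isIso_cell_comp (isIso_cell_wL ⟨P, p⟩ i₃) i₁
  have jr₂ := isIso_cell_comp (isIso_cell_wL ⟨P, q⟩ i₄) i₂
  -- The vertex is `(P ⊡ P) ⊡ P`; the common square is three copies of `ϖ` pasted together, supplied
  -- by `assoc_left` and `assoc_right`.
  obtain ⟨a, ha₁, ha₂⟩ := exists_iso_is3 hϖ _ ja₁ ja₂
    (isIso_cell_comp (isIso_cell_α _ _ _) (isIso_cell_comp (isIso_cell_wL _ i₁) i₁))
    (isIso_cell_comp (isIso_cell_α _ _ _) (isIso_cell_comp (isIso_cell_wL _ i₂) i₂))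
    hm.assoc_left hm.assoc_right
  obtain ⟨l, hl₁, hl₂⟩ := exists_iso_is3 hϖ _ jl₁ jl₂ (isIso_cell_lun _) (isIso_cell_lun _)
    (hm.unit_left hi) (Over.unit_left' (ω := square ϖ))
  obtain ⟨r, hr₁, hr₂⟩ := exists_iso_is3 hϖ _ jr₁ jr₂ (isIso_cell_run _) (isIso_cell_run _)
    (hm.unit_right hi) (Over.unit_right' (ω := square ϖ))
  refine ⟨⟨a, l, r,
    hϖ.hom_ext (pentagon_whiskerRight i₁ ha₁) (pentagon_whiskerRight i₂ ha₂),
    hϖ.hom_ext (triangle_whiskerRight i₁ i₃ ha₁ hl₁ hr₁)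
      (triangle_whiskerRight i₂ i₄ ha₂ hl₂ hr₂)⟩,
    ⟨⟨ha₁, hl₁, hr₁⟩, ha₂, hl₂, hr₂⟩, ?_⟩
  -- Pentagon and triangle are propositions, so uniqueness concerns the three isomorphisms only;
  -- each is determined after composing with both projections.
  rintro ⟨a', l', r', _, _⟩ ⟨⟨ha₁', hl₁', hr₁'⟩, ha₂', hl₂', hr₂'⟩
  obtain rfl : a' = a := Iso.ext
    (hϖ.hom_ext (ha₁'.whiskerRight_eq ha₁ ja₁) (ha₂'.whiskerRight_eq ha₂ ja₂))
  obtain rfl : l' = l := Iso.ext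
    (hϖ.hom_ext (hl₁'.whiskerRight_eq hl₁ jl₁) (hl₂'.whiskerRight_eq hl₂ jl₂))
  obtain rfl : r' = r := Iso.ext
    (hϖ.hom_ext (hr₁'.whiskerRight_eq hr₁ jr₁) (hr₂'.whiskerRight_eq hr₂ jr₂))
  rfl

end Central

end EnrichedTwoCategory

theorem mainTheorem3 {C : Type u} [Bicategory.{w, v} C] [Bicategory.Strict C] [GrayMonoid C]
    {Ob : Type t} (M : EnrichedTwoCategory C Ob) {x y : Ob} (f : M.Mor x y)
    {Af : C} {px : Af ⟶ M.hom x x} {py : Af ⟶ M.hom y y}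
    (ϖ : px ≫ M.push x f ≅ py ≫ M.pull f y) (hϖ : IsTwoFiberProduct ϖ) :
    Nonempty (SquareLift ϖ (M.mulSquare f ϖ)) ∧
    Nonempty (SquareLift ϖ (M.oneSquare f)) ∧
    ∀ (μ : SquareLift ϖ (M.mulSquare f ϖ)) (ι : SquareLift ϖ (M.oneSquare f)),
      ∃! S : AlgebraOn μ.u ι.u,
        IsAlgebraHom ⟨Af, μ.u, ι.u, S⟩ (M.endAlgebra x) px μ.ζ₁.symm ι.ζ₁.symm ∧
        IsAlgebraHom ⟨Af, μ.u, ι.u, S⟩ (M.endAlgebra y) py μ.ζ₂.symm ι.ζ₂.symm :=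
  ⟨hϖ.exists_lift _, hϖ.exists_lift _, EnrichedTwoCategory.Central.existsUnique_algebraOn hϖ⟩
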